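/- Let $k\in\mathbb N$, $0\le m<k$ real, $m\notin\{1,2,\dots\}$, $0<\alpha<1<\beta<2$, $a,b>0$; put $\Omega=(0,1)\times(-a,b)$, $\Omega_+=\Omega\cap\{y>0\}$, $\Omega_-=\Omega\cap\{y<0\}$. The Caputo derivatives with origin $0$ are $$ {}_CD^{\alpha}_{0y}u(x,y)=\frac1{\Gamma(1-\alpha)}\int_0^y\frac{u_z(x,z)}{(y-z)^{\alpha}}\,dz\quad(y>0),\qquad {}_CD^{\beta}_{0y}u(x,y)=\frac1{\Gamma(2-\beta)}\int_y^0\frac{u_{zz}(x,z)}{(z-y)^{\beta-1}}\,dz\quad(y<0). $$ **Problem D** (with data $\varphi:[0,1]\to\mathbb R$). Find $u:\overline\Omega\to\mathbb R$ such that * $\partial_x^{j}u\in C(\overline\Omega)$ for $0\le j\le 2k-1$; $\partial_x^{2k}u(x,y)$ exists for $0<x<1$, $-a\le y\le b$ and is continuous on $\Omega$; and $x^{m/2}\partial_x^{2k}u(\cdot,y)\in L_2(0,1)$ for every $y\in[-a,b]$; * for every $x\in(0,1)$, $u(x,\cdot)$ is differentiable on $(0,b)$ and twice differentiable on $(-a,0)$,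 the integrals defining ${}_CD^{\alpha}_{0y}u$ on $\Omega_+$ and ${}_CD^{\beta}_{0y}u$ on $\Omega_-$ converge absolutely, and ${}_CD^{\alpha}_{0y}u\in C(\Omega_+)$, ${}_CD^{\beta}_{0y}u\in C(\Omega_-)$; * ${}_CD^{\alpha}_{0y}u+(-1)^kx^m\partial_x^{2k}u=0$ in $\Omega_+$ and ${}_CD^{\beta}_{0y}u+(-1)^kx^m\partial_x^{2k}u=0$ in $\Omega_-$; * $\partial_x^{j}u(0,y)=\partial_x^{j}u(1,y)=0$ for $j=0,\dots,k-1$, $-a\le y\le b$; * for $0\le x\le1$ the one-sided limits exist and $u(x,+0)=u(x,-0)$, ${}_CD^{\alpha}_{0y}u(x,+0)=u_y(x,-0)$; * $u(x,b)-u(x,-a)=\varphi(x)$ for $0\le x\le 1$. Let $\lambda_1,\lambda_2,\dots$ be the eigenvalues of the problem $X^{(2k)}(x)=(-1)^k\lambda x^{-m}X(x)$ on $(0,1)$, $X^{(j)}(0)=X^{(j)}(1)=0$ $(j=0,\dots,k-1)$, i.e. the real $\lambda$ for which it has a solution $X\not\equiv0$ in $C^{2k-1}[0,1]\cap C^{2k}(0,1)$.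 With $E_{\mu,\eta}(z)=\sum_{s\ge0}z^s/\Gamma(\mu s+\eta)$ put $$\Delta(n)=E_{\alpha,1}(-\lambda_nb^\alpha)-\bigl(E_{\beta,1}(-\lambda_na^\beta)+a\lambda_nE_{\beta,2}(-\lambda_na^\beta)\bigr).$$ **Theorem.** The solution of Problem D is unique if and only if $\Delta(n)\ne0$ for every $n$. That is: Problem D has at most one solution for every $\varphi$ if and only if $\Delta(n)\neq 0$ for all $n$; and, for each individual $\varphi$ for which Problem D has a solution, that solution is the only one if and only if $\Delta(n)\ne0$ for all $n$. -/

import Mathlib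

open Set Filter Topology MeasureTheory

noncomputable section

namespace ProblemD

/-- The two-parameter Mittag-Leffler function `E_{μ,η}(z) = ∑ zⁿ / Γ(μ n + η)`. -/
def mittagLeffler (μ η z : ℝ) : ℝ :=
  ∑' n : ℕ, z ^ n / Real.Gamma (μ * n + η)

/-- The integral in the Caputo derivative of order `α ∈ (0,1)` with origin `0` exists on `(0,b)`:
`f` is differentiable on `(0,b)` and the defining integral converges absolutely at every
`y ∈ (0,b)`. -/
def CaputoPosExists (α b : ℝ) (f : ℝ → ℝ) : Prop :=
  (∀ z ∈ Ioo 0 b, DifferentiableAt ℝ f z) ∧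
  ∀ y ∈ Ioo 0 b, IntervalIntegrable (fun z => deriv f z / (y - z) ^ α) volume 0 y

/-- Caputo derivative of order `α ∈ (0,1)` with origin `0`, at a point `y > 0`. -/
def caputoPos (α : ℝ) (f : ℝ → ℝ) (y : ℝ) : ℝ :=
  1 / Real.Gamma (1 - α) * ∫ z in (0 : ℝ)..y, deriv f z / (y - z) ^ α

/-- The integral in the Caputo derivative of order `β ∈ (1,2)` with origin `0` exists on
`(-a,0)`: `f` is twice differentiable on `(-a,0)` and the defining integral converges absolutely
at every `y ∈ (-a,0)`. -/
def CaputoNegExists (β a : ℝ) (f : ℝ → ℝ) : Prop :=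
  (∀ z ∈ Ioo (-a) 0, DifferentiableAt ℝ f z ∧ DifferentiableAt ℝ (deriv f) z) ∧
  ∀ y ∈ Ioo (-a) 0,
    IntervalIntegrable (fun z => deriv (deriv f) z / (z - y) ^ (β - 1)) volume y 0

/-- Caputo derivative of order `β ∈ (1,2)` with origin `0`, at a point `y < 0`: the integral
over `(y,0)` is taken with positive orientation, so that
`(-y)^β` has derivative `Γ(β + 1)`. -/
def caputoNeg (β : ℝ) (f : ℝ → ℝ) (y : ℝ) : ℝ :=
  1 / Real.Gamma (2 - β) * ∫ z in y..(0 : ℝ), deriv (deriv f) z / (z - y) ^ (β - 1)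

/-- The partial derivative `∂ʲu/∂xʲ` at `(x,y)`, one-sided at `x = 0` and `x = 1`. -/
def dx (j : ℕ) (u : ℝ → ℝ → ℝ) (x y : ℝ) : ℝ :=
  iteratedDerivWithin j (fun s => u s y) (Icc 0 1) x

/-- `u` is a solution of Problem D with data `φ` in the rectangle `[0,1] × [-a,b]`. -/
structure IsSolution (k : ℕ) (m α β a b : ℝ) (φ : ℝ → ℝ) (u : ℝ → ℝ → ℝ) : Prop where
  /-- The `x`-derivatives up to order `2k-1` exist on the closed rectangle. -/
  contDiff_x : ∀ y ∈ Icc (-a) b,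
    ContDiffOn ℝ ((2 * k - 1 : ℕ) : WithTop ℕ∞) (fun x => u x y) (Icc 0 1)
  /-- They are jointly continuous on the closed rectangle. -/
  continuous_dx : ∀ j ≤ 2 * k - 1,
    ContinuousOn (fun p : ℝ × ℝ => dx j u p.1 p.2) (Icc 0 1 ×ˢ Icc (-a) b)
  /-- The `x`-derivative of order `2k` exists for `0 < x < 1`. -/
  differentiable_dx : ∀ y ∈ Icc (-a) b,
    DifferentiableOn ℝ (fun x => dx (2 * k - 1) u x y) (Ioo 0 1)
  /-- It is jointly continuous on the open rectangle. -/
  continuous_dx_top :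
    ContinuousOn (fun p : ℝ × ℝ => dx (2 * k) u p.1 p.2) (Ioo 0 1 ×ˢ Ioo (-a) b)
  memLp_dx_top : ∀ y ∈ Icc (-a) b,
    MemLp (fun x => x ^ (m / 2) * dx (2 * k) u x y) 2 (volume.restrict (Ioo 0 1))
  caputoPos_exists : ∀ x ∈ Ioo (0 : ℝ) 1, CaputoPosExists α b (u x)
  caputoNeg_exists : ∀ x ∈ Ioo (0 : ℝ) 1, CaputoNegExists β a (u x)
  continuous_caputoPos :
    ContinuousOn (fun p : ℝ × ℝ => caputoPos α (u p.1) p.2) (Ioo 0 1 ×ˢ Ioo 0 b)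
  continuous_caputoNeg :
    ContinuousOn (fun p : ℝ × ℝ => caputoNeg β (u p.1) p.2) (Ioo 0 1 ×ˢ Ioo (-a) 0)
  /-- The equation for `y > 0`. -/
  eq_pos : ∀ x ∈ Ioo (0 : ℝ) 1, ∀ y ∈ Ioo 0 b,
    caputoPos α (u x) y + (-1) ^ k * x ^ m * dx (2 * k) u x y = 0
  /-- The equation for `y < 0`. -/
  eq_neg : ∀ x ∈ Ioo (0 : ℝ) 1, ∀ y ∈ Ioo (-a) 0,
    caputoNeg β (u x) y + (-1) ^ k * x ^ m * dx (2 * k) u x y = 0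
  boundary : ∀ j < k, ∀ y ∈ Icc (-a) b, dx j u 0 y = 0 ∧ dx j u 1 y = 0
  /-- `u(x,+0) = u(x,-0)`. -/
  gluing : ∀ x ∈ Icc (0 : ℝ) 1, ∃ l : ℝ,
    Tendsto (u x) (𝓝[>] 0) (𝓝 l) ∧ Tendsto (u x) (𝓝[<] 0) (𝓝 l)
  /-- `D^α u(x,+0) = u_y(x,-0)`. -/
  gluing_deriv : ∀ x ∈ Icc (0 : ℝ) 1, ∃ l : ℝ,
    Tendsto (caputoPos α (u x)) (𝓝[>] 0) (𝓝 l) ∧ Tendsto (deriv (u x)) (𝓝[<] 0) (𝓝 l)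
  /-- The nonlocal condition. -/
  nonlocal : ∀ x ∈ Icc (0 : ℝ) 1, u x b - u x (-a) = φ x

/-- For the given data `φ`, Problem D has at most one solution (as a function on
`[0,1] × [-a,b]`). -/
def AtMostOneSolution (k : ℕ) (m α β a b : ℝ) (φ : ℝ → ℝ) : Prop :=
  ∀ u v : ℝ → ℝ → ℝ, IsSolution k m α β a b φ u → IsSolution k m α β a b φ v →
    ∀ x ∈ Icc (0 : ℝ) 1, ∀ y ∈ Icc (-a) b, u x y = v x y

/-- `lam` is an eigenvalue of `X⁽²ᵏ⁾ = (-1)ᵏ lam x⁻ᵐ X` on `(0,1)`,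
`X⁽ʲ⁾(0) = X⁽ʲ⁾(1) = 0` for `j < k`. -/
def IsEigenvalue (k : ℕ) (m lam : ℝ) : Prop :=
  ∃ X : ℝ → ℝ,
    ContDiffOn ℝ ((2 * k - 1 : ℕ) : WithTop ℕ∞) X (Icc 0 1) ∧
    ContDiffOn ℝ ((2 * k : ℕ) : WithTop ℕ∞) X (Ioo 0 1) ∧
    (∀ x ∈ Ioo (0 : ℝ) 1, iteratedDeriv (2 * k) X x = (-1) ^ k * lam * x ^ (-m) * X x) ∧
    (∀ j < k, iteratedDerivWithin j X (Icc 0 1) 0 = 0 ∧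
      iteratedDerivWithin j X (Icc 0 1) 1 = 0) ∧
    ∃ x ∈ Ioo (0 : ℝ) 1, X x ≠ 0

/-- `E_{α,1}(-lam b^α) - (E_{β,1}(-lam a^β) + a lam E_{β,2}(-lam a^β))`. -/
def Delta (α β a b lam : ℝ) : ℝ :=
  mittagLeffler α 1 (-lam * b ^ α) -
    (mittagLeffler β 1 (-lam * a ^ β) + a * lam * mittagLeffler β 2 (-lam * a ^ β))

end ProblemD

end

open Set Filter Topology MeasureTheory
open scoped InnerProductSpace BoundedContinuousFunction

noncomputable section

namespace ProblemD

/-! Pair a solution `u` with zero data against an eigenfunction `X` in the weight `x ^ (-m)`, giving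
`c(y) = ∫ x ^ (-m) X u(x,y) dx`. Integration by parts `2k` times leaves no boundary terms, because
each of them pairs derivatives whose orders add up to `2k - 1`, so that one order is below `k`.
Hence `c` solves the fractional equations `D^α c = -lam c` for `y > 0` and `D^β c = -lam c` for `y <
0`. The gluing conditions make `c` continuous at `0` with left derivative `-lam c(0)`, so `c` equals
`c(0)` times an explicit Mittag-Leffler profile, and the nonlocal condition becomes `c(0) Δ(lam) =
0`. If no `Δ` vanishes, every coefficient is zero (`coeff_eq_zero`), and completeness of the
eigenfunctions (`eq_zero_of_forall_eigenfunction`) gives `u = 0`. Conversely, if `Δ(lam) = 0`, then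
profile times `X` is a nonzero solution with zero data (`isSolution_profile_mul`), which can be
added to any given solution.

The coefficient `c` is never differentiated in `y`. The equation is first integrated fractionally in
`y` at fixed `x`, then tested against `X` on compact subintervals of `(0,1)`, and Green's identity
is used before letting these intervals grow. The result is a pair of Volterra equations
(`coeff_volterra_pos`, `coeff_volterra_neg`) whose continuous solutions are unique
(`eq_of_volterra`).

Completeness is variational. With `V` integration from `0`, a function with zero boundary data is
`V^k h`, where `h`, its `k`-th derivative, is orthogonal in `L²(0,1)` to polynomials of degree below
`k`. On that orthogonal complement let `T h = x ^ (-m/2) V^k h`. The operator `T* T` is compact,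
symmetric and injective, so its eigenvectors span a dense subspace; an eigenvector with eigenvalue
`μ` is the `k`-th derivative of a classical eigenfunction with `lam = 1/μ`
(`exists_isEigenfunction`). -/

/-! ### Riemann–Liouville kernels and fractional integrals -/

/-- The Riemann–Liouville kernel `t ^ (μ - 1) / Γ(μ)`. -/
def rlKernel (μ t : ℝ) : ℝ := t ^ (μ - 1) / Real.Gamma μ

/-- The Riemann–Liouville fractional integral of order `μ` with origin `0`. -/
def fracInt (μ : ℝ) (f : ℝ → ℝ) (y : ℝ) : ℝ :=
  ∫ z in (0 : ℝ)..y, rlKernel μ (y - z) * f z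

lemma rlKernel_nonneg {μ t : ℝ} (hμ : 0 < μ) (ht : 0 ≤ t) : 0 ≤ rlKernel μ t :=
  div_nonneg (Real.rpow_nonneg ht _) (Real.Gamma_pos_of_pos hμ).le

lemma rlKernel_pos {μ t : ℝ} (hμ : 0 < μ) (ht : 0 < t) : 0 < rlKernel μ t :=
  div_pos (Real.rpow_pos_of_pos ht _) (Real.Gamma_pos_of_pos hμ)

lemma rlKernel_one (t : ℝ) : rlKernel 1 t = 1 := by simp [rlKernel]

lemma rlKernel_two (t : ℝ) : rlKernel 2 t = t := by
  norm_num [rlKernel, Real.Gamma_two]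

lemma measurable_rlKernel (μ : ℝ) : Measurable (rlKernel μ) := by
  unfold rlKernel; fun_prop

/-- This is the scaled Beta integral; the Gamma normalisation of the kernels absorbs all constants.
-/
lemma integral_rlKernel_mul {μ ν y : ℝ} (hμ : 0 < μ) (hν : 0 < ν) (hy : 0 < y) :
    ∫ z in (0 : ℝ)..y, rlKernel μ (y - z) * rlKernel ν z = rlKernel (μ + ν) y := by
  have h := Complex.betaIntegral_scaled ν μ hy
  have hb := ProbabilityTheory.beta_eq_betaIntegralReal ν μ hν hμ
  have e : ∫ x in (0 : ℝ)..y, (x : ℂ) ^ ((ν : ℂ) - 1) * ((y : ℂ) - x) ^ ((μ : ℂ) - 1)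
      = ((∫ x in (0 : ℝ)..y, x ^ (ν - 1) * (y - x) ^ (μ - 1) : ℝ) : ℂ) := by
    rw [← intervalIntegral.integral_ofReal]
    refine intervalIntegral.integral_congr fun x hx => ?_
    rw [uIcc_of_le hy.le] at hx
    simp only [Complex.ofReal_mul]
    rw [Complex.ofReal_cpow hx.1, Complex.ofReal_cpow (sub_nonneg.2 hx.2)]
    push_cast; rfl
  rw [e] at h
  have h2 : ((y : ℂ) ^ ((ν : ℂ) + μ - 1)) = ((y ^ (ν + μ - 1) : ℝ) : ℂ) := by
    rw [Complex.ofReal_cpow hy.le]; push_cast; rfl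
  rw [h2] at h
  have h3 := congrArg Complex.re h
  rw [Complex.re_ofReal_mul, ← hb, Complex.ofReal_re] at h3
  have hG1 := (Real.Gamma_pos_of_pos hμ).ne'
  have hG2 := (Real.Gamma_pos_of_pos hν).ne'
  have : ∀ z, rlKernel μ (y - z) * rlKernel ν z
      = (1 / (Real.Gamma μ * Real.Gamma ν)) * (z ^ (ν - 1) * (y - z) ^ (μ - 1)) := by
    intro z; unfold rlKernel; field_simp
  simp_rw [this]
  rw [intervalIntegral.integral_const_mul, h3, ProbabilityTheory.beta, rlKernel, add_comm ν μ]
  field_simp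

lemma intervalIntegrable_rlKernel_mul {μ ν y : ℝ} (hμ : 0 < μ) (hν : 0 < ν) (hy : 0 < y) :
    IntervalIntegrable (fun z => rlKernel μ (y - z) * rlKernel ν z) volume 0 y := by
  -- A non-integrable function has integral `0` by default, so a positive value of the integral
  -- certifies integrability.
  apply intervalIntegral.intervalIntegrable_of_integral_ne_zero
  rw [integral_rlKernel_mul hμ hν hy]
  exact (rlKernel_pos (add_pos hμ hν) hy).ne'

lemma intervalIntegrable_rlKernel_sub {μ y : ℝ} (hμ : 0 < μ) (hy : 0 < y) :
    IntervalIntegrable (fun z => rlKernel μ (y - z)) volume 0 y := by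
  simpa [rlKernel_one] using intervalIntegrable_rlKernel_mul hμ one_pos hy

lemma integral_rlKernel_mul_shift {μ ν z y : ℝ} (hμ : 0 < μ) (hν : 0 < ν) (hy : z < y) :
    ∫ s in z..y, rlKernel μ (y - s) * rlKernel ν (s - z) = rlKernel (μ + ν) (y - z) := by
  rw [← integral_rlKernel_mul hμ hν (sub_pos.2 hy)]
  have := intervalIntegral.integral_comp_sub_right (a := z) (b := y)
    (fun s => rlKernel μ (y - z - s) * rlKernel ν s) z
  simpa using this

lemma intervalIntegrable_rlKernel_mul_shift {μ ν z y : ℝ} (hμ : 0 < μ) (hν : 0 < ν) (hy : z < y) :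
    IntervalIntegrable (fun s => rlKernel μ (y - s) * rlKernel ν (s - z)) volume z y := by
  apply intervalIntegral.intervalIntegrable_of_integral_ne_zero
  rw [integral_rlKernel_mul_shift hμ hν hy]
  exact (rlKernel_pos (add_pos hμ hν) (sub_pos.2 hy)).ne'

/-- Semigroup property of fractional integration. -/
lemma fracInt_fracInt {μ ν y : ℝ} {f : ℝ → ℝ} (hμ : 0 < μ) (hν : 0 < ν) (hy : 0 < y)
    (hfm : AEStronglyMeasurable f (volume.restrict (Ioc 0 y)))
    (hf : IntervalIntegrable (fun z => rlKernel (μ + ν) (y - z) * f z) volume 0 y) :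
    fracInt μ (fracInt ν f) y = fracInt (μ + ν) f y := by
  -- The integrand on the triangle `0 < z < s < y`, extended by zero so that both iterated integrals
  -- use the same measure.
  set G : ℝ → ℝ → ℝ := fun s z =>
    (Ioo z y).indicator (fun s => rlKernel μ (y - s) * rlKernel ν (s - z)) s * f z with hG
  set P := volume.restrict (Ioc (0 : ℝ) y) with hP
  have hsub : ∀ z ∈ Ioo 0 y, Ioo z y ∩ Ioc 0 y = Ioo z y := fun z hz =>
    inter_eq_self_of_subset_left fun s hs => ⟨hz.1.trans hs.1, hs.2.le⟩
  have hGs : ∀ z ∈ Ioo 0 y, ∫ s, G s z ∂P = rlKernel (μ + ν) (y - z) * f z := by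
    intro z hz
    simp only [hG]
    rw [integral_mul_const, integral_indicator measurableSet_Ioo, hP,
      Measure.restrict_restrict measurableSet_Ioo,
      hsub z hz,
      ← integral_Ioc_eq_integral_Ioo, ← intervalIntegral.integral_of_le hz.2.le,
      integral_rlKernel_mul_shift hμ hν hz.2]
  have hGi : ∀ z ∈ Ioo 0 y, Integrable (fun s => G s z) P := by
    intro z hz
    simp only [hG]
    refine Integrable.mul_const ?_ _
    rw [integrable_indicator_iff measurableSet_Ioo, hP, IntegrableOn,
      Measure.restrict_restrict measurableSet_Ioo,
      hsub z hz]
    have := intervalIntegrable_rlKernel_mul_shift hμ hν hz.2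
    rw [intervalIntegrable_iff_integrableOn_Ioo_of_le hz.2.le] at this
    exact this
  have hnn : ∀ s z, 0 ≤ (Ioo z y).indicator (fun s => rlKernel μ (y - s) * rlKernel ν (s - z)) s := by
    intro s z
    refine indicator_nonneg (fun s hs => ?_) s
    exact mul_nonneg (rlKernel_nonneg hμ (sub_nonneg.2 hs.2.le))
      (rlKernel_nonneg hν (sub_nonneg.2 hs.1.le))
  have hae : ∀ᵐ z ∂P, z ∈ Ioo 0 y := by
    rw [hP, ← Measure.restrict_congr_set Ioo_ae_eq_Ioc]
    exact ae_restrict_mem measurableSet_Ioo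
  have hf' : Integrable (fun z => rlKernel (μ + ν) (y - z) * f z) P := by
    rwa [intervalIntegrable_iff_integrableOn_Ioc_of_le hy.le] at hf
  -- The kernels are nonnegative, so the `s`-integral of `|G|` is exactly the absolute value of the
  -- integrand in `hf`; Fubini needs no further bound.
  have hint : Integrable (Function.uncurry G) (P.prod P) := by
    rw [integrable_prod_iff']
    · constructor
      · filter_upwards [hae] with z hz using hGi z hz
      · refine hf'.norm.congr ?_
        filter_upwards [hae] with z hz
        have : ∀ s, ‖Function.uncurry G (s, z)‖ =
            (Ioo z y).indicator (fun s => rlKernel μ (y - s) * rlKernel ν (s - z)) s * ‖f z‖ := by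
          intro s
          simp only [Function.uncurry, hG]
          rw [norm_mul, Real.norm_of_nonneg (hnn s z)]
        simp_rw [this]
        rw [integral_mul_const, norm_mul,
          Real.norm_of_nonneg (rlKernel_nonneg (add_pos hμ hν) (sub_nonneg.2 hz.2.le))]
        congr 1
        rw [integral_indicator measurableSet_Ioo, hP,
          Measure.restrict_restrict measurableSet_Ioo,
          hsub z hz,
          ← integral_Ioc_eq_integral_Ioo, ← intervalIntegral.integral_of_le hz.2.le,
          integral_rlKernel_mul_shift hμ hν hz.2]
    · refine AEStronglyMeasurable.mul ?_ hfm.comp_snd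
      have hset : MeasurableSet {p : ℝ × ℝ | p.2 < p.1 ∧ p.1 < y} :=
        (measurableSet_lt measurable_snd measurable_fst).inter
          (measurableSet_lt measurable_fst measurable_const)
      have hme : Measurable fun p : ℝ × ℝ => rlKernel μ (y - p.1) * rlKernel ν (p.1 - p.2) :=
        ((measurable_rlKernel μ).comp (measurable_const.sub measurable_fst)).mul
          ((measurable_rlKernel ν).comp (measurable_fst.sub measurable_snd))
      exact (hme.indicator hset).aestronglyMeasurable
  have hswap := integral_integral_swap hint
  unfold fracInt
  rw [intervalIntegral.integral_of_le hy.le, intervalIntegral.integral_of_le hy.le]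
  have e1 : ∫ s in Ioc 0 y, rlKernel μ (y - s) * ∫ z in (0 : ℝ)..s, rlKernel ν (s - z) * f z
      = ∫ s, ∫ z, G s z ∂P ∂P := by
    refine integral_congr_ae ?_
    filter_upwards [hae] with s hs
    have : ∀ z, G s z = (Iio s).indicator (fun z => rlKernel μ (y - s) * (rlKernel ν (s - z) * f z)) z := by
      intro z
      simp only [hG, indicator, mem_Ioo, mem_Iio, hs.2, and_true]
      split_ifs <;> ring
    simp_rw [this]
    rw [integral_indicator measurableSet_Iio, hP, Measure.restrict_restrict measurableSet_Iio,
      integral_const_mul, intervalIntegral.integral_of_le hs.1.le, integral_Ioc_eq_integral_Ioo]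
    congr 3
    ext z
    simp only [mem_Ioo, mem_inter_iff, mem_Iio, mem_Ioc]
    constructor
    · rintro ⟨h1, h2⟩; exact ⟨h2, h1, (h2.trans hs.2).le⟩
    · rintro ⟨h1, h2, _⟩; exact ⟨h2, h1⟩
  rw [e1, hswap]
  refine integral_congr_ae ?_
  filter_upwards [hae] with z hz using hGs z hz

/-! ### Mittag-Leffler series and the uniqueness of Volterra equations -/

/-- Euler's integral is restricted to `(R, ∞)`, where the power is at least `R ^ (s - 1)`. As `R` is
free, `Γ` beats every geometric sequence. -/
lemma rpow_mul_exp_neg_le_Gamma {R s : ℝ} (hR : 0 < R) (hs : 1 ≤ s) :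
    R ^ (s - 1) * Real.exp (-R) ≤ Real.Gamma s := by
  rw [Real.Gamma_eq_integral (by linarith), ← integral_exp_neg_Ioi R, ← integral_const_mul]
  have hi := Real.GammaIntegral_convergent (s := s) (by linarith)
  calc ∫ x in Ioi R, R ^ (s - 1) * Real.exp (-x)
      ≤ ∫ x in Ioi R, Real.exp (-x) * x ^ (s - 1) := by
        refine setIntegral_mono_on ((integrableOn_exp_neg_Ioi R).const_mul _)
          (hi.mono_set (Ioi_subset_Ioi hR.le)) measurableSet_Ioi fun x hx => ?_
        rw [mul_comm]
        gcongr
        exact le_of_lt hx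
    _ ≤ _ := by
        refine setIntegral_mono_set hi ?_ (Ioi_subset_Ioi hR.le).eventuallyLE
        filter_upwards [ae_restrict_mem measurableSet_Ioi] with x hx
        have : (0 : ℝ) < x := hx
        simp only [Pi.zero_apply]
        positivity

lemma summable_pow_div_Gamma {θ : ℝ} (hθ : 0 < θ) (η z : ℝ) :
    Summable fun n : ℕ => |z| ^ n / Real.Gamma (θ * n + η) := by
  -- Chosen so that `R ^ θ = 2|z| + 1`, which makes the series comparable to a geometric one of
  -- ratio `|z| / (2|z| + 1) < 1`.
  set R := (2 * |z| + 1) ^ (1 / θ) with hR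
  have hz := abs_nonneg z
  have hR0 : 0 < R := Real.rpow_pos_of_pos (by linarith) _
  have hRθ : R ^ θ = 2 * |z| + 1 := by
    rw [hR, ← Real.rpow_mul (by linarith)]
    field_simp
    simp
  have hq : |z| / (2 * |z| + 1) < 1 := by rw [div_lt_one (by linarith)]; linarith
  have hgeo := (summable_geometric_of_lt_one (by positivity) hq).mul_left
    (Real.exp R * R ^ (1 - η))
  refine hgeo.of_norm_bounded_eventually_nat ?_
  have htend : Tendsto (fun n : ℕ => θ * n + η) atTop atTop :=
    tendsto_atTop_add_const_right _ _ (tendsto_natCast_atTop_atTop.const_mul_atTop hθ)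
  filter_upwards [htend.eventually_ge_atTop 1] with n hn
  have hΓ := Real.Gamma_pos_of_pos (show 0 < θ * n + η by linarith)
  rw [Real.norm_of_nonneg (by positivity), div_le_iff₀ hΓ]
  refine le_trans ?_ (mul_le_mul_of_nonneg_left (rpow_mul_exp_neg_le_Gamma hR0 hn) (by positivity))
  have : R ^ (θ * n + η - 1) = (2 * |z| + 1) ^ n * R ^ (-(1 - η)) := by
    rw [show θ * n + η - 1 = θ * n + (-(1 - η)) by ring, Real.rpow_add hR0, Real.rpow_mul hR0.le,
      hRθ, Real.rpow_natCast]
  rw [this, Real.rpow_neg hR0.le, div_pow, Real.exp_neg]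
  have h1 := Real.rpow_pos_of_pos hR0 (1 - η)
  have h2 := Real.exp_pos R
  field_simp
  rfl

/-- A bounded solution of the homogeneous Volterra equation `v = c I^μ v` vanishes. -/
lemma eq_zero_of_eq_const_mul_fracInt {μ c T M : ℝ} {v : ℝ → ℝ} (hμ : 0 < μ)
    (hM : ∀ t ∈ Ioo 0 T, |v t| ≤ M) (hv : ∀ t ∈ Ioo 0 T, v t = c * fracInt μ v t) :
    ∀ t ∈ Ioo 0 T, v t = 0 := by
  -- Picard iteration: each use of the equation feeds the bound through `I^μ`, which raises the
  -- kernel order by `μ`. The bounds are multiples of the terms of a convergent Mittag-Leffler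
  -- series, hence tend to `0`.
  have key : ∀ n : ℕ, ∀ t ∈ Ioo 0 T, |v t| ≤ M * |c| ^ n * rlKernel (μ * n + 1) t := by
    intro n
    induction n with
    | zero => intro t ht; simpa [rlKernel_one] using hM t ht
    | succ n ih =>
      intro t ht
      have hp : 0 < μ * n + 1 := by positivity
      have hb : |fracInt μ v t| ≤ ∫ z in (0 : ℝ)..t,
          M * |c| ^ n * (rlKernel μ (t - z) * rlKernel (μ * n + 1) z) := by
        rw [← Real.norm_eq_abs]
        refine intervalIntegral.norm_integral_le_of_norm_le ht.1.le ?_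
          ((intervalIntegrable_rlKernel_mul hμ hp ht.1).const_mul _)
        filter_upwards with z hz
        have h0 := rlKernel_nonneg hμ (sub_nonneg.2 hz.2)
        rw [norm_mul, Real.norm_of_nonneg h0, Real.norm_eq_abs]
        have := mul_le_mul_of_nonneg_left (ih z ⟨hz.1, hz.2.trans_lt ht.2⟩) h0
        linarith
      rw [intervalIntegral.integral_const_mul, integral_rlKernel_mul hμ hp ht.1] at hb
      rw [hv t ht, abs_mul]
      have := mul_le_mul_of_nonneg_left hb (abs_nonneg c)
      rw [show μ * ((n + 1 : ℕ) : ℝ) + 1 = μ + (μ * n + 1) by push_cast; ring, pow_succ]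
      linarith
  intro t ht
  have hs := summable_pow_div_Gamma hμ 1 (|c| * t ^ μ)
  have hlim : Tendsto (fun n : ℕ => M * |c| ^ n * rlKernel (μ * n + 1) t) atTop (𝓝 0) := by
    have := hs.tendsto_atTop_zero.const_mul M
    rw [mul_zero] at this
    refine this.congr fun n => ?_
    have h1 : 0 ≤ t ^ μ := Real.rpow_nonneg ht.1.le _
    rw [rlKernel, abs_of_nonneg (by positivity), mul_pow, ← Real.rpow_natCast (t ^ μ),
      ← Real.rpow_mul ht.1.le, add_sub_cancel_right]
    ring
  exact abs_nonpos_iff.1 (ge_of_tendsto' hlim fun n => key n t ht)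

/-- The function `t ^ (η - 1) E_{θ,η}(-lam t ^ θ)`, as a series of Riemann–Liouville kernels. -/
def mlKernel (θ η lam t : ℝ) : ℝ := ∑' n : ℕ, (-lam) ^ n * rlKernel (θ * n + η) t

lemma rlKernel_series_term {θ η t : ℝ} (ht : 0 < t) (c : ℝ) (n : ℕ) :
    c ^ n * rlKernel (θ * n + η) t = t ^ (η - 1) * ((c * t ^ θ) ^ n / Real.Gamma (θ * n + η)) := by
  rw [rlKernel, show θ * (n : ℝ) + η - 1 = θ * n + (η - 1) by ring, Real.rpow_add ht,
    Real.rpow_mul ht.le, Real.rpow_natCast, mul_pow]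
  ring

lemma summable_rlKernel {θ : ℝ} (hθ : 0 < θ) (η c : ℝ) {t : ℝ} (ht : 0 < t) :
    Summable fun n : ℕ => |c| ^ n * rlKernel (θ * n + η) t := by
  simp_rw [rlKernel_series_term ht]
  have := (summable_pow_div_Gamma hθ η (|c| * t ^ θ)).mul_left (t ^ (η - 1))
  rwa [abs_of_nonneg (by positivity : 0 ≤ |c| * t ^ θ)] at this

lemma summable_rlKernel' {θ η : ℝ} (hθ : 0 < θ) (hη : 0 < η) (c : ℝ) {t : ℝ} (ht : 0 < t) :
    Summable fun n : ℕ => c ^ n * rlKernel (θ * n + η) t := by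
  refine (summable_rlKernel hθ η c ht).of_norm_bounded fun n => ?_
  rw [norm_mul, norm_pow, Real.norm_eq_abs, Real.norm_of_nonneg (rlKernel_nonneg (by positivity) ht.le)]

lemma mlKernel_eq {θ η t : ℝ} (ht : 0 < t) (lam : ℝ) :
    mlKernel θ η lam t = t ^ (η - 1) * mittagLeffler θ η (-lam * t ^ θ) := by
  simp_rw [mlKernel, mittagLeffler, rlKernel_series_term ht, tsum_mul_left]

lemma continuous_mittagLeffler {θ η : ℝ} (hθ : 0 < θ) (hη : 0 < η) :
    Continuous (mittagLeffler θ η) := by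
  rw [continuous_iff_continuousAt]
  intro z
  have h : ContinuousOn (mittagLeffler θ η) (Ioo (-(|z| + 1)) (|z| + 1)) := by
    refine continuousOn_tsum (fun n => by fun_prop) (summable_pow_div_Gamma hθ η (|z| + 1))
      fun n x hx => ?_
    have hΓ := Real.Gamma_pos_of_pos (show 0 < θ * n + η by positivity)
    rw [norm_div, norm_pow, Real.norm_of_nonneg hΓ.le, Real.norm_eq_abs]
    have hxz : |x| ≤ |(|z| + 1)| := by
      rw [abs_of_nonneg (by positivity : 0 ≤ |z| + 1)]
      exact abs_le.2 ⟨hx.1.le, hx.2.le⟩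
    exact div_le_div_of_nonneg_right (pow_le_pow_left₀ (abs_nonneg x) hxz n) hΓ.le
  refine h.continuousAt (Ioo_mem_nhds ?_ ?_)
  · linarith [neg_abs_le z]
  · linarith [le_abs_self z]

lemma mittagLeffler_zero (θ η : ℝ) : mittagLeffler θ η 0 = 1 / Real.Gamma η := by
  rw [mittagLeffler, tsum_eq_single 0 (fun n hn => by simp [hn])]
  simp

lemma continuousOn_mlKernel {θ η : ℝ} (hθ : 0 < θ) (hη : 0 < η) (lam : ℝ) :
    ContinuousOn (mlKernel θ η lam) (Ioi 0) := by
  refine ContinuousOn.congr (f := fun t => t ^ (η - 1) * mittagLeffler θ η (-lam * t ^ θ)) ?_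
    fun t ht => mlKernel_eq ht lam
  refine (continuousOn_id.rpow_const fun x hx => Or.inl (ne_of_gt hx)).mul ?_
  exact ((continuous_mittagLeffler hθ hη).comp
    (continuous_const.mul (Real.continuous_rpow_const hθ.le))).continuousOn

lemma tendsto_mlKernel_zero {θ η : ℝ} (hθ : 0 < θ) (hη : 1 < η) (lam : ℝ) :
    Tendsto (mlKernel θ η lam) (𝓝[>] 0) (𝓝 0) := by
  have hc : Continuous fun t : ℝ => t ^ (η - 1) * mittagLeffler θ η (-lam * t ^ θ) :=
    (Real.continuous_rpow_const (by linarith)).mul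
      ((continuous_mittagLeffler hθ (by linarith)).comp
        (continuous_const.mul (Real.continuous_rpow_const hθ.le)))
  have h0 := (hc.tendsto 0).mono_left (nhdsWithin_le_nhds (s := Ioi 0))
  rw [Real.zero_rpow (by linarith), zero_mul] at h0
  refine h0.congr' ?_
  filter_upwards [self_mem_nhdsWithin] with t ht using (mlKernel_eq ht lam).symm

/-- At `0` the function `mlKernel θ η lam` is as singular as `rlKernel η`: on `t > 0` the quotient
extends continuously to `0`. -/
lemma intervalIntegrable_rlKernel_mul_mlKernel {μ θ η t : ℝ} (hμ : 0 < μ) (hθ : 0 < θ)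
    (hη : 0 < η) (lam : ℝ) (ht : 0 < t) :
    IntervalIntegrable (fun z => rlKernel μ (t - z) * mlKernel θ η lam z) volume 0 t := by
  have hc : Continuous fun t : ℝ => Real.Gamma η * mittagLeffler θ η (-lam * t ^ θ) :=
    continuous_const.mul ((continuous_mittagLeffler hθ hη).comp
        (continuous_const.mul (Real.continuous_rpow_const hθ.le)))
  refine ((intervalIntegrable_rlKernel_mul hμ hη ht).mul_continuousOn hc.continuousOn).congr ?_
  intro z hz
  rw [uIoc_of_le ht.le] at hz
  have := (Real.Gamma_pos_of_pos hη).ne'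
  simp only [mlKernel_eq hz.1, rlKernel]
  field_simp

/-- Termwise Beta integrals: fractional integration merely shifts the second index. The interchange
is allowed because the norms sum to the same kind of series with `|-lam|`. -/
lemma fracInt_mlKernel {μ θ η t : ℝ} (hμ : 0 < μ) (hθ : 0 < θ) (hη : 0 < η) (lam : ℝ)
    (ht : 0 < t) : fracInt μ (mlKernel θ η lam) t = mlKernel θ (η + μ) lam t := by
  have hp : ∀ n : ℕ, 0 < θ * n + η := fun n => by positivity
  set F : ℕ → ℝ → ℝ := fun n z => (-lam) ^ n * (rlKernel μ (t - z) * rlKernel (θ * n + η) z)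
  have hFi : ∀ n, ∫ z in Ioc 0 t, F n z = (-lam) ^ n * rlKernel (θ * n + (η + μ)) t := by
    intro n
    rw [← intervalIntegral.integral_of_le ht.le, intervalIntegral.integral_const_mul,
      integral_rlKernel_mul hμ (hp n) ht]
    congr 2; ring
  have hFn : ∀ n, ∫ z in Ioc 0 t, ‖F n z‖ = |-lam| ^ n * rlKernel (θ * n + (η + μ)) t := by
    intro n
    have : ∫ z in Ioc 0 t, ‖F n z‖ = ∫ z in Ioc 0 t,
        |-lam| ^ n * (rlKernel μ (t - z) * rlKernel (θ * n + η) z) := by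
      refine setIntegral_congr_fun measurableSet_Ioc fun z hz => ?_
      simp only [F]
      rw [norm_mul, norm_pow, Real.norm_eq_abs, Real.norm_of_nonneg]
      exact mul_nonneg (rlKernel_nonneg hμ (sub_nonneg.2 hz.2)) (rlKernel_nonneg (hp n) hz.1.le)
    rw [this, ← intervalIntegral.integral_of_le ht.le, intervalIntegral.integral_const_mul,
      integral_rlKernel_mul hμ (hp n) ht]
    congr 2; ring
  have h := hasSum_integral_of_summable_integral_norm (μ := volume.restrict (Ioc 0 t)) (F := F)
    (fun n => by
      have := (intervalIntegrable_rlKernel_mul hμ (hp n) ht).const_mul ((-lam) ^ n)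
      rwa [intervalIntegrable_iff_integrableOn_Ioc_of_le ht.le] at this)
    (by simp_rw [hFn]; exact summable_rlKernel hθ _ _ ht)
  simp_rw [hFi] at h
  rw [mlKernel, h.tsum_eq, fracInt, intervalIntegral.integral_of_le ht.le]
  refine setIntegral_congr_fun measurableSet_Ioc fun z hz => ?_
  simp only [F, mlKernel]
  rw [← tsum_mul_left]
  congr 1; ext n; ring

/-- Splitting off the term `n = 0` and reindexing; together with `fracInt_mlKernel` this is a
Volterra equation for `mlKernel`. -/
lemma mlKernel_eq_sub {θ η t : ℝ} (hθ : 0 < θ) (hη : 0 < η) (lam : ℝ) (ht : 0 < t) :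
    mlKernel θ η lam t = rlKernel η t - lam * mlKernel θ (η + θ) lam t := by
  rw [mlKernel, (summable_rlKernel' hθ hη (-lam) ht).tsum_eq_zero_add, mlKernel, ← tsum_mul_left]
  simp only [pow_zero, one_mul, Nat.cast_zero, mul_zero, zero_add]
  rw [sub_eq_add_neg, ← tsum_neg]
  congr 2; ext n
  rw [show θ * ((n + 1 : ℕ) : ℝ) + η = θ * n + (η + θ) by push_cast; ring]
  ring

/-- Raising the index by `1` is integration of order `1`, so the fundamental theorem of calculus
replaces termwise differentiation. -/
lemma hasDerivAt_mlKernel {θ η t : ℝ} (hθ : 0 < θ) (hη : 0 < η) (lam : ℝ) (ht : 0 < t) :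
    HasDerivAt (mlKernel θ (η + 1) lam) (mlKernel θ η lam t) t := by
  have e : ∀ s, 0 < s → mlKernel θ (η + 1) lam s = ∫ z in (0 : ℝ)..s, mlKernel θ η lam z := by
    intro s hs
    rw [← fracInt_mlKernel one_pos hθ hη lam hs, fracInt]
    simp [rlKernel_one]
  have hi : IntervalIntegrable (mlKernel θ η lam) volume 0 t := by
    simpa [rlKernel_one] using intervalIntegrable_rlKernel_mul_mlKernel one_pos hθ hη lam ht
  have hc := continuousOn_mlKernel hθ hη lam
  have := intervalIntegral.integral_hasDerivAt_right hi
    (hc.stronglyMeasurableAtFilter isOpen_Ioi t ht) (hc.continuousAt (Ioi_mem_nhds ht))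
  refine this.congr_of_eventuallyEq ?_
  filter_upwards [Ioi_mem_nhds ht] with s hs using e s hs

/-! ### The time profiles and the equations they satisfy -/

lemma fracInt_congr {μ t : ℝ} {f g : ℝ → ℝ} (ht : 0 ≤ t) (h : ∀ z ∈ Ioo 0 t, f z = g z) :
    fracInt μ f t = fracInt μ g t := by
  rw [fracInt, fracInt, intervalIntegral.integral_of_le ht, intervalIntegral.integral_of_le ht,
    integral_Ioc_eq_integral_Ioo, integral_Ioc_eq_integral_Ioo]
  refine setIntegral_congr_fun measurableSet_Ioo fun z hz => ?_
  simp only [h z hz]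

lemma fracInt_add_mul {μ t c d : ℝ} {f g : ℝ → ℝ}
    (hf : IntervalIntegrable (fun z => rlKernel μ (t - z) * f z) volume 0 t)
    (hg : IntervalIntegrable (fun z => rlKernel μ (t - z) * g z) volume 0 t) :
    fracInt μ (fun z => c * f z + d * g z) t = c * fracInt μ f t + d * fracInt μ g t := by
  unfold fracInt
  rw [← intervalIntegral.integral_const_mul, ← intervalIntegral.integral_const_mul,
    ← intervalIntegral.integral_add (hf.const_mul c) (hg.const_mul d)]
  congr 1; ext z; ring

lemma fracInt_const_mul {μ t c : ℝ} {f : ℝ → ℝ} :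
    fracInt μ (fun z => c * f z) t = c * fracInt μ f t := by
  unfold fracInt
  rw [← intervalIntegral.integral_const_mul]
  congr 1; ext z; ring

/-- The solution of `D^α Y = -lam Y`, `Y(0) = 1`. -/
def posProfile (α lam y : ℝ) : ℝ := mittagLeffler α 1 (-lam * y ^ α)

/-- The solution of `D^β Z = -lam Z` with value `1` and derivative `lam` at `0`. -/
def negProfile (β lam t : ℝ) : ℝ :=
  mittagLeffler β 1 (-lam * t ^ β) + t * lam * mittagLeffler β 2 (-lam * t ^ β)

lemma continuous_posProfile {α : ℝ} (hα : 0 < α) (lam : ℝ) : Continuous (posProfile α lam) :=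
  (continuous_mittagLeffler hα one_pos).comp
    (continuous_const.mul (Real.continuous_rpow_const hα.le))

lemma continuous_negProfile {β : ℝ} (hβ : 0 < β) (lam : ℝ) : Continuous (negProfile β lam) :=
  ((continuous_mittagLeffler hβ one_pos).comp
    (continuous_const.mul (Real.continuous_rpow_const hβ.le))).add
  ((continuous_id.mul continuous_const).mul ((continuous_mittagLeffler hβ two_pos).comp
    (continuous_const.mul (Real.continuous_rpow_const hβ.le))))

lemma posProfile_zero {α : ℝ} (hα : 0 < α) (lam : ℝ) : posProfile α lam 0 = 1 := by
  simp [posProfile, Real.zero_rpow hα.ne', mittagLeffler_zero]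

lemma negProfile_zero {β : ℝ} (hβ : 0 < β) (lam : ℝ) : negProfile β lam 0 = 1 := by
  simp [negProfile, Real.zero_rpow hβ.ne', mittagLeffler_zero]

lemma posProfile_eq {α t : ℝ} (lam : ℝ) (ht : 0 < t) :
    posProfile α lam t = mlKernel α 1 lam t := by
  simp [mlKernel_eq ht, posProfile]

lemma negProfile_eq {β t : ℝ} (lam : ℝ) (ht : 0 < t) :
    negProfile β lam t = 1 * mlKernel β 1 lam t + lam * mlKernel β 2 lam t := by
  norm_num [mlKernel_eq ht, negProfile]
  ring

lemma posProfile_volterra {α t : ℝ} (hα : 0 < α) (lam : ℝ) (ht : 0 < t) :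
    posProfile α lam t = 1 - lam * fracInt α (posProfile α lam) t := by
  rw [fracInt_congr ht.le fun z hz => posProfile_eq lam hz.1, fracInt_mlKernel hα hα one_pos lam ht,
    posProfile_eq lam ht, mlKernel_eq_sub hα one_pos lam ht, rlKernel_one]

lemma negProfile_volterra {β t : ℝ} (hβ : 0 < β) (lam : ℝ) (ht : 0 < t) :
    negProfile β lam t = 1 + lam * t - lam * fracInt β (negProfile β lam) t := by
  rw [fracInt_congr ht.le fun z hz => negProfile_eq lam hz.1,
    fracInt_add_mul (intervalIntegrable_rlKernel_mul_mlKernel hβ hβ one_pos lam ht)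
      (intervalIntegrable_rlKernel_mul_mlKernel hβ hβ two_pos lam ht),
    fracInt_mlKernel hβ hβ one_pos lam ht, fracInt_mlKernel hβ hβ two_pos lam ht,
    negProfile_eq lam ht, mlKernel_eq_sub hβ one_pos lam ht, mlKernel_eq_sub hβ two_pos lam ht,
    rlKernel_one, rlKernel_two]
  ring

/-- Splitting off the constant term raises the second index from `1` to `α + 1`. Differentiating at
index `1` directly would lead to index `0`, outside the range of `hasDerivAt_mlKernel`. -/
lemma hasDerivAt_posProfile {α t : ℝ} (hα : 0 < α) (lam : ℝ) (ht : 0 < t) :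
    HasDerivAt (posProfile α lam) (-lam * mlKernel α α lam t) t := by
  have h := ((hasDerivAt_mlKernel hα hα lam ht).const_mul lam).const_sub 1
  rw [← neg_mul] at h
  refine h.congr_of_eventuallyEq ?_
  filter_upwards [Ioi_mem_nhds ht] with s hs
  rw [posProfile_eq lam hs, mlKernel_eq_sub hα one_pos lam hs, rlKernel_one, add_comm 1 α]

/-- The derivative of `negProfile`. -/
def negProfileDeriv (β lam t : ℝ) : ℝ :=
  lam - lam * mlKernel β β lam t - lam * (lam * mlKernel β (β + 1) lam t)

lemma hasDerivAt_negProfile {β t : ℝ} (hβ : 0 < β) (lam : ℝ) (ht : 0 < t) :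
    HasDerivAt (negProfile β lam) (negProfileDeriv β lam t) t := by
  have h1 := (hasDerivAt_mlKernel hβ hβ lam ht).const_mul lam
  have h2 := ((hasDerivAt_mlKernel hβ (by linarith : 0 < β + 1) lam ht).const_mul lam).const_mul lam
  have h3 := (hasDerivAt_id t).const_mul lam
  have h := ((h3.sub h1).sub h2).const_add 1
  rw [mul_one] at h
  refine h.congr_of_eventuallyEq ?_
  filter_upwards [Ioi_mem_nhds ht] with s hs
  rw [negProfile_eq lam hs, mlKernel_eq_sub hβ one_pos lam hs, mlKernel_eq_sub hβ two_pos lam hs,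
    rlKernel_one, rlKernel_two, add_comm 1 β, show (2 : ℝ) + β = β + 1 + 1 by ring]
  simp only [Pi.sub_apply, id]
  ring

lemma hasDerivAt_negProfileDeriv {β t : ℝ} (hβ : 1 < β) (lam : ℝ) (ht : 0 < t) :
    HasDerivAt (negProfileDeriv β lam)
      (-lam * mlKernel β (β - 1) lam t + -lam * lam * mlKernel β β lam t) t := by
  have hβ0 : 0 < β := by linarith
  have h1 := (hasDerivAt_mlKernel hβ0 (by linarith : 0 < β - 1) lam ht).const_mul lam
  have h2 := ((hasDerivAt_mlKernel hβ0 hβ0 lam ht).const_mul lam).const_mul lam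
  rw [sub_add_cancel] at h1
  have h := (h1.const_sub lam).sub h2
  refine h.congr_deriv ?_
  ring

lemma tendsto_negProfileDeriv {β : ℝ} (hβ : 1 < β) (lam : ℝ) :
    Tendsto (negProfileDeriv β lam) (𝓝[>] 0) (𝓝 lam) := by
  have hβ0 : 0 < β := by linarith
  have h1 := (tendsto_mlKernel_zero hβ0 hβ lam).const_mul lam
  have h2 := ((tendsto_mlKernel_zero hβ0 (by linarith : 1 < β + 1) lam).const_mul lam).const_mul lam
  have h := (h1.const_sub lam).sub h2
  simp only [mul_zero, sub_zero] at h
  exact h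

/-- The indices `α` and `1 - α` add up to `1`, so the profile itself reappears. -/
lemma fracInt_deriv_posProfile {α t : ℝ} (hα : 0 < α) (hα1 : α < 1) (lam : ℝ) (ht : 0 < t) :
    fracInt (1 - α) (fun z => -lam * mlKernel α α lam z) t = -lam * posProfile α lam t := by
  rw [fracInt_const_mul, fracInt_mlKernel (by linarith) hα hα lam ht, posProfile_eq lam ht]
  congr 2; ring

lemma fracInt_deriv_negProfileDeriv {β t : ℝ} (hβ : 1 < β) (hβ2 : β < 2) (lam : ℝ) (ht : 0 < t) :
    fracInt (2 - β) (fun z => -lam * mlKernel β (β - 1) lam z + -lam * lam * mlKernel β β lam z) t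
      = -lam * negProfile β lam t := by
  have hβ0 : 0 < β := by linarith
  have h2 : 0 < 2 - β := by linarith
  have h3 : 0 < β - 1 := by linarith
  rw [fracInt_add_mul (intervalIntegrable_rlKernel_mul_mlKernel h2 hβ0 h3 lam ht)
    (intervalIntegrable_rlKernel_mul_mlKernel h2 hβ0 hβ0 lam ht),
    fracInt_mlKernel h2 hβ0 h3 lam ht, fracInt_mlKernel h2 hβ0 hβ0 lam ht, negProfile_eq lam ht,
    show β - 1 + (2 - β) = 1 by ring, show β + (2 - β) = 2 by ring]
  ring

/-! ### Caputo derivatives as fractional integrals, and their linearity -/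

lemma rlKernel_one_sub {α t : ℝ} (ht : 0 ≤ t) :
    rlKernel (1 - α) t = 1 / Real.Gamma (1 - α) * (t ^ α)⁻¹ := by
  rw [rlKernel, show 1 - α - 1 = -α by ring, Real.rpow_neg ht]
  ring

lemma caputoPos_eq_fracInt {α y : ℝ} (f : ℝ → ℝ) (hy : 0 ≤ y) :
    caputoPos α f y = fracInt (1 - α) (deriv f) y := by
  rw [caputoPos, fracInt, ← intervalIntegral.integral_const_mul]
  refine intervalIntegral.integral_congr fun z hz => ?_
  rw [uIcc_of_le hy] at hz
  simp only [rlKernel_one_sub (sub_nonneg.2 hz.2)]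
  ring

/-- The reflection `y = -t` moves the negative side to a fractional integral with origin `0`; a
second derivative picks up no sign. -/
lemma caputoNeg_eq_fracInt {β t : ℝ} (f : ℝ → ℝ) (ht : 0 ≤ t) :
    caputoNeg β f (-t) = fracInt (2 - β) (fun s => deriv (deriv f) (-s)) t := by
  rw [caputoNeg, fracInt, ← intervalIntegral.integral_const_mul]
  have := intervalIntegral.integral_comp_neg (a := 0) (b := t) (fun z =>
    1 / Real.Gamma (2 - β) * (deriv (deriv f) z / (z - -t) ^ (β - 1)))
  rw [neg_zero] at this
  rw [← this]
  refine intervalIntegral.integral_congr fun z hz => ?_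
  rw [uIcc_of_le ht] at hz
  have h : 2 - β = 1 - (β - 1) := by ring
  simp only [h, rlKernel_one_sub (sub_nonneg.2 hz.2), show -z - -t = t - z by ring]
  ring

lemma deriv_add_const_mul {f g : ℝ → ℝ} {z : ℝ} (c : ℝ) (hf : DifferentiableAt ℝ f z)
    (hg : DifferentiableAt ℝ g z) :
    deriv (fun y => f y + c * g y) z = deriv f z + c * deriv g z :=
  (hf.hasDerivAt.add (hg.hasDerivAt.const_mul c)).deriv

lemma CaputoPosExists.add_const_mul {α b : ℝ} {f g : ℝ → ℝ} (c : ℝ) (hf : CaputoPosExists α b f)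
    (hg : CaputoPosExists α b g) :
    CaputoPosExists α b (fun y => f y + c * g y) ∧ ∀ y ∈ Ioo 0 b,
      caputoPos α (fun y => f y + c * g y) y = caputoPos α f y + c * caputoPos α g y := by
  have e : ∀ y ∈ Ioo 0 b, ∀ z ∈ Ioc 0 y, deriv f z / (y - z) ^ α + c * (deriv g z / (y - z) ^ α) =
      deriv (fun y => f y + c * g y) z / (y - z) ^ α := by
    intro y hy z hz
    have hz' : z ∈ Ioo 0 b := ⟨hz.1, hz.2.trans_lt hy.2⟩
    rw [deriv_add_const_mul c (hf.1 z hz') (hg.1 z hz')]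
    ring
  refine ⟨⟨fun z hz => (hf.1 z hz).add ((hg.1 z hz).const_mul c), fun y hy => ?_⟩, fun y hy => ?_⟩
  · refine ((hf.2 y hy).add ((hg.2 y hy).const_mul c)).congr ?_
    rw [uIoc_of_le hy.1.le]
    exact e y hy
  · have : ∫ z in (0 : ℝ)..y, deriv (fun y => f y + c * g y) z / (y - z) ^ α
        = ∫ z in (0 : ℝ)..y, (deriv f z / (y - z) ^ α + c * (deriv g z / (y - z) ^ α)) := by
      refine intervalIntegral.integral_congr_ae (ae_of_all _ ?_)
      rw [uIoc_of_le hy.1.le]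
      exact fun z hz => (e y hy z hz).symm
    rw [caputoPos, this, intervalIntegral.integral_add (hf.2 y hy) ((hg.2 y hy).const_mul c),
      intervalIntegral.integral_const_mul, caputoPos, caputoPos]
    ring

lemma deriv_deriv_add_const_mul {β a : ℝ} {f g : ℝ → ℝ} (c : ℝ) (hf : CaputoNegExists β a f)
    (hg : CaputoNegExists β a g) {z : ℝ} (hz : z ∈ Ioo (-a) 0) :
    HasDerivAt (deriv (fun y => f y + c * g y)) (deriv (deriv f) z + c * deriv (deriv g) z) z := by
  refine ((hf.1 z hz).2.hasDerivAt.add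
    ((hg.1 z hz).2.hasDerivAt.const_mul c)).congr_of_eventuallyEq ?_
  filter_upwards [isOpen_Ioo.mem_nhds hz] with s hs
  exact deriv_add_const_mul c (hf.1 s hs).1 (hg.1 s hs).1

lemma CaputoNegExists.add_const_mul {β a : ℝ} {f g : ℝ → ℝ} (c : ℝ) (hf : CaputoNegExists β a f)
    (hg : CaputoNegExists β a g) :
    CaputoNegExists β a (fun y => f y + c * g y) ∧ ∀ y ∈ Ioo (-a) 0,
      caputoNeg β (fun y => f y + c * g y) y = caputoNeg β f y + c * caputoNeg β g y := by
  have e : ∀ y ∈ Ioo (-a) 0, ∀ᵐ z, z ∈ Ioc y 0 →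
      deriv (deriv f) z / (z - y) ^ (β - 1) + c * (deriv (deriv g) z / (z - y) ^ (β - 1)) =
      deriv (deriv (fun y => f y + c * g y)) z / (z - y) ^ (β - 1) := by
    intro y hy
    -- The end point `z = 0` lies in `Ioc y 0`, but differentiability is only assumed to its left;
    -- it is discarded as a null set.
    filter_upwards [Measure.ae_ne volume 0] with z h0 hz
    rw [(deriv_deriv_add_const_mul c hf hg ⟨hy.1.trans hz.1, lt_of_le_of_ne hz.2 h0⟩).deriv]
    ring
  refine ⟨⟨fun z hz => ⟨(hf.1 z hz).1.add ((hg.1 z hz).1.const_mul c),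
    (deriv_deriv_add_const_mul c hf hg hz).differentiableAt⟩, fun y hy => ?_⟩, fun y hy => ?_⟩
  · refine ((hf.2 y hy).add ((hg.2 y hy).const_mul c)).congr_ae ?_
    rw [uIoc_of_le hy.2.le]
    exact (ae_restrict_iff' measurableSet_Ioc).2 (e y hy)
  · have : ∫ z in y..0, deriv (deriv (fun y => f y + c * g y)) z / (z - y) ^ (β - 1)
        = ∫ z in y..0, (deriv (deriv f) z / (z - y) ^ (β - 1)
          + c * (deriv (deriv g) z / (z - y) ^ (β - 1))) := by
      refine intervalIntegral.integral_congr_ae ?_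
      rw [uIoc_of_le hy.2.le]
      filter_upwards [e y hy] with z h hz using (h hz).symm
    rw [caputoNeg, this, intervalIntegral.integral_add (hf.2 y hy) ((hg.2 y hy).const_mul c),
      intervalIntegral.integral_const_mul, caputoNeg, caputoNeg]
    ring

lemma hasDerivAt_iteratedDerivWithin {n j : ℕ} {f : ℝ → ℝ}
    (hf : ContDiffOn ℝ ((n - 1 : ℕ) : WithTop ℕ∞) f (Icc 0 1))
    (hd : DifferentiableOn ℝ (iteratedDerivWithin (n - 1) f (Icc 0 1)) (Ioo 0 1))
    (hj : j < n) {x : ℝ} (hx : x ∈ Ioo (0 : ℝ) 1) :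
    HasDerivAt (iteratedDerivWithin j f (Icc 0 1)) (iteratedDerivWithin (j + 1) f (Icc 0 1) x) x := by
  have hd' : DifferentiableAt ℝ (iteratedDerivWithin j f (Icc 0 1)) x := by
    rcases (Nat.le_sub_one_of_lt hj).eq_or_lt with h | h
    · rw [h]; exact hd.differentiableAt (isOpen_Ioo.mem_nhds hx)
    · exact ((hf.differentiableOn_iteratedDerivWithin (by exact_mod_cast h)
        (uniqueDiffOn_Icc one_pos)).differentiableAt (Icc_mem_nhds hx.1 hx.2))
  rw [iteratedDerivWithin_succ, derivWithin_of_mem_nhds (Icc_mem_nhds hx.1 hx.2)]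
  exact hd'.hasDerivAt

/-- Needed at `x = 0` and `x = 1`, where existence of the Caputo derivatives is not assumed, so
their linearity is unavailable. There the boundary condition makes `u(x, ·)` vanish identically. -/
lemma gluing_deriv_of_eqOn_zero {a b : ℝ} (α : ℝ) (ha : 0 < a) (hb : 0 < b) {f : ℝ → ℝ}
    (hf : ∀ y ∈ Icc (-a) b, f y = 0) :
    Tendsto (caputoPos α f) (𝓝[>] 0) (𝓝 0) ∧ Tendsto (deriv f) (𝓝[<] 0) (𝓝 0) := by
  have hd : ∀ y ∈ Ioo (-a) b, deriv f y = 0 := by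
    intro y hy
    have : f =ᶠ[𝓝 y] fun _ => 0 := by
      filter_upwards [Icc_mem_nhds hy.1 hy.2] with s hs using hf s hs
    rw [this.deriv_eq, deriv_const]
  constructor
  · refine tendsto_const_nhds.congr' ?_
    filter_upwards [Ioo_mem_nhdsGT hb] with y hy
    rw [caputoPos_eq_fracInt f hy.1.le, fracInt_congr (g := fun _ => 0) hy.1.le
      fun z hz => hd z ⟨by linarith [hz.1], hz.2.trans hy.2⟩]
    simp [fracInt]
  · refine tendsto_const_nhds.congr' ?_
    filter_upwards [Ioo_mem_nhdsLT (neg_lt_zero.2 ha)] with y hy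
    rw [hd y ⟨hy.1, hy.2.trans hb⟩]

/-! ### Superposition of solutions -/

namespace IsSolution

variable {k : ℕ} {m α β a b : ℝ} {φ ψ : ℝ → ℝ} {u v : ℝ → ℝ → ℝ}

lemma hasDerivAt_dx (hu : IsSolution k m α β a b φ u) {j : ℕ} (hj : j < 2 * k) {x y : ℝ}
    (hx : x ∈ Ioo (0 : ℝ) 1) (hy : y ∈ Icc (-a) b) :
    HasDerivAt (fun s => dx j u s y) (dx (j + 1) u x y) x :=
  hasDerivAt_iteratedDerivWithin (hu.contDiff_x y hy) (hu.differentiable_dx y hy) hj hx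

lemma dx_add_const_mul (hu : IsSolution k m α β a b φ u) (hv : IsSolution k m α β a b ψ v) (c : ℝ)
    {j : ℕ} (hj : j ≤ 2 * k - 1) {x y : ℝ} (hx : x ∈ Icc (0 : ℝ) 1) (hy : y ∈ Icc (-a) b) :
    dx j (fun x y => u x y + c * v x y) x y = dx j u x y + c * dx j v x y := by
  have hj' : (j : WithTop ℕ∞) ≤ ((2 * k - 1 : ℕ) : WithTop ℕ∞) := by exact_mod_cast hj
  have h1 := ((hu.contDiff_x y hy).of_le hj') x hx
  have h2 := ((hv.contDiff_x y hy).of_le hj') x hx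
  have h2' : ContDiffWithinAt ℝ j (fun s => c * v s y) (Icc 0 1) x := contDiffWithinAt_const.mul h2
  simp only [dx]
  rw [iteratedDerivWithin_fun_add hx (uniqueDiffOn_Icc one_pos) h1 h2',
    iteratedDerivWithin_const_mul_field]

lemma dx_top_add_const_mul (hk : 1 ≤ k) (hu : IsSolution k m α β a b φ u)
    (hv : IsSolution k m α β a b ψ v) (c : ℝ)
    {x y : ℝ} (hx : x ∈ Ioo (0 : ℝ) 1) (hy : y ∈ Icc (-a) b) :
    HasDerivAt (fun x => dx (2 * k - 1) (fun x y => u x y + c * v x y) x y)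
      (dx (2 * k) u x y + c * dx (2 * k) v x y) x := by
  have h1 := hu.hasDerivAt_dx (j := 2 * k - 1) (by omega) hx hy
  have h2 := hv.hasDerivAt_dx (j := 2 * k - 1) (by omega) hx hy
  rw [show 2 * k - 1 + 1 = 2 * k by omega] at h1 h2
  refine (h1.add (h2.const_mul c)).congr_of_eventuallyEq ?_
  filter_upwards [Icc_mem_nhds hx.1 hx.2] with s hs
  exact hu.dx_add_const_mul hv c le_rfl hs hy

lemma dx_top_eq (hk : 1 ≤ k) (hu : IsSolution k m α β a b φ u)
    (hv : IsSolution k m α β a b ψ v) (c : ℝ)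
    {x y : ℝ} (hx : x ∈ Ioo (0 : ℝ) 1) (hy : y ∈ Icc (-a) b) :
    dx (2 * k) (fun x y => u x y + c * v x y) x y = dx (2 * k) u x y + c * dx (2 * k) v x y := by
  rw [← (dx_top_add_const_mul hk hu hv c hx hy).deriv, ← derivWithin_of_mem_nhds
    (Icc_mem_nhds hx.1 hx.2)]
  conv_lhs => rw [show 2 * k = 2 * k - 1 + 1 by omega]
  simp only [dx]
  rw [iteratedDerivWithin_succ]

/-- Applied with `c = -1` to subtract two solutions and with `c = 1` to add a homogeneous one. -/
lemma add_const_mul (hk : 1 ≤ k) (ha : 0 < a) (hb : 0 < b) (hu : IsSolution k m α β a b φ u)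
    (hv : IsSolution k m α β a b ψ v) (c : ℝ) :
    IsSolution k m α β a b (fun x => φ x + c * ψ x) (fun x y => u x y + c * v x y) := by
  have hp := fun x hx => (hu.caputoPos_exists x hx).add_const_mul c (hv.caputoPos_exists x hx)
  have hn := fun x hx => (hu.caputoNeg_exists x hx).add_const_mul c (hv.caputoNeg_exists x hx)
  have hyp : ∀ {y}, y ∈ Ioo 0 b → y ∈ Icc (-a) b := fun h => ⟨by linarith [h.1], h.2.le⟩
  have hyn : ∀ {y}, y ∈ Ioo (-a) 0 → y ∈ Icc (-a) b := fun h => ⟨h.1.le, by linarith [h.2]⟩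
  have hbd : ∀ j < k, ∀ y ∈ Icc (-a) b, dx j (fun x y => u x y + c * v x y) 0 y = 0 ∧
      dx j (fun x y => u x y + c * v x y) 1 y = 0 := by
    intro j hj y hy
    rw [hu.dx_add_const_mul hv c (by omega) (left_mem_Icc.2 zero_le_one) hy,
      hu.dx_add_const_mul hv c (by omega) (right_mem_Icc.2 zero_le_one) hy,
      (hu.boundary j hj y hy).1, (hu.boundary j hj y hy).2,
      (hv.boundary j hj y hy).1, (hv.boundary j hj y hy).2]
    simp
  refine ⟨fun y hy => (hu.contDiff_x y hy).add (contDiffOn_const.mul (hv.contDiff_x y hy)),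
    fun j hj => ?_, fun y hy x hx => ?_, ?_, fun y hy => ?_, fun x hx => (hp x hx).1,
    fun x hx => (hn x hx).1, ?_, ?_, fun x hx y hy => ?_, fun x hx y hy => ?_, hbd,
    fun x hx => ?_, fun x hx => ?_, fun x hx => ?_⟩
  · refine ((hu.continuous_dx j hj).add
      ((continuousOn_const (c := c)).mul (hv.continuous_dx j hj))).congr fun p hp => ?_
    exact hu.dx_add_const_mul hv c hj hp.1 hp.2
  · exact (dx_top_add_const_mul hk hu hv c hx hy).differentiableAt.differentiableWithinAt
  · refine (hu.continuous_dx_top.add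
      ((continuousOn_const (c := c)).mul hv.continuous_dx_top)).congr fun p hp => ?_
    exact dx_top_eq hk hu hv c hp.1 (Ioo_subset_Icc_self hp.2)
  · refine ((hu.memLp_dx_top y hy).add ((hv.memLp_dx_top y hy).const_mul c)).ae_eq ?_
    filter_upwards [ae_restrict_mem measurableSet_Ioo] with x hx
    rw [dx_top_eq hk hu hv c hx hy]
    simp only [Pi.add_apply]
    ring
  · refine (hu.continuous_caputoPos.add
      ((continuousOn_const (c := c)).mul hv.continuous_caputoPos)).congr fun p hpp => ?_
    exact (hp p.1 hpp.1).2 p.2 hpp.2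
  · refine (hu.continuous_caputoNeg.add
      ((continuousOn_const (c := c)).mul hv.continuous_caputoNeg)).congr fun p hpp => ?_
    exact (hn p.1 hpp.1).2 p.2 hpp.2
  · rw [(hp x hx).2 y hy, dx_top_eq hk hu hv c hx (hyp hy)]
    linear_combination hu.eq_pos x hx y hy + c * hv.eq_pos x hx y hy
  · rw [(hn x hx).2 y hy, dx_top_eq hk hu hv c hx (hyn hy)]
    linear_combination hu.eq_neg x hx y hy + c * hv.eq_neg x hx y hy
  · obtain ⟨l, h1, h2⟩ := hu.gluing x hx
    obtain ⟨l', h1', h2'⟩ := hv.gluing x hx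
    exact ⟨l + c * l', h1.add (h1'.const_mul c), h2.add (h2'.const_mul c)⟩
  · rcases hx.1.eq_or_lt with h0 | h0
    · subst h0
      refine ⟨0, gluing_deriv_of_eqOn_zero α ha hb fun y hy => ?_⟩
      simpa [dx] using (hbd 0 hk y hy).1
    rcases hx.2.eq_or_lt with h1 | h1
    · subst h1
      refine ⟨0, gluing_deriv_of_eqOn_zero α ha hb fun y hy => ?_⟩
      simpa [dx] using (hbd 0 hk y hy).2
    obtain ⟨l, h1, h2⟩ := hu.gluing_deriv x hx
    obtain ⟨l', h1', h2'⟩ := hv.gluing_deriv x hx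
    refine ⟨l + c * l', (h1.add (h1'.const_mul c)).congr' ?_, (h2.add (h2'.const_mul c)).congr' ?_⟩
    · filter_upwards [Ioo_mem_nhdsGT hb] with y hy
      exact ((hp x ⟨h0, by assumption⟩).2 y hy).symm
    · filter_upwards [Ioo_mem_nhdsLT (neg_lt_zero.2 ha)] with y hy
      have hx' : x ∈ Ioo (0 : ℝ) 1 := ⟨h0, by assumption⟩
      exact (deriv_add_const_mul c ((hu.caputoNeg_exists x hx').1 y hy).1
        ((hv.caputoNeg_exists x hx').1 y hy).1).symm
  · have h1 := hu.nonlocal x hx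
    have h2 := hv.nonlocal x hx
    linear_combination h1 + c * h2

end IsSolution

/-! ### Eigenfunctions and their decay at the degenerate end point -/

/-- `X` is a (possibly zero) solution of the eigenvalue problem with parameter `lam`. -/
structure IsEigenfunction (k : ℕ) (m lam : ℝ) (X : ℝ → ℝ) : Prop where
  contDiff_Icc : ContDiffOn ℝ ((2 * k - 1 : ℕ) : WithTop ℕ∞) X (Icc 0 1)
  contDiff_Ioo : ContDiffOn ℝ ((2 * k : ℕ) : WithTop ℕ∞) X (Ioo 0 1)
  eq : ∀ x ∈ Ioo (0 : ℝ) 1, iteratedDeriv (2 * k) X x = (-1) ^ k * lam * x ^ (-m) * X x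
  boundary : ∀ j < k, iteratedDerivWithin j X (Icc 0 1) 0 = 0 ∧
      iteratedDerivWithin j X (Icc 0 1) 1 = 0

lemma isEigenvalue_iff {k : ℕ} {m lam : ℝ} :
    IsEigenvalue k m lam ↔ ∃ X, IsEigenfunction k m lam X ∧ ∃ x ∈ Ioo (0 : ℝ) 1, X x ≠ 0 :=
  ⟨fun ⟨X, h1, h2, h3, h4, h5⟩ => ⟨X, ⟨h1, h2, h3, h4⟩, h5⟩,
    fun ⟨X, ⟨h1, h2, h3, h4⟩, h5⟩ => ⟨X, h1, h2, h3, h4, h5⟩⟩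

lemma iteratedDerivWithin_Icc_eq (j : ℕ) (f : ℝ → ℝ) {x : ℝ} (hx : x ∈ Ioo (0 : ℝ) 1) :
    iteratedDerivWithin j f (Icc 0 1) x = iteratedDeriv j f x := by
  have h : (Icc (0 : ℝ) 1 : Set ℝ) =ᶠ[𝓝 x] (univ : Set ℝ) :=
    eventuallyEq_univ.2 (Icc_mem_nhds hx.1 hx.2)
  rw [iteratedDerivWithin, iteratedDeriv, iteratedFDerivWithin_congr_set h, iteratedFDerivWithin_univ]

namespace IsEigenfunction

variable {k : ℕ} {m lam : ℝ} {X : ℝ → ℝ}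

lemma differentiableOn_top (hk : 1 ≤ k) (hX : IsEigenfunction k m lam X) :
    DifferentiableOn ℝ (iteratedDerivWithin (2 * k - 1) X (Icc 0 1)) (Ioo 0 1) := by
  refine (hX.contDiff_Ioo.differentiableOn_iteratedDerivWithin (m := 2 * k - 1)
    (by exact_mod_cast (by omega : 2 * k - 1 < 2 * k)) isOpen_Ioo.uniqueDiffOn).congr fun x hx => ?_
  rw [iteratedDerivWithin_Icc_eq _ _ hx, iteratedDerivWithin_of_isOpen isOpen_Ioo hx]

lemma eq_within (hX : IsEigenfunction k m lam X) {x : ℝ} (hx : x ∈ Ioo (0 : ℝ) 1) :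
    iteratedDerivWithin (2 * k) X (Icc 0 1) x = (-1) ^ k * lam * x ^ (-m) * X x := by
  rw [iteratedDerivWithin_Icc_eq _ _ hx, hX.eq x hx]

lemma continuousOn (hX : IsEigenfunction k m lam X) : ContinuousOn X (Icc 0 1) :=
  hX.contDiff_Icc.continuousOn

/-- Taylor's formula at `0`, where the first `k` derivatives vanish. This decay is what absorbs the
weight `x ^ (-m)` when `m < k`. -/
lemma exists_bound (hk : 1 ≤ k) (hX : IsEigenfunction k m lam X) :
    ∃ C, 0 ≤ C ∧ ∀ x ∈ Icc (0 : ℝ) 1, |X x| ≤ C * x ^ k := by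
  obtain ⟨n, rfl⟩ := Nat.exists_eq_add_of_le' hk
  obtain ⟨C, hC⟩ := exists_taylor_mean_remainder_bound (n := n) (zero_le_one' ℝ)
    (hX.contDiff_Icc.of_le (by exact_mod_cast (by omega : n + 1 ≤ 2 * (n + 1) - 1)))
  have ht : ∀ x, taylorWithinEval X n (Icc 0 1) 0 x = 0 := by
    intro x
    rw [taylor_within_apply]
    refine Finset.sum_eq_zero fun j hj => ?_
    rw [(hX.boundary j (Finset.mem_range.1 hj)).1, smul_zero]
  refine ⟨|C|, abs_nonneg C, fun x hx => ?_⟩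
  have h := hC x hx
  rw [ht, sub_zero, sub_zero, Real.norm_eq_abs] at h
  exact h.trans (mul_le_mul_of_nonneg_right (le_abs_self C) (pow_nonneg hx.1 _))

lemma exists_weighted_bound (hk : 1 ≤ k) (hX : IsEigenfunction k m lam X) {p : ℝ} (hp : p ≤ k) :
    ∃ C, 0 ≤ C ∧ ∀ x ∈ Ioo (0 : ℝ) 1, |x ^ (-p) * X x| ≤ C := by
  obtain ⟨C, hC0, hC⟩ := hX.exists_bound hk
  refine ⟨C, hC0, fun x hx => ?_⟩
  have h0 := Real.rpow_nonneg hx.1.le (-p)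
  rw [abs_mul, abs_of_nonneg h0]
  calc x ^ (-p) * |X x| ≤ x ^ (-p) * (C * x ^ k) :=
        mul_le_mul_of_nonneg_left (hC x (Ioo_subset_Icc_self hx)) h0
    _ = C * x ^ (-p + k) := by rw [Real.rpow_add hx.1, Real.rpow_natCast]; ring
    _ ≤ C * 1 := mul_le_mul_of_nonneg_left
        (Real.rpow_le_one hx.1.le hx.2.le (by linarith)) hC0
    _ = C := mul_one C

lemma continuousOn_weighted (hX : IsEigenfunction k m lam X) (p : ℝ) :
    ContinuousOn (fun x => x ^ (-p) * X x) (Ioo 0 1) :=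
  (continuousOn_id.rpow_const fun _ hx => Or.inl (ne_of_gt hx.1)).mul
    (hX.continuousOn.mono Ioo_subset_Icc_self)

end IsEigenfunction

/-! ### The separated solution -/

lemma caputoPos_of_hasDerivAt {α b : ℝ} (hα : α < 1) {f f' : ℝ → ℝ}
    (hf : ∀ z ∈ Ioo 0 b, HasDerivAt f (f' z) z)
    (hi : ∀ y ∈ Ioo 0 b, IntervalIntegrable (fun z => rlKernel (1 - α) (y - z) * f' z) volume 0 y) :
    CaputoPosExists α b f ∧ ∀ y ∈ Ioo 0 b, caputoPos α f y = fracInt (1 - α) f' y := by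
  refine ⟨⟨fun z hz => (hf z hz).differentiableAt, fun y hy => ?_⟩, fun y hy => ?_⟩
  · refine ((hi y hy).const_mul (Real.Gamma (1 - α))).congr ?_
    rw [uIoc_of_le hy.1.le]
    intro z hz
    have hΓ := (Real.Gamma_pos_of_pos (sub_pos.2 hα)).ne'
    simp only [(hf z ⟨hz.1, hz.2.trans_lt hy.2⟩).deriv, rlKernel_one_sub (sub_nonneg.2 hz.2)]
    field_simp
  · rw [caputoPos_eq_fracInt f hy.1.le]
    exact fracInt_congr hy.1.le fun z hz => (hf z ⟨hz.1, hz.2.trans hy.2⟩).deriv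

lemma hasDerivAt_of_reflect {f : ℝ → ℝ} {d t : ℝ} (h : HasDerivAt (fun s => f (-s)) d t) :
    HasDerivAt f (-d) (-t) := by
  have h' : HasDerivAt (fun s => f (-s)) d (-(-t)) := by rwa [neg_neg]
  have h2 := HasDerivAt.scomp (-t) h' (hasDerivAt_neg (-t))
  have e : ((fun s => f (-s)) ∘ fun s : ℝ => -s) = f := by ext s; simp
  rw [e] at h2
  simpa using h2

lemma caputoNeg_of_hasDerivAt {β a : ℝ} (hβ : β < 2) {f g' g'' : ℝ → ℝ}
    (hf : ∀ t ∈ Ioo 0 a, HasDerivAt (fun s => f (-s)) (g' t) t)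
    (hf' : ∀ t ∈ Ioo 0 a, HasDerivAt g' (g'' t) t)
    (hi : ∀ t ∈ Ioo 0 a, IntervalIntegrable (fun z => rlKernel (2 - β) (t - z) * g'' z) volume 0 t) :
    CaputoNegExists β a f ∧ (∀ t ∈ Ioo 0 a, deriv f (-t) = - g' t) ∧
      ∀ t ∈ Ioo 0 a, caputoNeg β f (-t) = fracInt (2 - β) g'' t := by
  have h1 : ∀ t ∈ Ioo 0 a, HasDerivAt f (- g' t) (-t) := fun t ht => hasDerivAt_of_reflect (hf t ht)
  have h2 : ∀ t ∈ Ioo 0 a, HasDerivAt (deriv f) (g'' t) (-t) := by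
    intro t ht
    rw [← neg_neg (g'' t)]
    refine hasDerivAt_of_reflect ((hf' t ht).neg.congr_of_eventuallyEq ?_)
    filter_upwards [isOpen_Ioo.mem_nhds ht] with s hs using (h1 s hs).deriv
  have hΓ := (Real.Gamma_pos_of_pos (sub_pos.2 hβ)).ne'
  refine ⟨⟨fun z hz => ?_, fun y hy => ?_⟩, fun t ht => (h1 t ht).deriv, fun t ht => ?_⟩
  · have hz' : -z ∈ Ioo 0 a := ⟨by linarith [hz.2], by linarith [hz.1]⟩
    have h3 := (h1 _ hz').differentiableAt
    have h4 := (h2 _ hz').differentiableAt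
    rw [neg_neg] at h3 h4
    exact ⟨h3, h4⟩
  · rw [IntervalIntegrable.iff_comp_neg, neg_zero]
    refine IntervalIntegrable.symm ?_
    have hy' : -y ∈ Ioo 0 a := ⟨by linarith [hy.2], by linarith [hy.1]⟩
    refine ((hi _ hy').const_mul (Real.Gamma (2 - β))).congr ?_
    rw [uIoc_of_le hy'.1.le]
    intro z hz
    have h : 2 - β = 1 - (β - 1) := by ring
    simp only [(h2 z ⟨hz.1, hz.2.trans_lt hy'.2⟩).deriv]
    rw [h] at hΓ ⊢
    rw [rlKernel_one_sub (sub_nonneg.2 hz.2), show -z - y = -y - z by ring]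
    field_simp
  · rw [caputoNeg_eq_fracInt f ht.1.le]
    exact fracInt_congr ht.1.le fun z hz => (h2 z ⟨hz.1, hz.2.trans ht.2⟩).deriv

/-- The `y`-factor of the separated solution. -/
def profile (α β lam y : ℝ) : ℝ :=
  if 0 ≤ y then posProfile α lam y else negProfile β lam (-y)

lemma continuous_profile {α β : ℝ} (hα : 0 < α) (hβ : 0 < β) (lam : ℝ) :
    Continuous (profile α β lam) := by
  refine Continuous.if_le (continuous_posProfile hα lam)
    ((continuous_negProfile hβ lam).comp continuous_neg) continuous_const continuous_id ?_
  rintro y rfl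
  simp [posProfile_zero hα, negProfile_zero hβ]

lemma profile_of_pos {α β lam y : ℝ} (hy : 0 ≤ y) : profile α β lam y = posProfile α lam y :=
  if_pos hy

lemma profile_of_neg {α β lam t : ℝ} (ht : 0 < t) : profile α β lam (-t) = negProfile β lam t := by
  rw [profile, if_neg (by linarith), neg_neg]

lemma caputoPos_profile {α β : ℝ} (hα0 : 0 < α) (hα1 : α < 1) (b lam c : ℝ) :
    CaputoPosExists α b (fun y => profile α β lam y * c) ∧
    ∀ y ∈ Ioo 0 b, caputoPos α (fun y => profile α β lam y * c) y = -lam * profile α β lam y * c := by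
  have h := caputoPos_of_hasDerivAt (α := α) (b := b) hα1 (f := fun y => profile α β lam y * c)
    (f' := fun y => c * (-lam * mlKernel α α lam y)) ?_ ?_
  · refine ⟨h.1, fun y hy => ?_⟩
    rw [h.2 y hy, fracInt_const_mul, fracInt_deriv_posProfile hα0 hα1 lam hy.1,
      profile_of_pos hy.1.le]
    ring
  · intro z hz
    rw [mul_comm]
    refine ((hasDerivAt_posProfile hα0 lam hz.1).mul_const c).congr_of_eventuallyEq ?_
    filter_upwards [Ioi_mem_nhds hz.1] with s hs
    rw [profile_of_pos (le_of_lt hs)]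
  · intro y hy
    refine ((intervalIntegrable_rlKernel_mul_mlKernel (sub_pos.2 hα1) hα0 hα0 lam hy.1).const_mul
      (c * -lam)).congr fun z _ => ?_
    ring

lemma caputoNeg_profile {α β : ℝ} (hβ1 : 1 < β) (hβ2 : β < 2) (a lam c : ℝ) :
    CaputoNegExists β a (fun y => profile α β lam y * c) ∧
    (∀ y ∈ Ioo (-a) 0, deriv (fun y => profile α β lam y * c) y = - negProfileDeriv β lam (-y) * c) ∧
    ∀ y ∈ Ioo (-a) 0, caputoNeg β (fun y => profile α β lam y * c) y = -lam * profile α β lam y * c := by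
  have hβ0 : 0 < β := by linarith
  have h := caputoNeg_of_hasDerivAt (β := β) (a := a) hβ2 (f := fun y => profile α β lam y * c)
    (g' := fun t => negProfileDeriv β lam t * c)
    (g'' := fun t => c * (-lam * mlKernel β (β - 1) lam t + -lam * lam * mlKernel β β lam t)) ?_ ?_ ?_
  · have hy' : ∀ y ∈ Ioo (-a) 0, -y ∈ Ioo 0 a := fun y hy => ⟨by linarith [hy.2], by linarith [hy.1]⟩
    refine ⟨h.1, fun y hy => ?_, fun y hy => ?_⟩
    · have := h.2.1 (-y) (hy' y hy)
      rw [neg_neg] at this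
      rw [this]; ring
    · have := h.2.2 (-y) (hy' y hy)
      rw [neg_neg] at this
      rw [this, fracInt_const_mul, fracInt_deriv_negProfileDeriv hβ1 hβ2 lam (hy' y hy).1,
        ← profile_of_neg (α := α) (hy' y hy).1, neg_neg]
      ring
  · intro t ht
    refine ((hasDerivAt_negProfile hβ0 lam ht.1).mul_const c).congr_of_eventuallyEq ?_
    filter_upwards [Ioi_mem_nhds ht.1] with s hs
    rw [profile_of_neg hs]
  · intro t ht
    rw [mul_comm]
    exact (hasDerivAt_negProfileDeriv hβ1 lam ht.1).mul_const c
  · intro t ht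
    have h2 : 0 < 2 - β := by linarith
    refine (((intervalIntegrable_rlKernel_mul_mlKernel h2 hβ0 (by linarith : 0 < β - 1) lam
      ht.1).const_mul (c * -lam)).add ((intervalIntegrable_rlKernel_mul_mlKernel h2 hβ0 hβ0 lam
      ht.1).const_mul (c * (-lam * lam)))).congr fun z _ => ?_
    ring

lemma Delta_eq {α β a b lam : ℝ} :
    Delta α β a b lam = posProfile α lam b - negProfile β lam a := rfl

/-- Separation of variables: both Caputo derivatives multiply the profile by `-lam`, cancelling the
spatial term. The slope `lam` of `negProfile` in `t = -y` is the slope `-lam` in `y`, as the gluing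
requires; `Δ = 0` is needed only for the nonlocal condition. -/
lemma isSolution_profile_mul {k : ℕ} {m α β a b lam : ℝ} {X : ℝ → ℝ} (hk : 1 ≤ k) (hm0 : 0 ≤ m)
    (hmk : m < k) (hα0 : 0 < α) (hα1 : α < 1) (hβ1 : 1 < β) (hβ2 : β < 2) (ha : 0 < a) (hb : 0 < b)
    (hX : IsEigenfunction k m lam X) (hΔ : Delta α β a b lam = 0) :
    IsSolution k m α β a b (fun _ => 0) (fun x y => profile α β lam y * X x) := by
  have hYc := continuous_profile hα0 (by linarith : 0 < β) lam
  have hdx : ∀ j x y, dx j (fun x y => profile α β lam y * X x) x y =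
      profile α β lam y * iteratedDerivWithin j X (Icc 0 1) x := fun j x y =>
    iteratedDerivWithin_const_mul_field _ _
  have hcp := fun c => caputoPos_profile (β := β) hα0 hα1 b lam c
  have hcn := fun c => caputoNeg_profile (α := α) hβ1 hβ2 a lam c
  have hXc : ContinuousOn X (Ioo 0 1) := hX.continuousOn.mono Ioo_subset_Icc_self
  have hYc2 : Continuous fun p : ℝ × ℝ => profile α β lam p.2 := hYc.comp continuous_snd
  have hpde : ∀ x ∈ Ioo (0 : ℝ) 1, ∀ y, -lam * profile α β lam y * X x +
      (-1) ^ k * x ^ m * (profile α β lam y * iteratedDerivWithin (2 * k) X (Icc 0 1) x) = 0 := by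
    intro x hx y
    have h1 : ((-1 : ℝ) ^ k) * (-1) ^ k = 1 := by rw [← mul_pow]; simp
    have h2 : x ^ m * x ^ (-m) = 1 := by rw [← Real.rpow_add hx.1]; simp
    rw [hX.eq_within hx]
    linear_combination (profile α β lam y * lam * X x) * (x ^ m * x ^ (-m) * h1 + h2)
  refine ⟨fun y hy => contDiffOn_const.mul hX.contDiff_Icc, fun j hj => ?_, fun y hy => ?_, ?_,
    fun y hy => ?_, fun x hx => (hcp (X x)).1, fun x hx => (hcn (X x)).1, ?_, ?_,
    fun x hx y hy => ?_, fun x hx y hy => ?_, fun j hj y hy => ?_, fun x hx => ?_, fun x hx => ?_,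
    fun x hx => ?_⟩
  · simp_rw [hdx]
    have hc := hX.contDiff_Icc.continuousOn_iteratedDerivWithin (m := j)
      (by exact_mod_cast hj) (uniqueDiffOn_Icc one_pos)
    exact hYc2.continuousOn.mul (hc.comp continuousOn_fst fun p hp => hp.1)
  · simp_rw [hdx]
    exact (hX.differentiableOn_top hk).const_mul _
  · simp_rw [hdx]
    refine hYc2.continuousOn.mul (ContinuousOn.comp (g := iteratedDerivWithin (2 * k) X (Icc 0 1))
      (t := Ioo 0 1) ?_ continuousOn_fst fun p hp => hp.1)
    refine ContinuousOn.congr ?_ fun x hx => hX.eq_within hx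
    exact (continuousOn_const.mul
      (continuousOn_id.rpow_const fun x hx => Or.inl (ne_of_gt hx.1))).mul hXc
  -- By the eigenvalue equation, `x ^ (m/2) X⁽²ᵏ⁾` is a multiple of `x ^ (-m/2) X`, which is bounded
  -- since `m/2 ≤ k`.
  · obtain ⟨C, hC0, hC⟩ := hX.exists_weighted_bound hk (p := m / 2) (by linarith)
    have h1 : MemLp (fun x => x ^ (-(m / 2)) * X x) 2 (volume.restrict (Ioo (0 : ℝ) 1)) := by
      refine MemLp.of_bound ((hX.continuousOn_weighted _).aestronglyMeasurable measurableSet_Ioo) C ?_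
      filter_upwards [ae_restrict_mem measurableSet_Ioo] with x hx using hC x hx
    refine (h1.const_mul ((-1) ^ k * lam * profile α β lam y)).ae_eq ?_
    filter_upwards [ae_restrict_mem measurableSet_Ioo] with x hx
    rw [hdx, hX.eq_within hx, show -(m / 2) = m / 2 + -m by ring, Real.rpow_add hx.1]
    ring
  · refine ContinuousOn.congr (f := fun p : ℝ × ℝ => -lam * profile α β lam p.2 * X p.1) ?_
      fun p hp => (hcp (X p.1)).2 p.2 hp.2
    exact (continuous_const.mul hYc2).continuousOn.mul (hXc.comp continuousOn_fst fun p hp => hp.1)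
  · refine ContinuousOn.congr (f := fun p : ℝ × ℝ => -lam * profile α β lam p.2 * X p.1) ?_
      fun p hp => (hcn (X p.1)).2.2 p.2 hp.2
    exact (continuous_const.mul hYc2).continuousOn.mul (hXc.comp continuousOn_fst fun p hp => hp.1)
  · rw [(hcp (X x)).2 y hy, hdx]
    exact hpde x hx y
  · rw [(hcn (X x)).2.2 y hy, hdx]
    exact hpde x hx y
  · simp [hdx, hX.boundary j hj]
  · have := ((hYc.mul_const (X x)).tendsto 0)
    exact ⟨_, this.mono_left nhdsWithin_le_nhds, this.mono_left nhdsWithin_le_nhds⟩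
  · refine ⟨-lam * X x, ?_, ?_⟩
    · have h1 : Tendsto (fun y => -lam * profile α β lam y * X x) (𝓝[>] 0) (𝓝 (-lam * X x)) := by
        have hc : Continuous fun y => -lam * profile α β lam y * X x :=
          (continuous_const.mul hYc).mul_const _
        have := hc.tendsto 0
        rw [profile_of_pos le_rfl, posProfile_zero hα0, mul_one] at this
        exact this.mono_left nhdsWithin_le_nhds
      refine h1.congr' ?_
      filter_upwards [Ioo_mem_nhdsGT hb] with y hy using ((hcp (X x)).2 y hy).symm
    · have hneg : Tendsto (fun y : ℝ => -y) (𝓝[<] 0) (𝓝[>] 0) := by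
        have := tendsto_neg_nhdsLT (a := (0 : ℝ))
        rwa [neg_zero] at this
      refine ((((tendsto_negProfileDeriv hβ1 lam).comp hneg).neg).mul_const (X x)).congr' ?_
      filter_upwards [Ioo_mem_nhdsLT (neg_lt_zero.2 ha)] with y hy
        using ((hcn (X x)).2.1 y hy).symm
  · rw [profile_of_pos hb.le, profile_of_neg ha, ← sub_mul, ← Delta_eq, hΔ, zero_mul]

/-! ### Inverting the Caputo derivatives -/

/-- Multiplication by the continuous factor `(y - z) ^ γ` removes the denominator; so convergence of
the Caputo integral already forces the derivative inside it to be integrable. -/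
lemma integrableOn_of_div_rpow {γ y : ℝ} {f : ℝ → ℝ} (hγ : 0 ≤ γ) (hy : 0 < y)
    (hf : IntervalIntegrable (fun z => f z / (y - z) ^ γ) volume 0 y) :
    IntervalIntegrable f volume 0 y := by
  have hc : ContinuousOn (fun z : ℝ => (y - z) ^ γ) (uIcc 0 y) :=
    (continuous_const.sub continuous_id).continuousOn.rpow_const fun _ _ => Or.inr hγ
  have h := hf.mul_continuousOn hc
  rw [intervalIntegrable_iff_integrableOn_Ioo_of_le hy.le] at h ⊢
  refine h.congr_fun (fun z hz => ?_) measurableSet_Ioo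
  have := (Real.rpow_pos_of_pos (sub_pos.2 hz.2) γ).ne'
  simp only
  field_simp

/-- The semigroup law gives `I^α D^α f = I^α I^(1-α) f' = I^1 f'`, and the last integral is `f -
f(0)`. -/
lemma eq_add_fracInt_caputoPos {α b : ℝ} {f : ℝ → ℝ} (hα0 : 0 < α) (hα1 : α < 1)
    (hf : CaputoPosExists α b f) (hc : ContinuousOn f (Ico 0 b)) :
    ∀ y ∈ Ioo 0 b, f y = f 0 + fracInt α (caputoPos α f) y := by
  intro y hy
  have hi := integrableOn_of_div_rpow hα0.le hy.1 (hf.2 y hy)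
  have h1 : ∫ z in (0 : ℝ)..y, deriv f z = f y - f 0 :=
    intervalIntegral.integral_eq_sub_of_hasDerivAt_of_le hy.1.le
      (hc.mono fun z hz => ⟨hz.1, hz.2.trans_lt hy.2⟩)
      (fun z hz => (hf.1 z ⟨hz.1, hz.2.trans hy.2⟩).hasDerivAt) hi
  have h2 := fracInt_fracInt hα0 (sub_pos.2 hα1) hy.1 (f := deriv f)
    (measurable_deriv f).aestronglyMeasurable (by simpa [rlKernel_one] using hi)
  rw [fracInt_congr hy.1.le fun z hz => (caputoPos_eq_fracInt f hz.1.le), h2, fracInt]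
  simp [rlKernel_one, h1]

/-- In the reflected variable, `I^β I^(2-β)` is `I^2`, so the second derivative is integrated
against `t - s`. Only the left limit `l` of `f'` at `0` enters, not a derivative at `0`. -/
lemma eq_add_fracInt_caputoNeg {β a l : ℝ} {f : ℝ → ℝ} (hβ1 : 1 < β) (hβ2 : β < 2)
    (hf : CaputoNegExists β a f) (hc : ContinuousOn f (Ioc (-a) 0))
    (hl : Tendsto (deriv f) (𝓝[<] 0) (𝓝 l)) :
    ∀ t ∈ Ioo 0 a, f (-t) = f 0 - t * l + fracInt β (fun s => caputoNeg β f (-s)) t := by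
  intro t ht
  set q : ℝ → ℝ := fun s => deriv (deriv f) (-s) with hq
  have hmem : ∀ s ∈ Ioo 0 a, -s ∈ Ioo (-a) 0 := fun s hs => ⟨by linarith [hs.2], by linarith [hs.1]⟩
  have hqi : IntervalIntegrable q volume 0 t := by
    have h := hf.2 (-t) (hmem t ht)
    rw [IntervalIntegrable.iff_comp_neg, neg_neg, neg_zero] at h
    refine integrableOn_of_div_rpow (γ := β - 1) (by linarith) ht.1 (h.symm.congr fun z _ => ?_)
    simp only [hq, show -z - -t = t - z by ring]
  have hqm : Measurable q := (measurable_deriv _).comp measurable_neg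
  have hqi2 : IntervalIntegrable (fun s => (t - s) * q s) volume 0 t :=
    hqi.continuousOn_mul (by fun_prop)
  have hneg : Tendsto (fun y : ℝ => -y) (𝓝[>] 0) (𝓝[<] 0) := by
    have := tendsto_neg_nhdsGT (a := (0 : ℝ))
    rwa [neg_zero] at this
  have hneg' : Tendsto (fun y : ℝ => -y) (𝓝[>] 0) (𝓝[Ioc (-a) 0] 0) := by
    refine tendsto_nhdsWithin_iff.2 ⟨hneg.mono_right nhdsWithin_le_nhds, ?_⟩
    filter_upwards [Ioo_mem_nhdsGT (ht.1.trans ht.2)] with s hs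
    exact ⟨(hmem s hs).1, (hmem s hs).2.le⟩
  have hd1 : ∀ s ∈ Ioo 0 a, HasDerivAt (fun s => f (-s)) (-(deriv f (-s))) s := by
    intro s hs
    have := (hf.1 (-s) (hmem s hs)).1.hasDerivAt.scomp s (hasDerivAt_neg s)
    rw [neg_smul, one_smul] at this
    exact this
  have hd2 : ∀ s ∈ Ioo 0 a, HasDerivAt (fun s => deriv f (-s)) (-(q s)) s := by
    intro s hs
    have := (hf.1 (-s) (hmem s hs)).2.hasDerivAt.scomp s (hasDerivAt_neg s)
    rw [neg_smul, one_smul] at this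
    exact this
  -- An explicit primitive of `(t - s) f''(-s)`, namely integration by parts in differentiated form.
  have hd : ∀ s ∈ Ioo 0 a, HasDerivAt (fun s => f (-s) - (t - s) * deriv f (-s))
      ((t - s) * q s) s := by
    intro s hs
    refine ((hd1 s hs).sub (((hasDerivAt_id s).const_sub t).mul (hd2 s hs))).congr_deriv ?_
    simp only [id]; ring
  have h1 : ∫ s in (0 : ℝ)..t, (t - s) * q s = f (-t) - (f 0 - t * l) := by
    refine intervalIntegral.integral_eq_sub_of_hasDerivAt_of_tendsto ht.1
      (fun s hs => hd s ⟨hs.1, hs.2.trans ht.2⟩) hqi2 ?_ ?_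
    · have e1 : Tendsto (fun s => f (-s)) (𝓝[>] 0) (𝓝 (f 0)) :=
        (hc 0 ⟨by linarith [ht.1, ht.2], le_rfl⟩).tendsto.comp hneg'
      have e2 : Tendsto (fun s : ℝ => t - s) (𝓝[>] 0) (𝓝 t) := by
        have : Tendsto (fun s : ℝ => t - s) (𝓝 0) (𝓝 (t - 0)) :=
          (continuous_const.sub continuous_id).tendsto 0
        rw [sub_zero] at this
        exact this.mono_left nhdsWithin_le_nhds
      exact e1.sub (e2.mul (hl.comp hneg))
    · have := (hd t ht).continuousAt.tendsto
      simp only [sub_self, zero_mul, sub_zero] at this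
      exact this.mono_left nhdsWithin_le_nhds
  have hb2 : β + (2 - β) = 2 := by ring
  have h2 := fracInt_fracInt (μ := β) (ν := 2 - β) (by linarith) (by linarith) ht.1 (f := q)
    hqm.aestronglyMeasurable (by simpa only [hb2, rlKernel_two] using hqi2)
  rw [fracInt_congr ht.1.le fun s hs => (caputoNeg_eq_fracInt f hs.1.le), h2, fracInt, hb2]
  simp only [rlKernel_two, h1]
  ring

/-! ### Green's identity and the Fourier coefficients -/

/-- The Lagrange bilinear concomitant. -/
def concomitant (n : ℕ) (p q : ℕ → ℝ → ℝ) (x : ℝ) : ℝ :=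
  ∑ j ∈ Finset.range n, (-1) ^ j * p j x * q (n - 1 - j) x

/-- The product rule turns each summand into a difference of consecutive terms, and the alternating
signs make the sum telescope. -/
lemma hasDerivAt_concomitant {n : ℕ} {p q : ℕ → ℝ → ℝ} {x : ℝ}
    (hp : ∀ j < n, HasDerivAt (p j) (p (j + 1) x) x)
    (hq : ∀ j < n, HasDerivAt (q j) (q (j + 1) x) x) :
    HasDerivAt (concomitant n p q) (p 0 x * q n x - (-1) ^ n * p n x * q 0 x) x := by
  have h := HasDerivAt.fun_sum (u := Finset.range n)
    (A := fun j x => (-1) ^ j * p j x * q (n - 1 - j) x)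
    (A' := fun j => (-1) ^ j * p j x * q (n - j) x - (-1) ^ (j + 1) * p (j + 1) x * q (n - (j + 1)) x)
    (x := x) ?_
  · rw [Finset.sum_range_sub' (fun j => (-1) ^ j * p j x * q (n - j) x)] at h
    simp only [pow_zero, one_mul, Nat.sub_zero, Nat.sub_self] at h
    exact h
  · intro j hj
    have hj' := Finset.mem_range.1 hj
    refine (((hp j hj').const_mul ((-1) ^ j)).mul (hq (n - 1 - j) (by omega))).congr_deriv ?_
    rw [show n - 1 - j + 1 = n - j by omega, show n - (j + 1) = n - 1 - j by omega]
    ring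

/-- An exhaustion of `(0,1)` by compact intervals. -/
def cutSet (n : ℕ) : Set ℝ := Icc (1 / ((n : ℝ) + 3)) (1 - 1 / ((n : ℝ) + 3))

/-- The shift by `3` makes the interval nonempty already for `n = 0`. -/
lemma cutSet_aux (n : ℕ) : 0 < 1 / ((n : ℝ) + 3) ∧ 1 / ((n : ℝ) + 3) ≤ 1 - 1 / ((n : ℝ) + 3) := by
  have h : (0 : ℝ) < (n : ℝ) + 3 := by positivity
  refine ⟨by positivity, ?_⟩
  have : 1 / ((n : ℝ) + 3) ≤ 1 / 2 := by
    apply one_div_le_one_div_of_le <;> linarith [Nat.cast_nonneg (α := ℝ) n]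
  linarith

lemma left_mem_cutSet (n : ℕ) : 1 / ((n : ℝ) + 3) ∈ cutSet n := left_mem_Icc.2 (cutSet_aux n).2

lemma right_mem_cutSet (n : ℕ) : 1 - 1 / ((n : ℝ) + 3) ∈ cutSet n :=
  right_mem_Icc.2 (cutSet_aux n).2

lemma isCompact_cutSet (n : ℕ) : IsCompact (cutSet n) := isCompact_Icc

lemma cutSet_subset (n : ℕ) : cutSet n ⊆ Ioo 0 1 := fun x hx =>
  ⟨(cutSet_aux n).1.trans_le hx.1, by have := hx.2; have := (cutSet_aux n).1; linarith⟩

lemma monotone_cutSet : Monotone cutSet := by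
  intro i j hij
  have h : 1 / ((j : ℝ) + 3) ≤ 1 / ((i : ℝ) + 3) := by
    apply one_div_le_one_div_of_le (by positivity)
    have : (i : ℝ) ≤ j := by exact_mod_cast hij
    linarith
  exact Icc_subset_Icc h (by linarith)

lemma tendsto_cut : Tendsto (fun n : ℕ => 1 / ((n : ℝ) + 3)) atTop (𝓝 0) := by
  have h : Tendsto (fun n : ℕ => (n : ℝ) + 3) atTop atTop :=
    tendsto_atTop_add_const_right _ _ tendsto_natCast_atTop_atTop
  simp only [one_div]
  exact h.inv_tendsto_atTop

lemma iUnion_cutSet : ⋃ n, cutSet n = Ioo 0 1 := by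
  refine subset_antisymm (iUnion_subset cutSet_subset) fun x hx => ?_
  have h := tendsto_cut.eventually (gt_mem_nhds (lt_min hx.1 (sub_pos.2 hx.2)))
  obtain ⟨n, hn⟩ := h.exists
  rw [lt_min_iff] at hn
  exact mem_iUnion.2 ⟨n, hn.1.le, by linarith [hn.2]⟩

lemma tendsto_setIntegral_cutSet {f : ℝ → ℝ} (hf : IntegrableOn f (Ioo 0 1)) :
    Tendsto (fun n => ∫ x in cutSet n, f x) atTop (𝓝 (∫ x in Ioo 0 1, f x)) := by
  have := tendsto_setIntegral_of_monotone (μ := volume) (f := f) (s := cutSet)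
    (fun _ => measurableSet_Icc) monotone_cutSet (by rwa [iUnion_cutSet])
  rwa [iUnion_cutSet] at this

/-- Fractional integration in one variable commutes with integration over a compact set in the
other. -/
lemma setIntegral_fracInt {μ y : ℝ} (hμ : 0 < μ) (hy : 0 < y) {E : Set ℝ} (hE : IsCompact E)
    {h : ℝ → ℝ → ℝ} (hh : ContinuousOn (Function.uncurry h) (E ×ˢ Icc 0 y)) :
    ∫ x in E, fracInt μ (h x) y = fracInt μ (fun z => ∫ x in E, h x z) y ∧
    AEStronglyMeasurable (fun z => rlKernel μ (y - z) * ∫ x in E, h x z)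
      (volume.restrict (Ioc 0 y)) := by
  have hfin : IsFiniteMeasure (volume.restrict E) := ⟨by simpa using hE.measure_lt_top⟩
  have hk : Integrable (fun z => rlKernel μ (y - z)) (volume.restrict (Ioc 0 y)) := by
    have := intervalIntegrable_rlKernel_sub hμ hy
    rwa [intervalIntegrable_iff_integrableOn_Ioc_of_le hy.le] at this
  obtain ⟨C, hC⟩ := (hE.prod isCompact_Icc).exists_bound_of_continuousOn hh
  have hint : Integrable (Function.uncurry fun x z => rlKernel μ (y - z) * h x z)
      ((volume.restrict E).prod (volume.restrict (Ioc 0 y))) := by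
    have hsub : E ×ˢ Ioc 0 y ⊆ E ×ˢ Icc 0 y := prod_mono_right Ioc_subset_Icc_self
    have hms : MeasurableSet (E ×ˢ Ioc 0 y) := hE.measurableSet.prod measurableSet_Ioc
    refine Integrable.mul_bdd (c := C) (hk.comp_snd (volume.restrict E)) ?_ ?_
    · rw [Measure.prod_restrict]
      exact (hh.mono hsub).aestronglyMeasurable hms
    · rw [Measure.prod_restrict]
      filter_upwards [ae_restrict_mem hms] with p hp using hC p (hsub hp)
  have e : ∀ z, ∫ x in E, rlKernel μ (y - z) * h x z = rlKernel μ (y - z) * ∫ x in E, h x z :=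
    fun z => integral_const_mul _ _
  constructor
  · have := integral_integral_swap hint
    simp only [fracInt, intervalIntegral.integral_of_le hy.le]
    rw [this]
    simp_rw [e]
  · have := hint.integral_prod_right.aestronglyMeasurable
    simpa only [Function.uncurry, e] using this

/-- The Fourier coefficient of `u(·, y)` with respect to `X` and the weight `x ^ (-m)`. -/
def coeff (m : ℝ) (X : ℝ → ℝ) (u : ℝ → ℝ → ℝ) (y : ℝ) : ℝ :=
  ∫ x in Ioo (0 : ℝ) 1, x ^ (-m) * X x * u x y

/-- The spatial part `-(-1)ᵏ xᵐ ∂ₓ²ᵏ u` of the equation. -/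
def spatial (k : ℕ) (m : ℝ) (u : ℝ → ℝ → ℝ) (x y : ℝ) : ℝ :=
  -((-1) ^ k * x ^ m * dx (2 * k) u x y)

section

variable {k : ℕ} {m α β a b lam : ℝ} {φ X : ℝ → ℝ} {u : ℝ → ℝ → ℝ}

lemma IsSolution.continuousOn (hu : IsSolution k m α β a b φ u) :
    ContinuousOn (fun p : ℝ × ℝ => u p.1 p.2) (Icc 0 1 ×ˢ Icc (-a) b) := by
  simpa [dx] using hu.continuous_dx 0 (Nat.zero_le _)

lemma IsSolution.continuousOn_spatial (hu : IsSolution k m α β a b φ u) :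
    ContinuousOn (fun p : ℝ × ℝ => spatial k m u p.1 p.2) (Ioo 0 1 ×ˢ Ioo (-a) b) := by
  unfold spatial
  refine ((continuousOn_const.mul (continuousOn_fst.rpow_const fun p hp => ?_)).mul
    hu.continuous_dx_top).neg
  exact Or.inl (ne_of_gt hp.1.1)

lemma IsSolution.exists_bound (hu : IsSolution k m α β a b φ u) :
    ∃ C, 0 ≤ C ∧ ∀ x ∈ Icc (0 : ℝ) 1, ∀ y ∈ Icc (-a) b, |u x y| ≤ C := by
  obtain ⟨C, hC⟩ := (isCompact_Icc.prod isCompact_Icc).exists_bound_of_continuousOn hu.continuousOn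
  exact ⟨|C|, abs_nonneg C, fun x hx y hy => (hC (x, y) ⟨hx, hy⟩).trans (le_abs_self C)⟩

lemma continuousOn_coeff_integrand (hX : IsEigenfunction k m lam X)
    (hu : IsSolution k m α β a b φ u) {y : ℝ} (hy : y ∈ Icc (-a) b) :
    ContinuousOn (fun x => x ^ (-m) * X x * u x y) (Ioo 0 1) := by
  refine (hX.continuousOn_weighted m).mul ?_
  exact hu.continuousOn.comp (continuous_id.prodMk continuous_const).continuousOn
    fun x hx => ⟨Ioo_subset_Icc_self hx, hy⟩

lemma exists_bound_coeff_integrand (hk : 1 ≤ k) (hmk : m < k) (hX : IsEigenfunction k m lam X)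
    (hu : IsSolution k m α β a b φ u) :
    ∃ C, 0 ≤ C ∧ ∀ x ∈ Ioo (0 : ℝ) 1, ∀ y ∈ Icc (-a) b, |x ^ (-m) * X x * u x y| ≤ C := by
  obtain ⟨C, hC0, hC⟩ := hX.exists_weighted_bound hk hmk.le
  obtain ⟨D, hD0, hD⟩ := hu.exists_bound
  refine ⟨C * D, by positivity, fun x hx y hy => ?_⟩
  rw [abs_mul]
  exact mul_le_mul (hC x hx) (hD x (Ioo_subset_Icc_self hx) y hy) (abs_nonneg _) hC0

lemma integrableOn_coeff_integrand (hk : 1 ≤ k) (hmk : m < k) (hX : IsEigenfunction k m lam X)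
    (hu : IsSolution k m α β a b φ u) {y : ℝ} (hy : y ∈ Icc (-a) b) :
    IntegrableOn (fun x => x ^ (-m) * X x * u x y) (Ioo 0 1) := by
  obtain ⟨C, _, hC⟩ := exists_bound_coeff_integrand hk hmk hX hu
  exact Integrable.of_bound
    ((continuousOn_coeff_integrand hX hu hy).aestronglyMeasurable measurableSet_Ioo) C
    ((ae_restrict_mem measurableSet_Ioo).mono fun x hx => hC x hx y hy)

lemma continuousOn_coeff (hk : 1 ≤ k) (hmk : m < k) (hX : IsEigenfunction k m lam X)
    (hu : IsSolution k m α β a b φ u) : ContinuousOn (coeff m X u) (Icc (-a) b) := by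
  obtain ⟨C, _, hC⟩ := exists_bound_coeff_integrand hk hmk hX hu
  refine continuousOn_of_dominated (bound := fun _ => C) (fun y hy =>
    (continuousOn_coeff_integrand hX hu hy).aestronglyMeasurable measurableSet_Ioo)
    (fun y hy => (ae_restrict_mem measurableSet_Ioo).mono fun x hx => hC x hx y hy)
    (integrable_const C) ?_
  filter_upwards [ae_restrict_mem measurableSet_Ioo] with x hx
  exact continuousOn_const.mul (hu.continuousOn.comp
    (continuous_const.prodMk continuous_id).continuousOn fun y hy => ⟨Ioo_subset_Icc_self hx, hy⟩)

/-- The boundary form in the integration by parts of `X ∂ₓ²ᵏ u`. -/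
def boundaryForm (k : ℕ) (X : ℝ → ℝ) (u : ℝ → ℝ → ℝ) (x y : ℝ) : ℝ :=
  concomitant (2 * k) (fun j => iteratedDerivWithin j X (Icc 0 1)) (fun j s => dx j u s y) x

lemma continuousOn_boundaryForm (hX : IsEigenfunction k m lam X)
    (hu : IsSolution k m α β a b φ u) :
    ContinuousOn (fun p : ℝ × ℝ => boundaryForm k X u p.1 p.2) (Icc 0 1 ×ˢ Icc (-a) b) := by
  unfold boundaryForm concomitant
  refine continuousOn_finsetSum _ fun j hj => ?_
  have hj' := Finset.mem_range.1 hj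
  refine (continuousOn_const.mul ?_).mul (hu.continuous_dx _ (by omega))
  have hc := hX.contDiff_Icc.continuousOn_iteratedDerivWithin (m := j)
      (by exact_mod_cast (by omega : j ≤ 2 * k - 1)) (uniqueDiffOn_Icc one_pos)
  exact hc.comp continuousOn_fst fun p hp => hp.1

/-- In every product the orders of the two derivatives add up to `2k - 1`, so one of them is below
`k` and its boundary condition applies. -/
lemma boundaryForm_endpoint (hX : IsEigenfunction k m lam X)
    (hu : IsSolution k m α β a b φ u) {y : ℝ} (hy : y ∈ Icc (-a) b) :
    boundaryForm k X u 0 y = 0 ∧ boundaryForm k X u 1 y = 0 := by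
  unfold boundaryForm concomitant
  constructor <;> refine Finset.sum_eq_zero fun j hj => ?_ <;> by_cases h : j < k
  · simp [(hX.boundary j h).1]
  · simp [(hu.boundary (2 * k - 1 - j) (by have := Finset.mem_range.1 hj; omega) y hy).1]
  · simp [(hX.boundary j h).2]
  · simp [(hu.boundary (2 * k - 1 - j) (by have := Finset.mem_range.1 hj; omega) y hy).2]

/-- Green's identity on a compact subinterval, where `∂ₓ²ᵏ u` is continuous. The weight `x ^ (-m)`
cancels `x ^ m`, and the eigenvalue equation restores it after all derivatives have moved to `X`. -/
lemma setIntegral_spatial (hk : 1 ≤ k) (hX : IsEigenfunction k m lam X)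
    (hu : IsSolution k m α β a b φ u) (n : ℕ) {y : ℝ} (hy : y ∈ Ioo (-a) b) :
    ∫ x in cutSet n, x ^ (-m) * X x * spatial k m u x y =
      -(-1) ^ k * (boundaryForm k X u (1 - 1 / ((n : ℝ) + 3)) y -
        boundaryForm k X u (1 / ((n : ℝ) + 3)) y)
      - lam * ∫ x in cutSet n, x ^ (-m) * X x * u x y := by
  have hsub := cutSet_subset n
  have hle := (cutSet_aux n).2
  have hyI := Ioo_subset_Icc_self hy
  have hE : uIcc (1 / ((n : ℝ) + 3)) (1 - 1 / ((n : ℝ) + 3)) = cutSet n := uIcc_of_le hle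
  have hd : ∀ x ∈ cutSet n, HasDerivAt (fun x => boundaryForm k X u x y)
      (X x * dx (2 * k) u x y - (-1) ^ k * lam * (x ^ (-m) * X x * u x y)) x := by
    intro x hx
    have h := hasDerivAt_concomitant (n := 2 * k) (x := x)
      (p := fun j => iteratedDerivWithin j X (Icc 0 1)) (q := fun j s => dx j u s y)
      (fun j hj => hasDerivAt_iteratedDerivWithin hX.contDiff_Icc (hX.differentiableOn_top hk) hj
        (hsub hx))
      (fun j hj => hu.hasDerivAt_dx hj (hsub hx) hyI)
    refine h.congr_deriv ?_
    rw [hX.eq_within (hsub hx)]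
    simp only [iteratedDerivWithin_zero, dx, pow_mul]
    ring
  have hc1 : ContinuousOn (fun x => X x * dx (2 * k) u x y) (cutSet n) := by
    refine (hX.continuousOn.mono (hsub.trans Ioo_subset_Icc_self)).mul ?_
    exact hu.continuous_dx_top.comp (continuous_id.prodMk continuous_const).continuousOn
      fun x hx => ⟨hsub hx, hy⟩
  have hc2 : ContinuousOn (fun x => x ^ (-m) * X x * u x y) (cutSet n) :=
    (continuousOn_coeff_integrand hX hu hyI).mono hsub
  have hi1 := hc1.integrableOn_compact (μ := volume) (isCompact_cutSet n)
  have hi2 := hc2.integrableOn_compact (μ := volume) (isCompact_cutSet n)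
  have hftc := intervalIntegral.integral_eq_sub_of_hasDerivAt (f := fun x => boundaryForm k X u x y)
    (fun x hx => hd x (hE ▸ hx)) (ContinuousOn.intervalIntegrable
      (by rw [hE]; exact hc1.sub (continuousOn_const.mul hc2)))
  rw [intervalIntegral.integral_of_le hle, ← integral_Icc_eq_integral_Ioc] at hftc
  change ∫ x in cutSet n, _ = _ at hftc
  rw [integral_sub hi1 (hi2.const_mul _), integral_const_mul] at hftc
  have e : ∫ x in cutSet n, x ^ (-m) * X x * spatial k m u x y =
      ∫ x in cutSet n, -(-1) ^ k * (X x * dx (2 * k) u x y) := by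
    refine setIntegral_congr_fun measurableSet_Icc fun x hx => ?_
    have h2 : x ^ m * x ^ (-m) = 1 := by rw [← Real.rpow_add (hsub hx).1]; simp
    simp only [spatial]
    linear_combination (-(-1) ^ k * X x * dx (2 * k) u x y) * h2
  rw [e, integral_const_mul]
  have h1 : ((-1 : ℝ) ^ k) * (-1) ^ k = 1 := by rw [← mul_pow]; simp
  linear_combination (-(-1) ^ k) * hftc
    - lam * (∫ x in cutSet n, x ^ (-m) * X x * u x y) * h1

/-- The boundary form is continuous up to `x = 0` and `x = 1` and vanishes there, since it involves
only derivatives of order at most `2k - 1`. -/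
lemma tendsto_setIntegral_spatial (hk : 1 ≤ k) (hmk : m < k) (hX : IsEigenfunction k m lam X)
    (hu : IsSolution k m α β a b φ u) {y : ℝ} (hy : y ∈ Ioo (-a) b) :
    Tendsto (fun n => ∫ x in cutSet n, x ^ (-m) * X x * spatial k m u x y) atTop
      (𝓝 (-lam * coeff m X u y)) := by
  have hyI := Ioo_subset_Icc_self hy
  refine Tendsto.congr (fun n => (setIntegral_spatial hk hX hu n hy).symm) ?_
  have hc : ContinuousOn (fun x => boundaryForm k X u x y) (Icc 0 1) :=
    (continuousOn_boundaryForm hX hu).comp (f := fun x : ℝ => (x, y)) (by fun_prop)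
      fun x hx => ⟨hx, hyI⟩
  have hm1 : ∀ n : ℕ, 1 / ((n : ℝ) + 3) ∈ Icc (0 : ℝ) 1 := fun n =>
    Ioo_subset_Icc_self (cutSet_subset n (left_mem_cutSet n))
  have hm2 : ∀ n : ℕ, 1 - 1 / ((n : ℝ) + 3) ∈ Icc (0 : ℝ) 1 := fun n =>
    Ioo_subset_Icc_self (cutSet_subset n (right_mem_cutSet n))
  have ht0 : Tendsto (fun n : ℕ => boundaryForm k X u (1 / ((n : ℝ) + 3)) y) atTop
      (𝓝 (boundaryForm k X u 0 y)) := (hc 0 (left_mem_Icc.2 zero_le_one)).tendsto.comp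
    (tendsto_nhdsWithin_iff.2 ⟨tendsto_cut, Eventually.of_forall hm1⟩)
  have hcut1 : Tendsto (fun n : ℕ => 1 - 1 / ((n : ℝ) + 3)) atTop (𝓝 1) := by
    simpa using tendsto_cut.const_sub 1
  have ht1 : Tendsto (fun n : ℕ => boundaryForm k X u (1 - 1 / ((n : ℝ) + 3)) y) atTop
      (𝓝 (boundaryForm k X u 1 y)) := (hc 1 (right_mem_Icc.2 zero_le_one)).tendsto.comp
    (tendsto_nhdsWithin_iff.2 ⟨hcut1, Eventually.of_forall hm2⟩)
  rw [(boundaryForm_endpoint hX hu hyI).1] at ht0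
  rw [(boundaryForm_endpoint hX hu hyI).2] at ht1
  have ht2 : Tendsto (fun n => ∫ x in cutSet n, x ^ (-m) * X x * u x y) atTop
      (𝓝 (coeff m X u y)) := tendsto_setIntegral_cutSet (integrableOn_coeff_integrand hk hmk hX hu hyI)
  have := ((ht1.sub ht0).const_mul (-(-1) ^ k)).sub (ht2.const_mul lam)
  rwa [sub_zero, mul_zero, zero_sub, ← neg_mul] at this

/-- Every term on the right of Green's identity is bounded uniformly in `n` and `y`, although the
integrand on the left has no such bound near the ends of `(0,1)`. This provides the dominating
function for the next limit. -/
lemma exists_bound_setIntegral_spatial (hk : 1 ≤ k) (hmk : m < k) (hX : IsEigenfunction k m lam X)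
    (hu : IsSolution k m α β a b φ u) :
    ∃ C, ∀ n, ∀ y ∈ Ioo (-a) b, |∫ x in cutSet n, x ^ (-m) * X x * spatial k m u x y| ≤ C := by
  obtain ⟨D, hD⟩ := (isCompact_Icc.prod isCompact_Icc).exists_bound_of_continuousOn
    (continuousOn_boundaryForm hX hu)
  obtain ⟨C, hC0, hC⟩ := exists_bound_coeff_integrand hk hmk hX hu
  refine ⟨D + D + |lam| * C, fun n y hy => ?_⟩
  have hyI := Ioo_subset_Icc_self hy
  rw [setIntegral_spatial hk hX hu n hy]
  have h1 := hD (1 / ((n : ℝ) + 3), y)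
    ⟨Ioo_subset_Icc_self (cutSet_subset n (left_mem_cutSet n)), hyI⟩
  have h2 := hD (1 - 1 / ((n : ℝ) + 3), y)
    ⟨Ioo_subset_Icc_self (cutSet_subset n (right_mem_cutSet n)), hyI⟩
  have hvol : volume.real (cutSet n) ≤ 1 := by
    have := (cutSet_aux n).1
    rw [cutSet, Real.volume_real_Icc_of_le (cutSet_aux n).2]
    linarith
  have h3 : ‖∫ x in cutSet n, x ^ (-m) * X x * u x y‖ ≤ C := by
    refine (norm_setIntegral_le_of_norm_le_const (C := C) (by simp [cutSet])
      fun x hx => hC x (cutSet_subset n hx) y hyI).trans ?_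
    exact mul_le_of_le_one_right hC0 hvol
  have h4 : |(-(-1 : ℝ) ^ k)| = 1 := by simp
  refine (abs_sub _ _).trans ?_
  rw [abs_mul, h4, one_mul, abs_mul]
  exact add_le_add ((abs_sub _ _).trans (add_le_add h2 h1))
    (mul_le_mul_of_nonneg_left h3 (abs_nonneg _))

/-- On each `cutSet` the two integrations commute; dominated convergence in `z` then lets the
subintervals grow. The parameter `σ` is `1` for the upper side and `-1` for the lower. -/
lemma tendsto_setIntegral_fracInt_spatial (hk : 1 ≤ k) (hmk : m < k)
    (hX : IsEigenfunction k m lam X) (hu : IsSolution k m α β a b φ u) {μ y : ℝ} (hμ : 0 < μ)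
    (hy : 0 < y) {σ : ℝ} (hσ : ∀ z ∈ Icc 0 y, σ * z ∈ Ioo (-a) b) :
    Tendsto (fun n => ∫ x in cutSet n,
        x ^ (-m) * X x * fracInt μ (fun z => spatial k m u x (σ * z)) y) atTop
      (𝓝 (-lam * fracInt μ (fun z => coeff m X u (σ * z)) y)) := by
  have hF : ∀ n, ContinuousOn (Function.uncurry
      fun x z => x ^ (-m) * X x * spatial k m u x (σ * z)) (cutSet n ×ˢ Icc 0 y) := by
    intro n
    refine ContinuousOn.mul ?_ ?_
    · exact (hX.continuousOn_weighted m).comp continuousOn_fst fun p hp => cutSet_subset n hp.1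
    · refine hu.continuousOn_spatial.comp (f := fun p : ℝ × ℝ => (p.1, σ * p.2)) ?_
        fun p hp => ⟨cutSet_subset n hp.1, hσ _ hp.2⟩
      fun_prop
  have hsw := fun n => setIntegral_fracInt hμ hy (isCompact_cutSet n) (hF n)
  have e : ∀ n, ∫ x in cutSet n, x ^ (-m) * X x * fracInt μ (fun z => spatial k m u x (σ * z)) y
      = fracInt μ (fun z => ∫ x in cutSet n, x ^ (-m) * X x * spatial k m u x (σ * z)) y := by
    intro n
    rw [← (hsw n).1]
    refine integral_congr_ae (ae_of_all _ fun x => ?_)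
    exact fracInt_const_mul.symm
  simp_rw [e]
  rw [← fracInt_const_mul]
  simp only [fracInt, intervalIntegral.integral_of_le hy.le]
  obtain ⟨C, hC⟩ := exists_bound_setIntegral_spatial hk hmk hX hu
  have hk' : Integrable (fun z => rlKernel μ (y - z)) (volume.restrict (Ioc 0 y)) := by
    have := intervalIntegrable_rlKernel_sub hμ hy
    rwa [intervalIntegrable_iff_integrableOn_Ioc_of_le hy.le] at this
  refine tendsto_integral_of_dominated_convergence (fun z => ‖rlKernel μ (y - z)‖ * C)
    (fun n => (hsw n).2) (hk'.norm.mul_const C) (fun n => ?_) ?_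
  · filter_upwards [ae_restrict_mem measurableSet_Ioc] with z hz
    rw [norm_mul]
    exact mul_le_mul_of_nonneg_left (hC n _ (hσ z (Ioc_subset_Icc_self hz))) (norm_nonneg _)
  · filter_upwards [ae_restrict_mem measurableSet_Ioc] with z hz
    exact (tendsto_setIntegral_spatial hk hmk hX hu (hσ z (Ioc_subset_Icc_self hz))).const_mul _

end

/-! ### Volterra equations for the coefficients -/

section

variable {k : ℕ} {m α β a b lam : ℝ} {φ X : ℝ → ℝ} {u : ℝ → ℝ → ℝ}

lemma IsSolution.continuousOn_y (hu : IsSolution k m α β a b φ u) {x : ℝ} (hx : x ∈ Icc (0 : ℝ) 1) :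
    ContinuousOn (u x) (Icc (-a) b) :=
  hu.continuousOn.comp (f := fun y : ℝ => (x, y)) (by fun_prop) fun _ hy => ⟨hx, hy⟩

lemma IsSolution.eq_pos_fracInt (ha : 0 < a) (hα0 : 0 < α) (hα1 : α < 1)
    (hu : IsSolution k m α β a b φ u) {x y : ℝ} (hx : x ∈ Ioo (0 : ℝ) 1) (hy : y ∈ Ioo 0 b) :
    u x y = u x 0 + fracInt α (spatial k m u x) y := by
  rw [eq_add_fracInt_caputoPos hα0 hα1 (hu.caputoPos_exists x hx)
    ((hu.continuousOn_y (Ioo_subset_Icc_self hx)).mono fun z hz => ⟨by linarith [hz.1], hz.2.le⟩) y hy]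
  congr 1
  refine fracInt_congr hy.1.le fun z hz => ?_
  rw [spatial]
  linarith [hu.eq_pos x hx z ⟨hz.1, hz.2.trans hy.2⟩]

/-- The gluing condition equates `u_y(x,-0)` with `D^α u(x,+0)`; the latter is found from the
equation for `y > 0`, because `∂ₓ²ᵏ u` is continuous across `y = 0`. -/
lemma IsSolution.tendsto_deriv (ha : 0 < a) (hb : 0 < b) (hu : IsSolution k m α β a b φ u)
    {x : ℝ} (hx : x ∈ Ioo (0 : ℝ) 1) :
    Tendsto (deriv (u x)) (𝓝[<] 0) (𝓝 (spatial k m u x 0)) := by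
  obtain ⟨l, h1, h2⟩ := hu.gluing_deriv x (Ioo_subset_Icc_self hx)
  have h0 : (0 : ℝ) ∈ Ioo (-a) b := ⟨by linarith, hb⟩
  have hc : ContinuousOn (spatial k m u x) (Ioo (-a) b) :=
    hu.continuousOn_spatial.comp (f := fun y : ℝ => (x, y)) (by fun_prop) fun _ hy => ⟨hx, hy⟩
  have h3 : Tendsto (caputoPos α (u x)) (𝓝[>] 0) (𝓝 (spatial k m u x 0)) := by
    refine ((hc.continuousAt (isOpen_Ioo.mem_nhds h0)).tendsto.mono_left
      nhdsWithin_le_nhds).congr' ?_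
    filter_upwards [Ioo_mem_nhdsGT hb] with y hy
    rw [spatial]
    linarith [hu.eq_pos x hx y hy]
  rwa [tendsto_nhds_unique h1 h3] at h2

lemma IsSolution.eq_neg_fracInt (ha : 0 < a) (hb : 0 < b) (hβ1 : 1 < β) (hβ2 : β < 2)
    (hu : IsSolution k m α β a b φ u) {x t : ℝ} (hx : x ∈ Ioo (0 : ℝ) 1) (ht : t ∈ Ioo 0 a) :
    u x (-t) = u x 0 - t * spatial k m u x 0 + fracInt β (fun s => spatial k m u x (-s)) t := by
  rw [eq_add_fracInt_caputoNeg hβ1 hβ2 (hu.caputoNeg_exists x hx)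
    ((hu.continuousOn_y (Ioo_subset_Icc_self hx)).mono fun z hz => ⟨hz.1.le, by linarith [hz.2]⟩)
    (hu.tendsto_deriv ha hb hx) t ht]
  congr 1
  refine fracInt_congr ht.1.le fun z hz => ?_
  rw [spatial]
  linarith [hu.eq_neg x hx (-z) ⟨by linarith [hz.2, ht.2], by linarith [hz.1]⟩]

lemma tendsto_setIntegral_coeff (hk : 1 ≤ k) (hmk : m < k) (hX : IsEigenfunction k m lam X)
    (hu : IsSolution k m α β a b φ u) {y : ℝ} (hy : y ∈ Icc (-a) b) :
    Tendsto (fun n => ∫ x in cutSet n, x ^ (-m) * X x * u x y) atTop (𝓝 (coeff m X u y)) :=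
  tendsto_setIntegral_cutSet (integrableOn_coeff_integrand hk hmk hX hu hy)

/-- The integrated equation is tested with `x ^ (-m) X` on `cutSet n`; the two sides have limits
computed independently, and these must agree. -/
lemma coeff_volterra_pos (hk : 1 ≤ k) (hmk : m < k) (ha : 0 < a) (hα0 : 0 < α) (hα1 : α < 1)
    (hX : IsEigenfunction k m lam X) (hu : IsSolution k m α β a b φ u) {y : ℝ} (hy : y ∈ Ioo 0 b) :
    coeff m X u y = coeff m X u 0 - lam * fracInt α (coeff m X u) y := by
  have hy1 : y ∈ Icc (-a) b := ⟨by linarith [hy.1], hy.2.le⟩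
  have hy0 : (0 : ℝ) ∈ Icc (-a) b := ⟨by linarith, (hy.1.trans hy.2).le⟩
  have h1 := (tendsto_setIntegral_coeff hk hmk hX hu hy1).sub
    (tendsto_setIntegral_coeff hk hmk hX hu hy0)
  have h2 := tendsto_setIntegral_fracInt_spatial hk hmk hX hu hα0 hy.1 (σ := 1)
    (fun z hz => by rw [one_mul]; exact ⟨by linarith [hz.1], hz.2.trans_lt hy.2⟩)
  simp only [one_mul] at h2
  have hi := fun n z hz => (integrableOn_coeff_integrand hk hmk hX hu (y := z) hz).mono_set
    (cutSet_subset n)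
  have e : ∀ n, (∫ x in cutSet n, x ^ (-m) * X x * u x y) - ∫ x in cutSet n, x ^ (-m) * X x * u x 0
      = ∫ x in cutSet n, x ^ (-m) * X x * fracInt α (spatial k m u x) y := by
    intro n
    rw [← integral_sub (hi n y hy1) (hi n 0 hy0)]
    refine setIntegral_congr_fun measurableSet_Icc fun x hx => ?_
    simp only [hu.eq_pos_fracInt ha hα0 hα1 (cutSet_subset n hx) hy]
    ring
  simp_rw [e] at h1
  linarith [tendsto_nhds_unique h1 h2]

/-- As on the positive side, except that the initial slope contributes `-t` times the spatial term
at `y = 0`, whose pairing tends to `-lam` times the coefficient; this produces the factor `1 + lam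
t`. -/
lemma coeff_volterra_neg (hk : 1 ≤ k) (hmk : m < k) (hb : 0 < b) (hβ1 : 1 < β) (hβ2 : β < 2)
    (hX : IsEigenfunction k m lam X) (hu : IsSolution k m α β a b φ u) {t : ℝ} (ht : t ∈ Ioo 0 a) :
    coeff m X u (-t) = coeff m X u 0 * (1 + lam * t)
      - lam * fracInt β (fun s => coeff m X u (-s)) t := by
  have ha : 0 < a := ht.1.trans ht.2
  have hy1 : -t ∈ Icc (-a) b := ⟨by linarith [ht.2], by linarith [ht.1]⟩
  have hy0 : (0 : ℝ) ∈ Ioo (-a) b := ⟨by linarith, hb⟩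
  have h1 := ((tendsto_setIntegral_coeff hk hmk hX hu hy1).sub
    (tendsto_setIntegral_coeff hk hmk hX hu (Ioo_subset_Icc_self hy0))).add
    ((tendsto_setIntegral_spatial hk hmk hX hu hy0).const_mul t)
  have h2 := tendsto_setIntegral_fracInt_spatial hk hmk hX hu (by linarith : 0 < β) ht.1 (σ := -1)
    (fun z hz => ⟨by linarith [hz.2, ht.2], by linarith [hz.1]⟩)
  simp only [neg_one_mul] at h2
  have hi := fun n z hz => (integrableOn_coeff_integrand hk hmk hX hu (y := z) hz).mono_set
    (cutSet_subset n)
  have hi3 : ∀ n, IntegrableOn (fun x => x ^ (-m) * X x * spatial k m u x 0) (cutSet n) := by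
    intro n
    refine ContinuousOn.integrableOn_compact (isCompact_cutSet n) ?_
    refine ((hX.continuousOn_weighted m).mono (cutSet_subset n)).mul ?_
    exact hu.continuousOn_spatial.comp (f := fun x : ℝ => (x, 0)) (by fun_prop)
      fun _ hx => ⟨cutSet_subset n hx, hy0⟩
  have e : ∀ n, (∫ x in cutSet n, x ^ (-m) * X x * u x (-t)) -
      (∫ x in cutSet n, x ^ (-m) * X x * u x 0) +
      t * (∫ x in cutSet n, x ^ (-m) * X x * spatial k m u x 0)
      = ∫ x in cutSet n, x ^ (-m) * X x * fracInt β (fun s => spatial k m u x (-s)) t := by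
    intro n
    have hs : IntegrableOn (fun x => x ^ (-m) * X x * u x (-t) - x ^ (-m) * X x * u x 0) (cutSet n) :=
      (hi n _ hy1).sub (hi n 0 (Ioo_subset_Icc_self hy0))
    rw [← integral_sub (hi n _ hy1) (hi n 0 (Ioo_subset_Icc_self hy0)), ← integral_const_mul,
      ← integral_add hs ((hi3 n).const_mul t)]
    refine setIntegral_congr_fun measurableSet_Icc fun x hx => ?_
    simp only [hu.eq_neg_fracInt ha hb hβ1 hβ2 (cutSet_subset n hx) ht]
    ring
  simp_rw [e] at h1
  linarith [tendsto_nhds_unique h1 h2]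

/-- Two continuous solutions of the Volterra equation `v = w - lam I^μ v` agree up to the
right end point. -/
lemma eq_of_volterra {μ T : ℝ} (hμ : 0 < μ) (hT : 0 < T) {v w f : ℝ → ℝ}
    (hv : ContinuousOn v (Icc 0 T)) (hw : ContinuousOn w (Icc 0 T))
    (hve : ∀ t ∈ Ioo 0 T, v t = f t - lam * fracInt μ v t)
    (hwe : ∀ t ∈ Ioo 0 T, w t = f t - lam * fracInt μ w t) : ∀ t ∈ Ioc 0 T, v t = w t := by
  have hi : ∀ g : ℝ → ℝ, ContinuousOn g (Icc 0 T) → ∀ t ∈ Ioo 0 T,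
      IntervalIntegrable (fun z => rlKernel μ (t - z) * g z) volume 0 t := by
    intro g hg t ht
    refine (intervalIntegrable_rlKernel_sub hμ ht.1).mul_continuousOn (hg.mono ?_)
    rw [uIcc_of_le ht.1.le]
    exact Icc_subset_Icc_right ht.2.le
  obtain ⟨M, hM⟩ := isCompact_Icc.exists_bound_of_continuousOn (hv.sub hw)
  have h0 := eq_zero_of_eq_const_mul_fracInt (T := T) (M := M) (c := -lam) hμ
    (v := fun t => 1 * v t + -1 * w t)
    (fun t ht => by simpa [sub_eq_add_neg] using hM t (Ioo_subset_Icc_self ht))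
    (fun t ht => by
      rw [fracInt_add_mul (hi v hv t ht) (hi w hw t ht)]
      linarith [hve t ht, hwe t ht])
  have h1 : EqOn v w (Ioo 0 T) := fun t ht => by linarith [h0 t ht]
  -- The Volterra equations hold only in the open interval, while the nonlocal condition is read at
  -- its end; continuity bridges the gap.
  have h2 : EqOn v w (Icc 0 T) := by
    have hcl : Icc 0 T ⊆ closure (Ioo 0 T) := by rw [closure_Ioo hT.ne]
    exact h1.of_subset_closure hv hw Ioo_subset_Icc_self hcl
  exact fun t ht => h2 (Ioc_subset_Icc_self ht)

/-- If `Δ(lam) ≠ 0`, then the coefficients of a solution with zero data vanish. -/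
lemma coeff_eq_zero (hk : 1 ≤ k) (hmk : m < k) (hα0 : 0 < α) (hα1 : α < 1)
    (hβ1 : 1 < β) (hβ2 : β < 2) (ha : 0 < a) (hb : 0 < b)
    (hX : IsEigenfunction k m lam X) (hu : IsSolution k m α β a b (fun _ => 0) u)
    (hΔ : Delta α β a b lam ≠ 0) : ∀ y ∈ Icc (-a) b, coeff m X u y = 0 := by
  set c := coeff m X u 0 with hc
  have hβ0 : 0 < β := by linarith
  have hcont := continuousOn_coeff hk hmk hX hu
  have hpos : ∀ y ∈ Ioc 0 b, coeff m X u y = c * posProfile α lam y := by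
    refine eq_of_volterra (lam := lam) (f := fun _ => c) hα0 hb
      (hcont.mono (Icc_subset_Icc_left (by linarith)))
      (continuous_const.mul (continuous_posProfile hα0 lam)).continuousOn
      (fun y hy => coeff_volterra_pos hk hmk ha hα0 hα1 hX hu hy) fun y hy => ?_
    rw [fracInt_const_mul]
    linear_combination c * posProfile_volterra hα0 lam hy.1
  have hneg : ∀ t ∈ Ioc 0 a, coeff m X u (-t) = c * negProfile β lam t := by
    refine eq_of_volterra (lam := lam) (v := fun t => coeff m X u (-t))
      (f := fun t => c * (1 + lam * t)) hβ0 ha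
      (hcont.comp continuous_neg.continuousOn fun t ht => ⟨by linarith [ht.2], by linarith [ht.1]⟩)
      (continuous_const.mul (continuous_negProfile hβ0 lam)).continuousOn
      (fun y hy => coeff_volterra_neg hk hmk hb hβ1 hβ2 hX hu hy) fun y hy => ?_
    rw [fracInt_const_mul]
    linear_combination c * negProfile_volterra hβ0 lam hy.1
  have hba : coeff m X u b = coeff m X u (-a) := by
    refine setIntegral_congr_fun measurableSet_Ioo fun x hx => ?_
    have := hu.nonlocal x (Ioo_subset_Icc_self hx)
    simp only [sub_eq_zero.1 this]
  -- With both profiles inserted, the nonlocal condition reads `c * Δ = 0`.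
  rw [hpos b ⟨hb, le_rfl⟩, hneg a ⟨ha, le_rfl⟩, ← sub_eq_zero, ← mul_sub, ← Delta_eq] at hba
  have hc0 : c = 0 := (mul_eq_zero.1 hba).resolve_right hΔ
  intro y hy
  rcases lt_trichotomy y 0 with h | h | h
  · have := hneg (-y) ⟨by linarith, by linarith [hy.1]⟩
    rwa [neg_neg, hc0, zero_mul] at this
  · rw [h, ← hc, hc0]
  · rw [hpos y ⟨h, hy.2⟩, hc0, zero_mul]

end

/-! ### Iterated primitives -/

/-- The primitive vanishing at `0`. -/
def prim (f : ℝ → ℝ) (x : ℝ) : ℝ := ∫ t in (0 : ℝ)..x, f t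

/-- The primitive of `-f` vanishing at `1`. -/
def coprim (f : ℝ → ℝ) (x : ℝ) : ℝ := ∫ t in x..1, f t

lemma intervalIntegrable_of_integrableOn {f : ℝ → ℝ} (hf : IntegrableOn f (Ioo 0 1)) {x y : ℝ}
    (hx : x ∈ Icc (0 : ℝ) 1) (hy : y ∈ Icc (0 : ℝ) 1) : IntervalIntegrable f volume x y := by
  have h := (intervalIntegrable_iff_integrableOn_Ioo_of_le (zero_le_one' ℝ)).2 hf
  refine h.mono_set ?_
  rw [uIcc_of_le (zero_le_one' ℝ)]
  exact ordConnected_Icc.uIcc_subset hx hy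

lemma integrableOn_of_continuousOn {f : ℝ → ℝ} (hf : ContinuousOn f (Icc 0 1)) :
    IntegrableOn f (Ioo 0 1) :=
  (hf.integrableOn_compact isCompact_Icc).mono_set Ioo_subset_Icc_self

lemma continuousOn_prim {f : ℝ → ℝ} (hf : IntegrableOn f (Ioo 0 1)) :
    ContinuousOn (prim f) (Icc 0 1) := by
  have h := intervalIntegral.continuousOn_primitive_interval (f := f) (μ := volume) (a := 0) (b := 1)
    (by rw [uIcc_of_le (zero_le_one' ℝ)]; exact (integrableOn_Icc_iff_integrableOn_Ioo).2 hf)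
  rwa [uIcc_of_le (zero_le_one' ℝ)] at h

lemma coprim_eq {f : ℝ → ℝ} (hf : IntegrableOn f (Ioo 0 1)) {x : ℝ} (hx : x ∈ Icc (0 : ℝ) 1) :
    coprim f x = prim f 1 - prim f x :=
  (intervalIntegral.integral_interval_sub_left
    (intervalIntegrable_of_integrableOn hf (left_mem_Icc.2 zero_le_one) (right_mem_Icc.2 zero_le_one))
    (intervalIntegrable_of_integrableOn hf (left_mem_Icc.2 zero_le_one) hx)).symm

lemma continuousOn_coprim {f : ℝ → ℝ} (hf : IntegrableOn f (Ioo 0 1)) :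
    ContinuousOn (coprim f) (Icc 0 1) :=
  (continuousOn_const.sub (continuousOn_prim hf)).congr fun _ hx => coprim_eq hf hx

lemma integrableOn_prim_iterate {f : ℝ → ℝ} (hf : IntegrableOn f (Ioo 0 1)) (n : ℕ) :
    IntegrableOn (prim^[n] f) (Ioo 0 1) := by
  induction n with
  | zero => exact hf
  | succ n ih =>
    rw [Function.iterate_succ_apply']
    exact integrableOn_of_continuousOn (continuousOn_prim ih)

lemma integrableOn_coprim_iterate {f : ℝ → ℝ} (hf : IntegrableOn f (Ioo 0 1)) (n : ℕ) :
    IntegrableOn (coprim^[n] f) (Ioo 0 1) := by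
  induction n with
  | zero => exact hf
  | succ n ih =>
    rw [Function.iterate_succ_apply']
    exact integrableOn_of_continuousOn (continuousOn_coprim ih)

lemma continuousOn_prim_iterate_succ {f : ℝ → ℝ} (hf : IntegrableOn f (Ioo 0 1)) (n : ℕ) :
    ContinuousOn (prim^[n + 1] f) (Icc 0 1) := by
  rw [Function.iterate_succ_apply']
  exact continuousOn_prim (integrableOn_prim_iterate hf n)

lemma continuousOn_coprim_iterate_succ {f : ℝ → ℝ} (hf : IntegrableOn f (Ioo 0 1)) (n : ℕ) :
    ContinuousOn (coprim^[n + 1] f) (Icc 0 1) := by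
  rw [Function.iterate_succ_apply']
  exact continuousOn_coprim (integrableOn_coprim_iterate hf n)

lemma continuousOn_prim_iterate {f : ℝ → ℝ} (hf : ContinuousOn f (Icc 0 1)) (n : ℕ) :
    ContinuousOn (prim^[n] f) (Icc 0 1) := by
  cases n with
  | zero => exact hf
  | succ n => exact continuousOn_prim_iterate_succ (integrableOn_of_continuousOn hf) n

lemma continuousOn_coprim_iterate {f : ℝ → ℝ} (hf : ContinuousOn f (Icc 0 1)) (n : ℕ) :
    ContinuousOn (coprim^[n] f) (Icc 0 1) := by
  cases n with
  | zero => exact hf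
  | succ n => exact continuousOn_coprim_iterate_succ (integrableOn_of_continuousOn hf) n

lemma prim_congr_ae {f g : ℝ → ℝ} (h : f =ᵐ[volume.restrict (Ioo 0 1)] g) :
    EqOn (prim f) (prim g) (Icc 0 1) := by
  intro x hx
  refine intervalIntegral.integral_congr_ae_restrict ?_
  rw [uIoc_of_le hx.1]
  have h1 : volume.restrict (Ioc 0 x) ≤ volume.restrict (Ioo (0 : ℝ) 1) := by
    rw [← Measure.restrict_congr_set (Ioo_ae_eq_Ioc (a := 0) (b := x))]
    exact Measure.restrict_mono (Ioo_subset_Ioo_right hx.2) le_rfl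
  exact ae_mono h1 h

lemma prim_iterate_congr_ae {f g : ℝ → ℝ} (h : f =ᵐ[volume.restrict (Ioo 0 1)] g) (n : ℕ) :
    EqOn (prim^[n + 1] f) (prim^[n + 1] g) (Icc 0 1) := by
  induction n with
  | zero => exact prim_congr_ae h
  | succ n ih =>
    rw [Function.iterate_succ_apply' prim (n + 1) f, Function.iterate_succ_apply' prim (n + 1) g]
    refine prim_congr_ae ?_
    filter_upwards [ae_restrict_mem measurableSet_Ioo] with x hx using ih (Ioo_subset_Icc_self hx)

lemma prim_iterate_congr {f g : ℝ → ℝ} (h : EqOn f g (Icc 0 1)) (n : ℕ) :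
    EqOn (prim^[n] f) (prim^[n] g) (Icc 0 1) := by
  cases n with
  | zero => exact h
  | succ n =>
    refine prim_iterate_congr_ae ?_ n
    filter_upwards [ae_restrict_mem measurableSet_Ioo] with x hx using h (Ioo_subset_Icc_self hx)

lemma abs_prim_iterate_le {f : ℝ → ℝ} {C : ℝ} (hC : ∀ x ∈ Icc (0 : ℝ) 1, |f x| ≤ C) (n : ℕ) :
    ∀ x ∈ Icc (0 : ℝ) 1, |prim^[n] f x| ≤ C * x ^ n := by
  have hC0 : 0 ≤ C := (abs_nonneg _).trans (hC 0 (left_mem_Icc.2 zero_le_one))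
  induction n with
  | zero => simpa using hC
  | succ n ih =>
    intro x hx
    rw [Function.iterate_succ_apply', prim, ← Real.norm_eq_abs]
    refine (intervalIntegral.norm_integral_le_of_norm_le_const (C := C * x ^ n) fun t ht => ?_).trans ?_
    · rw [uIoc_of_le hx.1] at ht
      refine (ih t ⟨ht.1.le, ht.2.trans hx.2⟩).trans ?_
      exact mul_le_mul_of_nonneg_left (pow_le_pow_left₀ ht.1.le ht.2 n) hC0
    · rw [sub_zero, abs_of_nonneg hx.1, pow_succ, mul_assoc]

lemma prim_add_mul {f g : ℝ → ℝ} (hf : IntegrableOn f (Ioo 0 1)) (hg : IntegrableOn g (Ioo 0 1))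
    (c d : ℝ) : EqOn (prim fun x => c * f x + d * g x) (fun x => c * prim f x + d * prim g x)
      (Icc 0 1) := by
  intro x hx
  have h0 := left_mem_Icc.2 (zero_le_one' ℝ)
  simp only [prim]
  rw [intervalIntegral.integral_add ((intervalIntegrable_of_integrableOn hf h0 hx).const_mul c)
    ((intervalIntegrable_of_integrableOn hg h0 hx).const_mul d), intervalIntegral.integral_const_mul,
    intervalIntegral.integral_const_mul]

lemma prim_iterate_add_mul {f g : ℝ → ℝ} (hf : IntegrableOn f (Ioo 0 1))
    (hg : IntegrableOn g (Ioo 0 1)) (c d : ℝ) (n : ℕ) :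
    EqOn (prim^[n] fun x => c * f x + d * g x) (fun x => c * prim^[n] f x + d * prim^[n] g x)
      (Icc 0 1) := by
  induction n with
  | zero => exact fun _ _ => rfl
  | succ n ih =>
    intro x hx
    rw [Function.iterate_succ_apply', Function.iterate_succ_apply', Function.iterate_succ_apply',
      ← prim_add_mul (integrableOn_prim_iterate hf n) (integrableOn_prim_iterate hg n) c d hx]
    exact prim_iterate_congr ih 1 hx

lemma hasDerivWithinAt_prim {f : ℝ → ℝ} (hf : ContinuousOn f (Icc 0 1)) {x : ℝ}
    (hx : x ∈ Icc (0 : ℝ) 1) : HasDerivWithinAt (prim f) (f x) (Icc 0 1) x := by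
  -- A continuous extension to the line gives a two-sided derivative at the end points as well.
  set g := IccExtend (zero_le_one' ℝ) ((Icc (0 : ℝ) 1).domRestrict f) with hg
  have hgc : Continuous g := (continuousOn_iff_continuous_domRestrict.1 hf).Icc_extend'
  have hgf : EqOn f g (Icc 0 1) := fun y hy => by
    rw [hg, IccExtend_of_mem _ _ hy]; rfl
  rw [hgf hx]
  refine (hgc.integral_hasStrictDerivAt 0 x).hasDerivAt.hasDerivWithinAt.congr
    (fun y hy => prim_iterate_congr hgf 1 hy) (prim_iterate_congr hgf 1 hx)

lemma hasDerivAt_prim {f : ℝ → ℝ} (hf : IntegrableOn f (Ioo 0 1)) (hc : ContinuousOn f (Ioo 0 1))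
    {x : ℝ} (hx : x ∈ Ioo (0 : ℝ) 1) : HasDerivAt (prim f) (f x) x :=
  intervalIntegral.integral_hasDerivAt_right
    (intervalIntegrable_of_integrableOn hf (left_mem_Icc.2 zero_le_one) (Ioo_subset_Icc_self hx))
    (hc.stronglyMeasurableAtFilter isOpen_Ioo x hx) (hc.continuousAt (isOpen_Ioo.mem_nhds hx))

lemma hasDerivWithinAt_coprim {f : ℝ → ℝ} (hf : ContinuousOn f (Icc 0 1)) {x : ℝ}
    (hx : x ∈ Icc (0 : ℝ) 1) : HasDerivWithinAt (coprim f) (-f x) (Icc 0 1) x :=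
  ((hasDerivWithinAt_prim hf hx).const_sub (prim f 1)).congr
    (fun _ hy => coprim_eq (integrableOn_of_continuousOn hf) hy)
    (coprim_eq (integrableOn_of_continuousOn hf) hx)

lemma hasDerivAt_coprim {f : ℝ → ℝ} (hf : IntegrableOn f (Ioo 0 1)) (hc : ContinuousOn f (Ioo 0 1))
    {x : ℝ} (hx : x ∈ Ioo (0 : ℝ) 1) : HasDerivAt (coprim f) (-f x) x := by
  refine ((hasDerivAt_prim hf hc hx).const_sub (prim f 1)).congr_of_eventuallyEq ?_
  filter_upwards [Icc_mem_nhds hx.1 hx.2] with y hy using coprim_eq hf hy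

/-- Fubini on the triangle `t < x`: `coprim` is the adjoint of `prim`. -/
lemma integral_prim_mul {f g : ℝ → ℝ} (hf : IntegrableOn f (Ioo 0 1))
    (hg : IntegrableOn g (Ioo 0 1)) :
    ∫ x in Ioo (0 : ℝ) 1, prim f x * g x = ∫ x in Ioo (0 : ℝ) 1, f x * coprim g x := by
  set P := volume.restrict (Ioo (0 : ℝ) 1) with hP
  set G : ℝ → ℝ → ℝ := fun x t => {p : ℝ × ℝ | p.2 < p.1}.indicator (fun p => g p.1 * f p.2) (x, t)
    with hG
  have hint : Integrable (Function.uncurry G) (P.prod P) :=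
    (Integrable.mul_prod hg hf).indicator (measurableSet_lt measurable_snd measurable_fst)
  have e1 : ∀ x ∈ Ioo (0 : ℝ) 1, ∫ t, G x t ∂P = prim f x * g x := by
    intro x hx
    have : ∀ t, G x t = (Iio x).indicator (fun t => g x * f t) t := fun t => by
      simp [hG, indicator]
    simp_rw [this]
    rw [integral_indicator measurableSet_Iio, hP, Measure.restrict_restrict measurableSet_Iio,
      integral_const_mul, prim, intervalIntegral.integral_of_le hx.1.le,
      integral_Ioc_eq_integral_Ioo, mul_comm]
    congr 3
    ext t; simp only [mem_inter_iff, mem_Iio, mem_Ioo]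
    exact ⟨fun h => ⟨h.2.1, h.1⟩, fun h => ⟨h.2, h.1, h.2.trans hx.2⟩⟩
  have e2 : ∀ t ∈ Ioo (0 : ℝ) 1, ∫ x, G x t ∂P = f t * coprim g t := by
    intro t ht
    have : ∀ x, G x t = (Ioi t).indicator (fun x => g x * f t) x := fun x => by
      simp [hG, indicator]
    simp_rw [this]
    rw [integral_indicator measurableSet_Ioi, hP, Measure.restrict_restrict measurableSet_Ioi,
      integral_mul_const, coprim, intervalIntegral.integral_of_le ht.2.le,
      integral_Ioc_eq_integral_Ioo, mul_comm]
    congr 3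
    ext x; simp only [mem_inter_iff, mem_Ioi, mem_Ioo]
    exact ⟨fun h => ⟨h.1, h.2.2⟩, fun h => ⟨h.1, ht.1.trans h.1, h.2⟩⟩
  rw [← setIntegral_congr_fun measurableSet_Ioo e1, ← setIntegral_congr_fun measurableSet_Ioo e2]
  exact integral_integral_swap hint

lemma integral_prim_iterate_mul {f g : ℝ → ℝ} (hf : IntegrableOn f (Ioo 0 1))
    (hg : IntegrableOn g (Ioo 0 1)) (n : ℕ) :
    ∫ x in Ioo (0 : ℝ) 1, prim^[n] f x * g x = ∫ x in Ioo (0 : ℝ) 1, f x * coprim^[n] g x := by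
  induction n generalizing g with
  | zero => rfl
  | succ n ih =>
    rw [Function.iterate_succ_apply', integral_prim_mul (integrableOn_prim_iterate hf n) hg,
      ih (g := coprim g) (integrableOn_coprim_iterate hg 1), Function.iterate_succ_apply]

/-- The values at `1` of iterated primitives are moments against the polynomials `(1 - x) ^ n / n!`.
This converts boundary conditions at `1` into orthogonality. -/
lemma prim_iterate_succ_one {f : ℝ → ℝ} (hf : IntegrableOn f (Ioo 0 1)) (n : ℕ) :
    prim^[n + 1] f 1 = ∫ x in Ioo (0 : ℝ) 1, f x * coprim^[n] (fun _ => 1) x := by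
  rw [← integral_prim_iterate_mul hf (integrableOn_of_continuousOn continuousOn_const),
    Function.iterate_succ_apply', prim, intervalIntegral.integral_of_le zero_le_one,
    integral_Ioc_eq_integral_Ioo]
  simp

lemma prim_iterate_succ_zero (f : ℝ → ℝ) (n : ℕ) : prim^[n + 1] f 0 = 0 := by
  rw [Function.iterate_succ_apply', prim, intervalIntegral.integral_same]

/-- A continuous primitive that vanishes almost everywhere vanishes on `(0,1)`; Lebesgue
differentiation then recovers `f`. -/
lemma ae_eq_zero_of_prim_ae_eq_zero {f : ℝ → ℝ} (hf : IntegrableOn f (Ioo 0 1))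
    (h : prim f =ᵐ[volume.restrict (Ioo 0 1)] 0) : f =ᵐ[volume.restrict (Ioo 0 1)] 0 := by
  have h0 : EqOn (prim f) 0 (Ioo 0 1) :=
    Measure.eqOn_open_of_ae_eq h isOpen_Ioo ((continuousOn_prim hf).mono Ioo_subset_Icc_self)
      continuousOn_const
  have hd := (intervalIntegrable_of_integrableOn hf (left_mem_Icc.2 zero_le_one)
    (right_mem_Icc.2 zero_le_one)).ae_hasDerivAt_integral
  rw [uIcc_of_le (zero_le_one' ℝ)] at hd
  rw [Filter.EventuallyEq, ae_restrict_iff' measurableSet_Ioo]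
  filter_upwards [hd] with x hx hxI
  have h1 : HasDerivAt (prim f) (f x) x := hx (Ioo_subset_Icc_self hxI) 0 (left_mem_Icc.2 zero_le_one)
  have h2 : HasDerivAt (prim f) 0 x := by
    refine (hasDerivAt_const x (0 : ℝ)).congr_of_eventuallyEq ?_
    filter_upwards [isOpen_Ioo.mem_nhds hxI] with y hy using h0 hy
  exact h1.unique h2

lemma ae_eq_zero_of_prim_iterate_ae_eq_zero {f : ℝ → ℝ} (hf : IntegrableOn f (Ioo 0 1)) (n : ℕ)
    (h : prim^[n] f =ᵐ[volume.restrict (Ioo 0 1)] 0) : f =ᵐ[volume.restrict (Ioo 0 1)] 0 := by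
  induction n with
  | zero => exact h
  | succ n ih =>
    rw [Function.iterate_succ_apply'] at h
    exact ih (ae_eq_zero_of_prim_ae_eq_zero (integrableOn_prim_iterate hf n) h)

/-! ### Regularity of weak eigenfunctions -/

/-- A finite chain of successive derivatives. -/
lemma contDiffOn_of_derivative_chain {D : ℕ → ℝ → ℝ} {s : Set ℝ} (hs : UniqueDiffOn ℝ s) {n : ℕ}
    (h : ∀ j < n, ∀ x ∈ s, HasDerivWithinAt (D j) (D (j + 1) x) s x) (hc : ContinuousOn (D n) s) :
    ContDiffOn ℝ (n : WithTop ℕ∞) (D 0) s ∧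
      ∀ j ≤ n, ∀ x ∈ s, iteratedDerivWithin j (D 0) s x = D j x := by
  have hD : ∀ j ≤ n, ∀ x ∈ s, iteratedDerivWithin j (D 0) s x = D j x := by
    intro j
    induction j with
    | zero => intro _ x _; simp
    | succ j ih =>
      intro hj x hx
      rw [iteratedDerivWithin_succ, derivWithin_congr (fun y hy => ih (by omega) y hy)
        (ih (by omega) x hx), (h j (by omega) x hx).derivWithin (hs x hx)]
  refine ⟨?_, hD⟩
  have hcont : ∀ j ≤ n, ContinuousOn (D j) s := by
    intro j hj
    rcases hj.eq_or_lt with h' | h'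
    · rw [h']; exact hc
    · exact fun x hx => (h j h' x hx).continuousWithinAt
  refine contDiffOn_of_continuousOn_differentiableOn_deriv (n := (n : ℕ∞)) (fun j hj => ?_)
    fun j hj => ?_
  · have hj' : j ≤ n := by exact_mod_cast hj
    exact (hcont j hj').congr fun x hx => hD j hj' x hx
  · have hj' : j < n := by exact_mod_cast hj
    exact DifferentiableOn.congr (fun x hx => (h j hj' x hx).differentiableWithinAt)
      fun x hx => hD j hj'.le x hx

/-- The `i`-th derivative of `lam W^k F + ∑ c_l W^l 1`, where `W` is `coprim`. -/
def weakDeriv (k : ℕ) (lam : ℝ) (F : ℝ → ℝ) (c : ℕ → ℝ) (i : ℕ) (x : ℝ) : ℝ :=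
  (-1) ^ i * (lam * coprim^[k - i] F x +
    ∑ l ∈ Finset.range k, c l * if i ≤ l then coprim^[l - i] (fun _ => 1) x else 0)

section

variable {k : ℕ} {lam : ℝ} {F : ℝ → ℝ} {c : ℕ → ℝ}

lemma hasDerivWithinAt_polyPart (i l : ℕ) {x : ℝ} (hx : x ∈ Icc (0 : ℝ) 1) :
    HasDerivWithinAt (fun x => if i ≤ l then coprim^[l - i] (fun _ => 1) x else 0)
      (-(if i + 1 ≤ l then coprim^[l - (i + 1)] (fun _ => 1) x else 0)) (Icc 0 1) x := by
  rcases lt_trichotomy i l with h | h | h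
  · simp only [if_pos h.le, if_pos (Nat.succ_le_of_lt h)]
    rw [show l - i = l - (i + 1) + 1 by omega, Function.iterate_succ_apply']
    exact hasDerivWithinAt_coprim (continuousOn_coprim_iterate continuousOn_const _) hx
  · subst h
    simpa using hasDerivWithinAt_const x (Icc (0 : ℝ) 1) (1 : ℝ)
  · simp only [if_neg (not_le.2 h), if_neg (by omega : ¬ i + 1 ≤ l), neg_zero]
    exact hasDerivWithinAt_const x _ _

lemma hasDerivWithinAt_weakDeriv_of {s : Set ℝ} (hs : s ⊆ Icc 0 1) {i : ℕ} {x : ℝ} (hx : x ∈ s)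
    (hF : HasDerivWithinAt (coprim^[k - i] F) (-coprim^[k - (i + 1)] F x) s x) :
    HasDerivWithinAt (weakDeriv k lam F c i) (weakDeriv k lam F c (i + 1) x) s x := by
  have h2 : HasDerivWithinAt (fun x => ∑ l ∈ Finset.range k,
      c l * if i ≤ l then coprim^[l - i] (fun _ => 1) x else 0)
      (∑ l ∈ Finset.range k,
        c l * -(if i + 1 ≤ l then coprim^[l - (i + 1)] (fun _ => 1) x else 0)) s x :=
    HasDerivWithinAt.fun_sum fun l _ =>
      ((hasDerivWithinAt_polyPart i l (hs hx)).mono hs).const_mul (c l)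
  refine (((hF.const_mul lam).add h2).const_mul ((-1) ^ i)).congr_deriv ?_
  simp only [weakDeriv, mul_neg, Finset.sum_neg_distrib, pow_succ]
  ring

/-- The last differentiation, from `coprim F` to `F`, is excluded on the closed interval because `F`
may be singular at `0`; it is permitted in `hasDerivAt_weakDeriv` on the open one. This matches the
classes `C^(2k-1)` on `[0,1]` and `C^(2k)` on `(0,1)`. -/
lemma hasDerivWithinAt_weakDeriv (hF : IntegrableOn F (Ioo 0 1)) {i : ℕ} (hi : i + 1 < k) {x : ℝ}
    (hx : x ∈ Icc (0 : ℝ) 1) :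
    HasDerivWithinAt (weakDeriv k lam F c i) (weakDeriv k lam F c (i + 1) x) (Icc 0 1) x := by
  refine hasDerivWithinAt_weakDeriv_of subset_rfl hx ?_
  rw [show k - i = k - (i + 1) + 1 by omega, Function.iterate_succ_apply']
  refine hasDerivWithinAt_coprim ?_ hx
  rw [show k - (i + 1) = k - (i + 2) + 1 by omega]
  exact continuousOn_coprim_iterate_succ hF _

lemma hasDerivAt_weakDeriv (hF : IntegrableOn F (Ioo 0 1)) (hFc : ContinuousOn F (Ioo 0 1)) {i : ℕ}
    (hi : i < k) {x : ℝ} (hx : x ∈ Ioo (0 : ℝ) 1) :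
    HasDerivWithinAt (weakDeriv k lam F c i) (weakDeriv k lam F c (i + 1) x) (Ioo 0 1) x := by
  refine hasDerivWithinAt_weakDeriv_of Ioo_subset_Icc_self hx ?_
  rw [show k - i = k - (i + 1) + 1 by omega, Function.iterate_succ_apply']
  refine (hasDerivAt_coprim (integrableOn_coprim_iterate hF _) ?_ hx).hasDerivWithinAt
  rcases h : k - (i + 1) with _ | n
  · exact hFc
  · exact (continuousOn_coprim_iterate_succ hF n).mono Ioo_subset_Icc_self

lemma continuousOn_weakDeriv (hF : IntegrableOn F (Ioo 0 1)) {i : ℕ} (hi : i < k) :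
    ContinuousOn (weakDeriv k lam F c i) (Icc 0 1) := by
  unfold weakDeriv
  refine continuousOn_const.mul ((continuousOn_const.mul ?_).add ?_)
  · rw [show k - i = k - (i + 1) + 1 by omega]
    exact continuousOn_coprim_iterate_succ hF _
  · exact continuousOn_finsetSum _ fun l _ => continuousOn_const.mul
      fun x hx => (hasDerivWithinAt_polyPart i l hx).continuousWithinAt

lemma weakDeriv_top (x : ℝ) : weakDeriv k lam F c k x = (-1) ^ k * lam * F x := by
  have : ∀ l ∈ Finset.range k, (c l * if k ≤ l then coprim^[l - k] (fun _ => 1) x else 0) = 0 := by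
    intro l hl
    rw [if_neg (by have := Finset.mem_range.1 hl; omega), mul_zero]
  rw [weakDeriv, Finset.sum_eq_zero this]
  simp [mul_assoc]

/-- The successive derivatives of the `k`-fold primitive of `weakDeriv k lam F c 0`. -/
def derivChain (k : ℕ) (lam : ℝ) (F : ℝ → ℝ) (c : ℕ → ℝ) (j : ℕ) : ℝ → ℝ :=
  if j < k then prim^[k - j] (weakDeriv k lam F c 0) else weakDeriv k lam F c (j - k)

lemma derivChain_of_le {j : ℕ} (hj : j ≤ k) :
    derivChain k lam F c j = prim^[k - j] (weakDeriv k lam F c 0) := by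
  rcases hj.eq_or_lt with h | h
  · simp [derivChain, h]
  · simp [derivChain, h]

lemma derivChain_of_ge {j : ℕ} (hj : k ≤ j) :
    derivChain k lam F c j = weakDeriv k lam F c (j - k) := if_neg (not_lt.2 hj)

lemma hasDerivWithinAt_derivChain_of_lt (hF : IntegrableOn F (Ioo 0 1)) {j : ℕ} (hj : j < k) {x : ℝ}
    (hx : x ∈ Icc (0 : ℝ) 1) :
    HasDerivWithinAt (derivChain k lam F c j) (derivChain k lam F c (j + 1) x) (Icc 0 1) x := by
  rw [derivChain_of_le hj.le, derivChain_of_le hj, show k - j = k - (j + 1) + 1 by omega,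
    Function.iterate_succ_apply']
  exact hasDerivWithinAt_prim
    (continuousOn_prim_iterate (continuousOn_weakDeriv hF (by omega)) _) hx

/-- By `hw`, `h` agrees almost everywhere with a function having `k` derivatives on `(0,1)`; these
kill the polynomial part and leave `(-1)^k lam F`. The eigenfunction is the `k`-fold primitive of
this better representative: it has zero data at `0` by construction and at `1` by `horth`. -/
lemma isEigenfunction_of_weak {m : ℝ} {h : ℝ → ℝ} (hk : 1 ≤ k) (hh : IntegrableOn h (Ioo 0 1))
    (hF : IntegrableOn (fun x => x ^ (-m) * prim^[k] h x) (Ioo 0 1))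
    (horth : ∀ i < k, ∫ x in Ioo (0 : ℝ) 1, h x * coprim^[i] (fun _ => 1) x = 0)
    (hw : h =ᵐ[volume.restrict (Ioo 0 1)] fun x =>
      lam * coprim^[k] (fun x => x ^ (-m) * prim^[k] h x) x +
        ∑ l ∈ Finset.range k, c l * coprim^[l] (fun _ => 1) x) :
    ∃ X, IsEigenfunction k m lam X ∧ EqOn X (prim^[k] h) (Icc 0 1) := by
  set F : ℝ → ℝ := fun x => x ^ (-m) * prim^[k] h x with hFdef
  have hw' : weakDeriv k lam F c 0 =ᵐ[volume.restrict (Ioo 0 1)] h := by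
    filter_upwards [hw] with x hx
    rw [hx]; simp [weakDeriv]
  have hpr : ∀ n, EqOn (prim^[n + 1] (weakDeriv k lam F c 0)) (prim^[n + 1] h) (Icc 0 1) :=
    prim_iterate_congr_ae hw'
  obtain ⟨n, rfl⟩ := Nat.exists_eq_add_of_le' hk
  have hD0 : derivChain (n + 1) lam F c 0 = prim^[n + 1] (weakDeriv (n + 1) lam F c 0) :=
    derivChain_of_le (Nat.zero_le _)
  have hFc : ContinuousOn F (Ioo 0 1) :=
    (continuousOn_id.rpow_const fun x hx => Or.inl (ne_of_gt hx.1)).mul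
      ((continuousOn_prim_iterate_succ hh n).mono Ioo_subset_Icc_self)
  have c1 := contDiffOn_of_derivative_chain (D := derivChain (n + 1) lam F c)
    (uniqueDiffOn_Icc one_pos) (n := 2 * (n + 1) - 1) (fun j hj x hx => by
      rcases lt_or_ge j (n + 1) with h' | h'
      · exact hasDerivWithinAt_derivChain_of_lt hF h' hx
      · rw [derivChain_of_ge h', derivChain_of_ge (by omega : n + 1 ≤ j + 1),
          show j + 1 - (n + 1) = j - (n + 1) + 1 by omega]
        exact hasDerivWithinAt_weakDeriv hF (by omega) hx)
    (by rw [derivChain_of_ge (by omega)]; exact continuousOn_weakDeriv hF (by omega))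
  have c2 := contDiffOn_of_derivative_chain (D := derivChain (n + 1) lam F c)
    isOpen_Ioo.uniqueDiffOn (n := 2 * (n + 1)) (fun j hj x hx => by
      rcases lt_or_ge j (n + 1) with h' | h'
      · exact (hasDerivWithinAt_derivChain_of_lt hF h' (Ioo_subset_Icc_self hx)).mono
          Ioo_subset_Icc_self
      · rw [derivChain_of_ge h', derivChain_of_ge (by omega : n + 1 ≤ j + 1),
          show j + 1 - (n + 1) = j - (n + 1) + 1 by omega]
        exact hasDerivAt_weakDeriv hF hFc (by omega) hx)
    (by
      rw [derivChain_of_ge (by omega), show 2 * (n + 1) - (n + 1) = n + 1 by omega]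
      exact (continuousOn_const.mul hFc).congr fun x _ => weakDeriv_top x)
  refine ⟨derivChain (n + 1) lam F c 0, ⟨c1.1, c2.1, fun x hx => ?_, fun j hj => ?_⟩, ?_⟩
  · rw [← iteratedDerivWithin_of_isOpen isOpen_Ioo hx, c2.2 _ le_rfl x hx,
      derivChain_of_ge (by omega), show 2 * (n + 1) - (n + 1) = n + 1 by omega, weakDeriv_top, hD0,
      hpr n (Ioo_subset_Icc_self hx)]
    simp only [hFdef]
    ring
  · rw [c1.2 j (by omega) 0 (left_mem_Icc.2 zero_le_one),
      c1.2 j (by omega) 1 (right_mem_Icc.2 zero_le_one), derivChain_of_le hj.le,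
      show n + 1 - j = n - j + 1 by omega]
    refine ⟨prim_iterate_succ_zero _ _, ?_⟩
    rw [hpr _ (right_mem_Icc.2 zero_le_one), prim_iterate_succ_one hh]
    exact horth _ (by omega)
  · rw [hD0]; exact hpr n

end

/-! ### The compact weighted integration operator on `L²(0,1)` -/

/-- The Hilbert space `L²(0,1)`. -/
abbrev L2Unit : Type := Lp ℝ 2 (volume.restrict (Ioo (0 : ℝ) 1))

lemma integrableOn_coe (h : L2Unit) : IntegrableOn h (Ioo 0 1) :=
  (Lp.memLp h).integrable one_le_two

lemma inner_eq_integral (f g : L2Unit) : ⟪f, g⟫_ℝ = ∫ x in Ioo (0 : ℝ) 1, f x * g x := by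
  rw [L2.inner_def]
  refine integral_congr_ae (ae_of_all _ fun x => ?_)
  simp [mul_comm]

lemma memLp_of_continuousOn {f : ℝ → ℝ} (hf : ContinuousOn f (Icc 0 1)) :
    MemLp f 2 (volume.restrict (Ioo (0 : ℝ) 1)) := by
  obtain ⟨C, hC⟩ := isCompact_Icc.exists_bound_of_continuousOn hf
  exact MemLp.of_bound ((hf.mono Ioo_subset_Icc_self).aestronglyMeasurable measurableSet_Ioo) C
    ((ae_restrict_mem measurableSet_Ioo).mono fun x hx => hC x (Ioo_subset_Icc_self hx))

/-- Cauchy–Schwarz against the indicator of `(x, y)`; this Hölder bound yields the equicontinuity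
behind compactness. -/
lemma abs_prim_sub_le (h : L2Unit) {x y : ℝ} (hx : x ∈ Icc (0 : ℝ) 1) (hy : y ∈ Icc (0 : ℝ) 1) :
    |prim h x - prim h y| ≤ ‖h‖ * √|x - y| := by
  wlog hxy : x ≤ y generalizing x y
  · rw [abs_sub_comm, abs_sub_comm x y]
    exact this hy hx (le_of_not_ge hxy)
  have h0 := left_mem_Icc.2 (zero_le_one' ℝ)
  have e : prim h y - prim h x = ∫ t in x..y, h t :=
    intervalIntegral.integral_interval_sub_left
      (intervalIntegrable_of_integrableOn (integrableOn_coe h) h0 hy)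
      (intervalIntegrable_of_integrableOn (integrableOn_coe h) h0 hx)
  have hfin : (volume.restrict (Ioo (0 : ℝ) 1)) (Ioo x y) ≠ ⊤ := measure_ne_top _ _
  have hin := L2.inner_indicatorConstLp_one (𝕜 := ℝ) (μ := volume.restrict (Ioo (0 : ℝ) 1))
    measurableSet_Ioo hfin h
  have hsub : Ioo x y ∩ Ioo 0 1 = Ioo x y :=
    inter_eq_self_of_subset_left (Ioo_subset_Ioo hx.1 hy.2)
  rw [Measure.restrict_restrict measurableSet_Ioo, hsub, ← integral_Ioc_eq_integral_Ioo,
    ← intervalIntegral.integral_of_le hxy] at hin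
  rw [abs_sub_comm, e, ← hin, abs_sub_comm]
  refine (abs_real_inner_le_norm _ _).trans ?_
  rw [norm_indicatorConstLp two_ne_zero ENNReal.ofNat_ne_top, mul_comm]
  refine mul_le_mul_of_nonneg_left (le_of_eq ?_) (norm_nonneg _)
  rw [measureReal_restrict_apply measurableSet_Ioo, hsub, Real.volume_real_Ioo_of_le hxy,
    abs_of_nonneg (sub_nonneg.2 hxy), Real.sqrt_eq_rpow]
  simp

lemma abs_prim_le (h : L2Unit) {x : ℝ} (hx : x ∈ Icc (0 : ℝ) 1) : |prim h x| ≤ ‖h‖ := by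
  have h1 := abs_prim_sub_le h hx (left_mem_Icc.2 zero_le_one)
  rw [show prim h 0 = 0 from intervalIntegral.integral_same, sub_zero, sub_zero,
    abs_of_nonneg hx.1] at h1
  refine h1.trans (mul_le_of_le_one_right (norm_nonneg _) ?_)
  rw [Real.sqrt_le_one]
  exact hx.2

/-- Integration as a bounded operator from `L²(0,1)` to `C[0,1]`. -/
def primCLM : L2Unit →L[ℝ] (Icc (0 : ℝ) 1 →ᵇ ℝ) :=
  LinearMap.mkContinuous
    { toFun := fun h => BoundedContinuousFunction.mkOfCompact
        ⟨fun x : Icc (0 : ℝ) 1 => prim h x,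
          continuousOn_iff_continuous_domRestrict.1 (continuousOn_prim (integrableOn_coe h))⟩
      map_add' := fun f g => by
        ext x
        have h1 : prim (f + g : L2Unit) x = prim (fun x => 1 * f x + 1 * g x) x := by
          refine prim_congr_ae ?_ x.2
          filter_upwards [Lp.coeFn_add f g] with t ht
          rw [ht]; simp
        have h2 := prim_add_mul (integrableOn_coe f) (integrableOn_coe g) 1 1 x.2
        simp only [one_mul] at h1 h2
        exact h1.trans h2
      map_smul' := fun c f => by
        ext x
        have h1 : prim (c • f : L2Unit) x = prim (fun x => c * f x + 0 * f x) x := by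
          refine prim_congr_ae ?_ x.2
          filter_upwards [Lp.coeFn_smul c f] with t ht
          rw [ht]; simp
        have h2 := prim_add_mul (integrableOn_coe f) (integrableOn_coe f) c 0 x.2
        simp only [zero_mul, add_zero] at h1 h2
        exact h1.trans h2 } 1
    fun h => by
      rw [one_mul, BoundedContinuousFunction.norm_le (norm_nonneg _)]
      exact fun x => abs_prim_le h x.2

lemma primCLM_apply (h : L2Unit) (x : Icc (0 : ℝ) 1) : primCLM h x = prim h x := rfl

/-- Arzelà–Ascoli: the image of the unit ball is bounded by `1` and has the common modulus of
continuity `√r`. -/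
lemma isCompactOperator_primCLM : IsCompactOperator primCLM := by
  refine (isCompactOperator_iff_isCompact_closure_image_closedBall
    (primCLM : L2Unit →ₗ[ℝ] (Icc (0 : ℝ) 1 →ᵇ ℝ)) one_pos).2 ?_
  refine BoundedContinuousFunction.arzela_ascoli (Icc (-1) 1) isCompact_Icc _ ?_ ?_
  · rintro f x ⟨h, hh, rfl⟩
    exact abs_le.1 ((abs_prim_le h x.2).trans (by simpa using hh))
  · refine Metric.equicontinuous_of_continuity_modulus (fun r => √r) ?_ _ ?_
    · have := Real.continuous_sqrt.tendsto 0
      rwa [Real.sqrt_zero] at this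
    · rintro x y ⟨_, h, hh, rfl⟩
      refine (abs_prim_sub_le h x.2 y.2).trans ?_
      exact mul_le_of_le_one_left (Real.sqrt_nonneg _) (by simpa using hh)

section

variable {m : ℝ} {n : ℕ}

/-- The square is integrable when `2n - m > -1`, which follows from `m < n + 1` and `n ≥ 0`. -/
lemma memLp_rpow (hm : m < n + 1) :
    MemLp (fun x : ℝ => x ^ ((n : ℝ) - m / 2)) 2 (volume.restrict (Ioo (0 : ℝ) 1)) := by
  have hmeas : AEStronglyMeasurable (fun x : ℝ => x ^ ((n : ℝ) - m / 2))
      (volume.restrict (Ioo (0 : ℝ) 1)) :=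
    (measurable_id.pow_const _).aestronglyMeasurable
  rw [memLp_two_iff_integrable_sq hmeas]
  have hn : (0 : ℝ) ≤ n := Nat.cast_nonneg n
  have h := intervalIntegral.intervalIntegrable_rpow' (a := 0) (b := 1) (r := 2 * n - m)
    (by linarith)
  rw [intervalIntegrable_iff_integrableOn_Ioo_of_le zero_le_one] at h
  refine h.congr_fun (fun x hx => ?_) measurableSet_Ioo
  change x ^ (2 * (n : ℝ) - m) = (x ^ ((n : ℝ) - m / 2)) ^ 2
  rw [← Real.rpow_natCast (x ^ ((n : ℝ) - m / 2)) 2, ← Real.rpow_mul hx.1.le]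
  congr 1
  push_cast; ring

lemma abs_weighted_le {F : ℝ → ℝ} {C p : ℝ} (hC : ∀ x ∈ Icc (0 : ℝ) 1, |F x| ≤ C) {x : ℝ}
    (hx : x ∈ Ioo (0 : ℝ) 1) :
    |x ^ (-p) * prim^[n] F x| ≤ C * x ^ ((n : ℝ) - p) := by
  have h0 := Real.rpow_nonneg hx.1.le (-p)
  rw [abs_mul, abs_of_nonneg h0]
  refine (mul_le_mul_of_nonneg_left
    (abs_prim_iterate_le hC n x (Ioo_subset_Icc_self hx)) h0).trans (le_of_eq ?_)
  rw [sub_eq_add_neg, Real.rpow_add hx.1, Real.rpow_natCast]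
  ring

lemma aestronglyMeasurable_weighted {F : ℝ → ℝ} (hF : ContinuousOn F (Icc 0 1)) (p : ℝ) :
    AEStronglyMeasurable (fun x => x ^ (-p) * prim^[n] F x) (volume.restrict (Ioo (0 : ℝ) 1)) :=
  ((continuousOn_id.rpow_const fun _ hx => Or.inl (ne_of_gt hx.1)).mul
    ((continuousOn_prim_iterate hF n).mono Ioo_subset_Icc_self)).aestronglyMeasurable
      measurableSet_Ioo

lemma memLp_weighted (hm : m < n + 1) {F : ℝ → ℝ} (hF : ContinuousOn F (Icc 0 1)) :
    MemLp (fun x => x ^ (-(m / 2)) * prim^[n] F x) 2 (volume.restrict (Ioo (0 : ℝ) 1)) := by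
  obtain ⟨C, hC⟩ := isCompact_Icc.exists_bound_of_continuousOn hF
  refine (memLp_rpow hm).of_le_mul (c := C) (aestronglyMeasurable_weighted hF _) ?_
  filter_upwards [ae_restrict_mem measurableSet_Ioo] with x hx
  rw [Real.norm_of_nonneg (Real.rpow_nonneg hx.1.le _)]
  exact abs_weighted_le hC hx

/-- A bounded continuous function on `[0,1]`, extended to the line. -/
def extend (f : Icc (0 : ℝ) 1 →ᵇ ℝ) : ℝ → ℝ := IccExtend (zero_le_one' ℝ) f

lemma extend_apply (f : Icc (0 : ℝ) 1 →ᵇ ℝ) {x : ℝ} (hx : x ∈ Icc (0 : ℝ) 1) :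
    extend f x = f ⟨x, hx⟩ := IccExtend_of_mem _ _ hx

lemma continuous_extend (f : Icc (0 : ℝ) 1 →ᵇ ℝ) : Continuous (extend f) :=
  f.continuous.Icc_extend'

/-- The operator `f ↦ x ^ (-m/2) V^n f` from `C[0,1]` to `L²(0,1)`, as a linear map. -/
def weightLM (hm : m < n + 1) : (Icc (0 : ℝ) 1 →ᵇ ℝ) →ₗ[ℝ] L2Unit where
  toFun := fun f => (memLp_weighted hm (continuous_extend f).continuousOn).toLp _
  map_add' := fun f g => by
    rw [← MemLp.toLp_add, MemLp.toLp_eq_toLp_iff]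
    filter_upwards [ae_restrict_mem measurableSet_Ioo] with x hx
    have hx' := Ioo_subset_Icc_self hx
    have h1 : prim^[n] (extend (f + g)) x =
        prim^[n] (fun x => 1 * extend f x + 1 * extend g x) x := by
      refine prim_iterate_congr (fun t ht => ?_) n hx'
      simp [extend_apply _ ht]
    rw [h1, prim_iterate_add_mul (integrableOn_of_continuousOn (continuous_extend f).continuousOn)
      (integrableOn_of_continuousOn (continuous_extend g).continuousOn) 1 1 n hx']
    simp only [Pi.add_apply]
    ring
  map_smul' := fun c f => by
    rw [RingHom.id_apply, ← MemLp.toLp_const_smul, MemLp.toLp_eq_toLp_iff]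
    filter_upwards [ae_restrict_mem measurableSet_Ioo] with x hx
    have hx' := Ioo_subset_Icc_self hx
    have h1 : prim^[n] (extend (c • f)) x =
        prim^[n] (fun x => c * extend f x + 0 * extend f x) x := by
      refine prim_iterate_congr (fun t ht => ?_) n hx'
      simp [extend_apply _ ht]
    rw [h1, prim_iterate_add_mul (integrableOn_of_continuousOn (continuous_extend f).continuousOn)
      (integrableOn_of_continuousOn (continuous_extend f).continuousOn) c 0 n hx']
    simp only [Pi.smul_apply, smul_eq_mul]
    ring

lemma weightLM_ae_eq (hm : m < n + 1) (f : Icc (0 : ℝ) 1 →ᵇ ℝ) :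
    weightLM hm f =ᵐ[volume.restrict (Ioo (0 : ℝ) 1)]
      fun x => x ^ (-(m / 2)) * prim^[n] (extend f) x :=
  (memLp_weighted hm (continuous_extend f).continuousOn).coeFn_toLp

lemma norm_weightLM_le (hm : m < n + 1) (f : Icc (0 : ℝ) 1 →ᵇ ℝ) :
    ‖weightLM hm f‖ ≤ ‖(memLp_rpow hm).toLp _‖ * ‖f‖ := by
  rw [mul_comm]
  refine Lp.norm_le_mul_norm_of_ae_le_mul ?_
  filter_upwards [ae_restrict_mem measurableSet_Ioo, (memLp_rpow hm).coeFn_toLp,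
    weightLM_ae_eq hm f] with x hx h1 h2
  rw [h1, h2, Real.norm_of_nonneg (Real.rpow_nonneg hx.1.le _)]
  refine abs_weighted_le (fun t ht => ?_) hx
  rw [extend_apply f ht]
  exact f.norm_coe_le_norm _

/-- The operator `f ↦ x ^ (-m/2) V^n f` from `C[0,1]` to `L²(0,1)`. -/
def weightCLM (hm : m < n + 1) : (Icc (0 : ℝ) 1 →ᵇ ℝ) →L[ℝ] L2Unit :=
  (weightLM hm).mkContinuous _ (norm_weightLM_le hm)

/-- The operator `h ↦ x ^ (-m/2) V^(n+1) h` on `L²(0,1)`. -/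
def weightedPrim (hm : m < n + 1) : L2Unit →L[ℝ] L2Unit := weightCLM hm ∘L primCLM

lemma isCompactOperator_weightedPrim (hm : m < n + 1) : IsCompactOperator (weightedPrim hm) :=
  isCompactOperator_primCLM.clm_comp (weightCLM hm)

lemma weightedPrim_ae_eq (hm : m < n + 1) (h : L2Unit) :
    weightedPrim hm h =ᵐ[volume.restrict (Ioo (0 : ℝ) 1)]
      fun x => x ^ (-(m / 2)) * prim^[n + 1] h x := by
  filter_upwards [ae_restrict_mem measurableSet_Ioo,
    weightLM_ae_eq hm (primCLM h)] with x hx h1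
  refine h1.trans ?_
  rw [Function.iterate_succ_apply]
  congr 1
  refine prim_iterate_congr (fun t ht => ?_) n (Ioo_subset_Icc_self hx)
  rw [extend_apply _ ht, primCLM_apply]

/-- The weight is shared equally by the two factors, so the inner product of images is the weighted
pairing of iterated primitives. -/
lemma inner_weightedPrim (hm : m < n + 1) (f g : L2Unit) :
    ⟪weightedPrim hm f, weightedPrim hm g⟫_ℝ =
      ∫ x in Ioo (0 : ℝ) 1, x ^ (-m) * prim^[n + 1] f x * prim^[n + 1] g x := by
  rw [inner_eq_integral]
  refine integral_congr_ae ?_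
  filter_upwards [ae_restrict_mem measurableSet_Ioo, weightedPrim_ae_eq hm f,
    weightedPrim_ae_eq hm g] with x hx h1 h2
  rw [h1, h2, show -m = -(m / 2) + -(m / 2) by ring, Real.rpow_add hx.1]
  ring

lemma eq_zero_of_weightedPrim_eq_zero (hm : m < n + 1) {h : L2Unit} (h0 : weightedPrim hm h = 0) :
    h = 0 := by
  rw [Lp.eq_zero_iff_ae_eq_zero]
  refine ae_eq_zero_of_prim_iterate_ae_eq_zero (integrableOn_coe h) (n + 1) ?_
  have h1 := (Lp.eq_zero_iff_ae_eq_zero).1 h0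
  filter_upwards [ae_restrict_mem measurableSet_Ioo, h1, weightedPrim_ae_eq hm h] with x hx h2 h3
  rw [h3] at h2
  exact (mul_eq_zero.1 h2).resolve_left (Real.rpow_pos_of_pos hx.1 _).ne'

lemma integrableOn_weighted (hm : m < n + 1) (h : L2Unit) :
    IntegrableOn (fun x => x ^ (-m) * prim^[n + 1] h x) (Ioo 0 1) := by
  have hc := continuousOn_prim (integrableOn_coe h)
  have hi := intervalIntegral.intervalIntegrable_rpow' (a := 0) (b := 1) (r := (n : ℝ) - m)
    (by linarith)
  rw [intervalIntegrable_iff_integrableOn_Ioo_of_le zero_le_one] at hi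
  refine Integrable.mono' (hi.const_mul ‖h‖) (aestronglyMeasurable_weighted hc m) ?_
  filter_upwards [ae_restrict_mem measurableSet_Ioo] with x hx
  exact abs_weighted_le (fun t ht => abs_prim_le h ht) hx

/-! ### The Green operator and its eigenvectors -/

/-- The polynomial `(1 - x) ^ i / i!` in `L²(0,1)`. -/
def polyLp (i : ℕ) : L2Unit :=
  (memLp_of_continuousOn (continuousOn_coprim_iterate (f := fun _ => 1) continuousOn_const i)).toLp _

lemma polyLp_ae_eq (i : ℕ) :
    polyLp i =ᵐ[volume.restrict (Ioo (0 : ℝ) 1)] coprim^[i] fun _ => 1 := MemLp.coeFn_toLp _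

/-- The polynomials of degree at most `n`. -/
def polySpan (n : ℕ) : Submodule ℝ L2Unit := Submodule.span ℝ (range fun i : Fin (n + 1) => polyLp i)

/-- Finite dimension makes `polySpan n` its own double orthogonal complement. -/
instance (n : ℕ) : FiniteDimensional ℝ (polySpan n) :=
  FiniteDimensional.span_of_finite ℝ (finite_range _)

lemma inner_polyLp (i : ℕ) (h : L2Unit) :
    ⟪polyLp i, h⟫_ℝ = ∫ x in Ioo (0 : ℝ) 1, h x * coprim^[i] (fun _ => 1) x := by
  rw [inner_eq_integral]
  refine integral_congr_ae ?_
  filter_upwards [polyLp_ae_eq i] with x hx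
  rw [hx, mul_comm]

/-- Through `prim_iterate_succ_one`, these moment conditions say that the `(n + 1)`-fold primitive
of `h` satisfies the boundary conditions at `1`. -/
lemma mem_polySpan_orthogonal {h : L2Unit} : h ∈ (polySpan n)ᗮ ↔
    ∀ i < n + 1, ∫ x in Ioo (0 : ℝ) 1, h x * coprim^[i] (fun _ => 1) x = 0 := by
  rw [polySpan, Submodule.mem_orthogonal]
  constructor
  · intro hh i hi
    rw [← inner_polyLp]
    exact hh _ (Submodule.subset_span ⟨⟨i, hi⟩, rfl⟩)
  · intro hh u hu
    induction hu using Submodule.span_induction with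
    | mem x hx => obtain ⟨i, rfl⟩ := hx; rw [inner_polyLp]; exact hh i i.2
    | zero => simp
    | add x y _ _ hx hy => rw [inner_add_left, hx, hy, add_zero]
    | smul c x _ hx => rw [inner_smul_left, hx, mul_zero]

/-- `weightedPrim` on the orthogonal complement of the polynomials of degree at most `n`. -/
def restrictedPrim (hm : m < n + 1) : (polySpan n)ᗮ →L[ℝ] L2Unit :=
  weightedPrim hm ∘L (polySpan n)ᗮ.subtypeL

/-- The inverse of the differential operator, in its variational form. -/
def greenOp (hm : m < n + 1) : (polySpan n)ᗮ →L[ℝ] (polySpan n)ᗮ :=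
  (ContinuousLinearMap.adjoint (restrictedPrim hm)) ∘L restrictedPrim hm

lemma inner_greenOp (hm : m < n + 1) (f g : (polySpan n)ᗮ) :
    ⟪greenOp hm f, g⟫_ℝ = ⟪weightedPrim hm f, weightedPrim hm g⟫_ℝ := by
  rw [greenOp, ContinuousLinearMap.comp_apply, ContinuousLinearMap.adjoint_inner_left]
  rfl

lemma isSymmetric_greenOp (hm : m < n + 1) : (greenOp hm).IsSymmetric := by
  intro f g
  change ⟪greenOp hm f, g⟫_ℝ = ⟪f, greenOp hm g⟫_ℝ
  rw [inner_greenOp, real_inner_comm, ← inner_greenOp hm g f, real_inner_comm]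

lemma isCompactOperator_greenOp (hm : m < n + 1) : IsCompactOperator (greenOp hm) :=
  ((isCompactOperator_weightedPrim hm).comp_clm (polySpan n)ᗮ.subtypeL).clm_comp
    (ContinuousLinearMap.adjoint (restrictedPrim hm))

lemma eq_zero_of_greenOp_eq_zero (hm : m < n + 1) {h : (polySpan n)ᗮ} (h0 : greenOp hm h = 0) :
    h = 0 := by
  have h1 := inner_greenOp hm h h
  rw [h0, inner_zero_left] at h1
  exact Subtype.ext (eq_zero_of_weightedPrim_eq_zero hm (inner_self_eq_zero.1 h1.symm))

/-- Eigenvectors of `greenOp` are the derivatives of order `n + 1` of eigenfunctions. -/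
lemma exists_isEigenfunction (hm : m < n + 1) {μ : ℝ} (hμ : μ ≠ 0) {h : (polySpan n)ᗮ}
    (hh : greenOp hm h = μ • h) :
    ∃ X, IsEigenfunction (n + 1) m μ⁻¹ X ∧ EqOn X (prim^[n + 1] (h : L2Unit)) (Icc 0 1) := by
  have hF := integrableOn_weighted hm (h : L2Unit)
  set F : ℝ → ℝ := fun x => x ^ (-m) * prim^[n + 1] (h : L2Unit) x with hFdef
  have hW : MemLp (coprim^[n + 1] F) 2 (volume.restrict (Ioo (0 : ℝ) 1)) :=
    memLp_of_continuousOn (continuousOn_coprim_iterate_succ hF n)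
  -- The weak equation: moving the primitives off the test function `g` shows this difference to be
  -- orthogonal to every `g` in the complement, so it is a polynomial.
  have hmem : (h : L2Unit) - μ⁻¹ • hW.toLp _ ∈ polySpan n := by
    refine (Submodule.orthogonal_orthogonal (polySpan n)).le
      ((Submodule.mem_orthogonal _ _).2 fun g hg => ?_)
    have h1 := inner_greenOp hm h ⟨g, hg⟩
    rw [hh, inner_smul_left, inner_weightedPrim] at h1
    have h2 : ⟪g, hW.toLp _⟫_ℝ = ∫ x in Ioo (0 : ℝ) 1, F x * prim^[n + 1] g x := by
      rw [inner_eq_integral]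
      have e : ∫ x in Ioo (0 : ℝ) 1, g x * (hW.toLp _ : L2Unit) x
          = ∫ x in Ioo (0 : ℝ) 1, g x * coprim^[n + 1] F x := by
        refine integral_congr_ae ?_
        filter_upwards [hW.coeFn_toLp] with x hx
        rw [hx]
      rw [e, ← integral_prim_iterate_mul (integrableOn_coe g) hF]
      simp_rw [mul_comm]
    have h3 : ⟪(h : L2Unit), g⟫_ℝ = ⟪h, (⟨g, hg⟩ : (polySpan n)ᗮ)⟫_ℝ := rfl
    rw [inner_sub_right, inner_smul_right, h2, real_inner_comm, h3, ← h1]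
    simp only [conj_trivial]
    field_simp
    simp
  obtain ⟨c, hc⟩ := (Submodule.mem_span_range_iff_exists_fun ℝ).1 hmem
  refine isEigenfunction_of_weak (c := fun l => if hl : l < n + 1 then c ⟨l, hl⟩ else 0)
    (by omega) (integrableOn_coe _) hF (mem_polySpan_orthogonal.1 h.2) ?_
  have e1 : (h : L2Unit) = μ⁻¹ • hW.toLp _ + ∑ i : Fin (n + 1), c i • polyLp i := by
    rw [hc]; abel
  have e2 : (∑ i : Fin (n + 1), c i • polyLp i : L2Unit) =ᵐ[volume.restrict (Ioo (0 : ℝ) 1)]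
      fun x => ∑ i : Fin (n + 1), c i * coprim^[(i : ℕ)] (fun _ => 1) x := by
    have : ∀ s : Finset (Fin (n + 1)),
        (∑ i ∈ s, c i • polyLp i : L2Unit) =ᵐ[volume.restrict (Ioo (0 : ℝ) 1)]
        fun x => ∑ i ∈ s, c i * coprim^[(i : ℕ)] (fun _ => 1) x := by
      intro s
      induction s using Finset.induction_on with
      | empty =>
        simp only [Finset.sum_empty]
        exact Lp.coeFn_zero ℝ 2 (volume.restrict (Ioo (0 : ℝ) 1))
      | insert i s hi ih =>
        rw [Finset.sum_insert hi]
        filter_upwards [Lp.coeFn_add (c i • polyLp i) (∑ i ∈ s, c i • polyLp i), ih,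
          Lp.coeFn_smul (c i) (polyLp i), polyLp_ae_eq i] with x h1 h2 h3 h4
        rw [h1, Pi.add_apply, h2, h3, Pi.smul_apply, h4, Finset.sum_insert hi, smul_eq_mul]
    exact this Finset.univ
  have e3 : (h : L2Unit) =ᵐ[volume.restrict (Ioo (0 : ℝ) 1)]
      (μ⁻¹ • hW.toLp _ + ∑ i : Fin (n + 1), c i • polyLp i : L2Unit) := by rw [← e1]
  filter_upwards [e3, Lp.coeFn_add (μ⁻¹ • hW.toLp _) (∑ i : Fin (n + 1), c i • polyLp i), e2,
    Lp.coeFn_smul μ⁻¹ (hW.toLp _), hW.coeFn_toLp] with x h1 h2 h3 h4 h5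
  rw [h1, h2, Pi.add_apply, h3, h4, Pi.smul_apply, h5, smul_eq_mul, Finset.sum_range]
  congr 1
  exact Finset.sum_congr rfl fun i _ => by rw [dif_pos i.2]

end

/-! ### Completeness of the eigenfunctions -/

lemma prim_iterate_iteratedDerivWithin {k : ℕ} {w : ℝ → ℝ}
    (hw : ContDiffOn ℝ (k : WithTop ℕ∞) w (Icc 0 1))
    (h0 : ∀ j < k, iteratedDerivWithin j w (Icc 0 1) 0 = 0) {i : ℕ} (hi : i ≤ k) :
    EqOn (prim^[i] (iteratedDerivWithin k w (Icc 0 1))) (iteratedDerivWithin (k - i) w (Icc 0 1))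
      (Icc 0 1) := by
  have hud := uniqueDiffOn_Icc (zero_lt_one' ℝ)
  induction i with
  | zero => exact fun _ _ => rfl
  | succ i ih =>
    intro x hx
    have hki : k - i = k - (i + 1) + 1 := by omega
    have hc := hw.continuousOn_iteratedDerivWithin (m := k - (i + 1))
      (by exact_mod_cast Nat.sub_le k (i + 1)) hud
    have hc' := hw.continuousOn_iteratedDerivWithin (m := k - i)
      (by exact_mod_cast Nat.sub_le k i) hud
    have hd := hw.differentiableOn_iteratedDerivWithin (m := k - (i + 1))
      (by exact_mod_cast (by omega : k - (i + 1) < k)) hud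
    rw [Function.iterate_succ_apply']
    refine (prim_iterate_congr (ih (by omega)) 1 hx).trans ?_
    have hftc := intervalIntegral.integral_eq_sub_of_hasDerivAt_of_le hx.1
      (hc.mono (Icc_subset_Icc_right hx.2))
      (f' := iteratedDerivWithin (k - i) w (Icc 0 1)) (fun t ht => by
        have ht' : Icc (0 : ℝ) 1 ∈ 𝓝 t := Icc_mem_nhds ht.1 (ht.2.trans_le hx.2)
        rw [hki, iteratedDerivWithin_succ, derivWithin_of_mem_nhds ht']
        exact (hd.differentiableAt ht').hasDerivAt)
      (intervalIntegrable_of_integrableOn (integrableOn_of_continuousOn hc')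
        (left_mem_Icc.2 zero_le_one) hx)
    rw [h0 _ (by omega), sub_zero] at hftc
    exact hftc

/-- Completeness of the eigenfunctions. -/
lemma eq_zero_of_forall_eigenfunction {k : ℕ} {m : ℝ} (hk : 1 ≤ k) (hmk : m < k) {w : ℝ → ℝ}
    (hw : ContDiffOn ℝ (k : WithTop ℕ∞) w (Icc 0 1))
    (h0 : ∀ j < k, iteratedDerivWithin j w (Icc 0 1) 0 = 0 ∧
      iteratedDerivWithin j w (Icc 0 1) 1 = 0)
    (hort : ∀ lam X, IsEigenfunction k m lam X → (∃ x ∈ Ioo (0 : ℝ) 1, X x ≠ 0) →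
      ∫ x in Ioo (0 : ℝ) 1, x ^ (-m) * X x * w x = 0) :
    ∀ x ∈ Icc (0 : ℝ) 1, w x = 0 := by
  obtain ⟨n, rfl⟩ := Nat.exists_eq_add_of_le' hk
  have hm : m < n + 1 := by exact_mod_cast hmk
  set g := iteratedDerivWithin (n + 1) w (Icc 0 1) with hg
  have hgc : ContinuousOn g (Icc 0 1) :=
    hw.continuousOn_iteratedDerivWithin le_rfl (uniqueDiffOn_Icc one_pos)
  have hpr : ∀ i ≤ n + 1, EqOn (prim^[i] g) (iteratedDerivWithin (n + 1 - i) w (Icc 0 1)) (Icc 0 1) :=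
    fun i hi => prim_iterate_iteratedDerivWithin hw (fun j hj => (h0 j hj).1) hi
  have hgw : EqOn (prim^[n + 1] g) w (Icc 0 1) := by
    have := hpr (n + 1) le_rfl
    simpa using this
  have hgL := memLp_of_continuousOn hgc
  set gL : L2Unit := hgL.toLp _ with hgLdef
  have hgae : gL =ᵐ[volume.restrict (Ioo (0 : ℝ) 1)] g := hgL.coeFn_toLp
  -- The moments of `g` are the values at `1` of the lower derivatives of `w`, which vanish.
  have hmem : gL ∈ (polySpan n)ᗮ := by
    rw [mem_polySpan_orthogonal]
    intro i hi
    have e : ∫ x in Ioo (0 : ℝ) 1, gL x * coprim^[i] (fun _ => 1) x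
        = ∫ x in Ioo (0 : ℝ) 1, g x * coprim^[i] (fun _ => 1) x := by
      refine integral_congr_ae ?_
      filter_upwards [hgae] with x hx
      rw [hx]
    rw [e, ← prim_iterate_succ_one (integrableOn_of_continuousOn hgc),
      hpr (i + 1) hi (right_mem_Icc.2 zero_le_one)]
    exact (h0 _ (by omega)).2
  have hgLw : EqOn (prim^[n + 1] gL) w (Icc 0 1) := (prim_iterate_congr_ae hgae n).trans hgw
  set gK : (polySpan n)ᗮ := ⟨gL, hmem⟩ with hgK
  -- For an eigenvector `h` with `μ ≠ 0`, `μ` times its inner product with `gK` is the weighted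
  -- integral of `X w`, zero by `hort`. Injectivity of `greenOp` excludes `μ = 0`, and the spectral
  -- theorem then forces `gK = 0`.
  have hperp : gK ∈ (⨆ μ, Module.End.eigenspace (greenOp hm : Module.End ℝ (polySpan n)ᗮ) μ)ᗮ := by
    rw [← Submodule.iInf_orthogonal, Submodule.mem_iInf]
    intro μ
    rw [Submodule.mem_orthogonal]
    intro h hh
    have hT : greenOp hm h = μ • h := Module.End.mem_eigenspace_iff.1 hh
    by_cases hh0 : h = 0
    · rw [hh0, inner_zero_left]
    have hμ : μ ≠ 0 := by
      rintro rfl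
      rw [zero_smul] at hT
      exact hh0 (eq_zero_of_greenOp_eq_zero hm hT)
    obtain ⟨X, hX, hXh⟩ := exists_isEigenfunction hm hμ hT
    have hne : ∃ x ∈ Ioo (0 : ℝ) 1, X x ≠ 0 := by
      by_contra hcon
      push Not at hcon
      refine hh0 (Subtype.ext ?_)
      rw [Submodule.coe_zero, Lp.eq_zero_iff_ae_eq_zero]
      refine ae_eq_zero_of_prim_iterate_ae_eq_zero (integrableOn_coe _) (n + 1) ?_
      filter_upwards [ae_restrict_mem measurableSet_Ioo] with x hx
      rw [← hXh (Ioo_subset_Icc_self hx), hcon x hx, Pi.zero_apply]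
    have h1 := inner_greenOp hm h gK
    rw [hT, inner_smul_left, inner_weightedPrim] at h1
    have h2 : ∫ x in Ioo (0 : ℝ) 1, x ^ (-m) * prim^[n + 1] (h : L2Unit) x *
        prim^[n + 1] (gK : L2Unit) x = ∫ x in Ioo (0 : ℝ) 1, x ^ (-m) * X x * w x := by
      refine setIntegral_congr_fun measurableSet_Ioo fun x hx => ?_
      simp only [hgK, hXh (Ioo_subset_Icc_self hx), hgLw (Ioo_subset_Icc_self hx)]
    rw [h2, hort _ X hX hne] at h1
    exact (mul_eq_zero.1 h1).resolve_left (by simpa using hμ)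
  rw [ContinuousLinearMap.orthogonalComplement_iSup_eigenspaces_eq_bot
    (isCompactOperator_greenOp hm) (isSymmetric_greenOp hm), Submodule.mem_bot] at hperp
  have hgL0 : gL = 0 := congrArg Subtype.val hperp
  have hgae0 : gL =ᵐ[volume.restrict (Ioo (0 : ℝ) 1)] fun _ => 0 :=
    (Lp.eq_zero_iff_ae_eq_zero).1 hgL0
  intro x hx
  rw [← hgLw hx, prim_iterate_congr_ae hgae0 n hx]
  have := abs_prim_iterate_le (f := fun _ => (0 : ℝ)) (C := 0) (by simp) (n + 1) x hx
  rw [zero_mul] at this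
  exact abs_nonpos_iff.1 this

/-! ### The two directions of the theorem -/

section

variable {k : ℕ} {m α β a b : ℝ}

/-- Completeness is applied at each fixed `y` to the difference of two solutions, all of whose
coefficients vanish. -/
lemma atMostOneSolution_of_Delta_ne_zero (hk : 1 ≤ k) (hmk : m < k) (hα0 : 0 < α) (hα1 : α < 1)
    (hβ1 : 1 < β) (hβ2 : β < 2) (ha : 0 < a) (hb : 0 < b)
    (hΔ : ∀ lam : ℝ, IsEigenvalue k m lam → Delta α β a b lam ≠ 0) (φ : ℝ → ℝ) :
    AtMostOneSolution k m α β a b φ := by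
  intro u v hu hv x hx y hy
  have hw := hu.add_const_mul hk ha hb hv (-1)
  have hφ : (fun x => φ x + -1 * φ x) = fun _ => (0 : ℝ) := by ext; ring
  rw [hφ] at hw
  have h := eq_zero_of_forall_eigenfunction hk hmk
    ((hw.contDiff_x y hy).of_le (by exact_mod_cast (by omega : k ≤ 2 * k - 1)))
    (fun j hj => hw.boundary j hj y hy)
    (fun lam X hX hne => coeff_eq_zero hk hmk hα0 hα1 hβ1 hβ2 ha hb hX hw
      (hΔ lam (isEigenvalue_iff.2 ⟨X, hX, hne⟩)) y hy) x hx
  linarith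

/-- If `Δ` vanished, adding the separated solution to `u` would keep the data but change the value
at `y = 0`, where the profile equals `1`. -/
lemma Delta_ne_zero_of_atMostOneSolution (hk : 1 ≤ k) (hm0 : 0 ≤ m) (hmk : m < k) (hα0 : 0 < α)
    (hα1 : α < 1) (hβ1 : 1 < β) (hβ2 : β < 2) (ha : 0 < a) (hb : 0 < b) {φ : ℝ → ℝ}
    {u : ℝ → ℝ → ℝ} (hu : IsSolution k m α β a b φ u) (huniq : AtMostOneSolution k m α β a b φ)
    (lam : ℝ) (hlam : IsEigenvalue k m lam) : Delta α β a b lam ≠ 0 := by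
  intro hΔ
  obtain ⟨X, hX, x, hx, hne⟩ := isEigenvalue_iff.1 hlam
  have hv := isSolution_profile_mul hk hm0 hmk hα0 hα1 hβ1 hβ2 ha hb hX hΔ
  have hw := hu.add_const_mul hk ha hb hv 1
  have hφ : (fun x => φ x + 1 * 0) = φ := by ext; ring
  rw [hφ] at hw
  have h := huniq _ _ hu hw x (Ioo_subset_Icc_self hx) 0 ⟨by linarith, hb.le⟩
  simp only [profile_of_pos le_rfl, posProfile_zero hα0] at h
  exact hne (by linarith)

end

end ProblemD
end

theorem mainTheorem2 (k : ℕ) (m α β a b : ℝ)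
    (hm0 : 0 ≤ m) (hmk : m < k) (hmN : ∀ j : ℕ, 1 ≤ j → m ≠ j)
    (hα0 : 0 < α) (hα1 : α < 1) (hβ1 : 1 < β) (hβ2 : β < 2)
    (ha : 0 < a) (hb : 0 < b) :
    ((∀ φ : ℝ → ℝ, ProblemD.AtMostOneSolution k m α β a b φ) ↔
      ∀ lam : ℝ, ProblemD.IsEigenvalue k m lam → ProblemD.Delta α β a b lam ≠ 0) ∧
    (∀ φ : ℝ → ℝ, (∃ u : ℝ → ℝ → ℝ, ProblemD.IsSolution k m α β a b φ u) →
      (ProblemD.AtMostOneSolution k m α β a b φ ↔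
        ∀ lam : ℝ, ProblemD.IsEigenvalue k m lam → ProblemD.Delta α β a b lam ≠ 0)) := by
  have hk : 1 ≤ k := by
    rcases Nat.eq_zero_or_pos k with rfl | h
    · simp only [Nat.cast_zero] at hmk; linarith
    · exact h
  have h1 := ProblemD.atMostOneSolution_of_Delta_ne_zero (a := a) (b := b) hk hmk hα0 hα1 hβ1 hβ2
    ha hb
  refine ⟨⟨fun h => ?_, fun h φ => h1 h φ⟩, fun φ ⟨u, hu⟩ => ⟨fun h => ?_, fun h => h1 h φ⟩⟩
  · intro lam hlam hΔ
    -- No solution is given here, but under `Δ = 0` the separated solution is itself one with zero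
    -- data, so uniqueness for that data is contradicted.
    obtain ⟨X, hX, -⟩ := ProblemD.isEigenvalue_iff.1 hlam
    exact ProblemD.Delta_ne_zero_of_atMostOneSolution hk hm0 hmk hα0 hα1 hβ1 hβ2 ha hb
      (ProblemD.isSolution_profile_mul hk hm0 hmk hα0 hα1 hβ1 hβ2 ha hb hX hΔ) (h _) lam hlam hΔ
  · exact ProblemD.Delta_ne_zero_of_atMostOneSolution hk hm0 hmk hα0 hα1 hβ1 hβ2 ha hb hu h
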